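/- Let $\Lambda\subset\mathbb R^{2d}$ be a lattice (a discrete subgroup of full rank) and let $\mathcal A$ be a solid involutive Banach algebra of sequences on $\Lambda$ with respect to convolution. That is, $\mathcal A$ is a Banach space of sequences $\mathbf a:\Lambda\to\mathbb C$ with $\|\mathbf a*\mathbf b\|_{\mathcal A}\le\|\mathbf a\|_{\mathcal A}\|\mathbf b\|_{\mathcal A}$, closed under $\mathbf a^*(\lambda)=\overline{\mathbf a(-\lambda)}$ with $\|\mathbf a^*\|_{\mathcal A}\le\|\mathbf a\|_{\mathcal A}$, such that $|\mathbf a|\le|\mathbf b|$ pointwise and $\mathbf b\in\mathcal A$ imply $\mathbf a\in\mathcal A$ and $\|\mathbf a\|_{\mathcal A}\le\|\mathbf b\|_{\mathcal A}$. Assume that every standard sequence $\delta_\lambda$, $\lambda\in\Lambda$, belongs to $\mathcal A$. Fix a relatively compact fundamental domain $C\ni 0$ of $\Lambda$. The amalgam space $W(\mathcal A)$ consists of the measurable, locally essentially bounded functions $F$ on $\mathbb R^{2d}$ for which the sequence $\lambda\mapsto\operatorname{ess\,sup}_{\lambda+C}|F|$ belongs to $\mathcal A$. Write $\pi(x,\xi)f(t)=e^{2\pi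 i\xi\cdot t}f(t-x)$ and $V_gf(z)=\langle f,\pi(z)g\rangle$. Let $\Psi(u)=e^{-\pi u\cdot u/2}$ on $\mathbb R^{2d}$, and for $\sigma\in\mathcal S'(\mathbb R^{2d})$ put $\mathcal V_\Psi\sigma(z,\zeta)=\langle\sigma,M_\zeta T_z\Psi\rangle$, where $M_\zeta T_z\Psi(u)=e^{2\pi i\zeta\cdot u}\Psi(u-z)$. The grand symbol is $\mathcal G(\sigma)(\zeta)=\operatorname{ess\,sup}_{z}|\mathcal V_\Psi\sigma(z,\zeta)|$. With $j(\zeta_1,\zeta_2)=(\zeta_2,-\zeta_1)$, let $\widetilde M^{\infty,\mathcal A}$ be the set of $\sigma\in\mathcal S'(\mathbb R^{2d})$ with $\mathcal G(\sigma)\circ j\in W(\mathcal A)$. Let $M^\infty(\mathbb R^{2d})$ be the set of $\sigma\in\mathcal S'(\mathbb R^{2d})$ with $\mathcal V_\Psi\sigma$ bounded. Let $M^1(\mathbb R^d)$ be the set of $f\in L^2(\mathbb R^d)$ with $V_\varphi f\in L^1(\mathbb R^{2d})$, where $\varphi(t)=e^{-\pi t\cdot t}$. The Weyl transform is given by $\langle\sigma^wf,h\rangle=\langle\sigma,W(h,f)\rangle$,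 where $W(h,f)(x,\xi)=\int h(x+\tfrac t2)\overline{f(x-\tfrac t2)}e^{-2\pi it\cdot\xi}\,dt$. This number is defined for every $\sigma\in\mathcal S'(\mathbb R^{2d})$ if $f,h\in\mathcal S(\mathbb R^d)$. It is also defined if $\sigma\in M^\infty(\mathbb R^{2d})$ and $f,h\in M^1(\mathbb R^d)$, through the duality $\langle\sigma,\Phi\rangle=\iint\mathcal V_\Psi\sigma\,\overline{\mathcal V_\Psi\Phi}\,dz\,d\zeta$ (note that $\|\Psi\|_2=1$). Let $g\in L^2(\mathbb R^d)$ satisfy $V_gg\in W(\mathcal A)$, and let $\{\pi(\lambda)g:\lambda\in\Lambda\}$ be a tight Gabor frame with constant 1, i.e. $\|f\|_2^2=\sum_{\lambda\in\Lambda}|\langle f,\pi(\lambda)g\rangle|^2$ for all $f\in L^2(\mathbb R^d)$. Then the following are equivalent for $\sigma\in\mathcal S'(\mathbb R^{2d})$. (i) $\sigma\in\widetilde M^{\infty,\mathcal A}$. (ii) There is a function $H\in W(\mathcal A)$ such that, for all $z,w\in\mathbb R^{2d}$, the number $\langle\sigma^w\pi(z)g,\pi(w)g\rangle$ is defined and $|\langle\sigma^w\pi(z)g,\pi(w)g\rangle|\le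 H(w-z)$. (iii) There is a sequence $\mathbf h\in\mathcal A$ such that, for all $\lambda,\mu\in\Lambda$, the number $\langle\sigma^w\pi(\mu)g,\pi(\lambda)g\rangle$ is defined and $|\langle\sigma^w\pi(\mu)g,\pi(\lambda)g\rangle|\le\mathbf h(\lambda-\mu)$. -/

import Mathlib

open MeasureTheory Filter Topology SchwartzMap
open scoped ENNReal RealInnerProductSpace ComplexConjugate

noncomputable section

/-! ### Solid involutive Banach algebras of sequences under convolution -/

/-- The convolution `(a * b)(l) = ∑ₘ a(m) b(l - m)` of two sequences on an abelian group. -/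
def seqConv {G : Type*} [AddCommGroup G] (a b : G → ℂ) : G → ℂ :=
  fun l => ∑' m, a m * b (l - m)

/-- A solid involutive Banach algebra of sequences on the discrete abelian group `G`, with respect
to convolution and the involution `a*(l) = conj (a (-l))`, containing all the standard sequences
`δ_l`.  `nrm` is the norm; only its values on `carrier` matter. -/
structure SolidConvAlgebra (G : Type*) [AddCommGroup G] where
  /-- the sequences that belong to the algebra -/
  carrier : Submodule ℂ (G → ℂ)
  /-- the norm -/
  nrm : (G → ℂ) → ℝ
  nrm_nonneg : ∀ a ∈ carrier, 0 ≤ nrm a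
  eq_zero_of_nrm_eq_zero : ∀ a ∈ carrier, nrm a = 0 → a = 0
  nrm_add_le : ∀ a ∈ carrier, ∀ b ∈ carrier, nrm (a + b) ≤ nrm a + nrm b
  nrm_smul : ∀ (c : ℂ), ∀ a ∈ carrier, nrm (c • a) = ‖c‖ * nrm a
  complete : ∀ u : ℕ → G → ℂ, (∀ n, u n ∈ carrier) →
    (∀ ε > 0, ∃ N, ∀ m ≥ N, ∀ n ≥ N, nrm (u m - u n) < ε) →
    ∃ a ∈ carrier, Tendsto (fun n => nrm (u n - a)) atTop (𝓝 0)
  conv_summable : ∀ a ∈ carrier, ∀ b ∈ carrier, ∀ l, Summable fun m => a m * b (l - m)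
  conv_mem : ∀ a ∈ carrier, ∀ b ∈ carrier, seqConv a b ∈ carrier
  nrm_conv_le : ∀ a ∈ carrier, ∀ b ∈ carrier, nrm (seqConv a b) ≤ nrm a * nrm b
  star_mem : ∀ a ∈ carrier, (fun l => conj (a (-l))) ∈ carrier
  nrm_star_le : ∀ a ∈ carrier, nrm (fun l => conj (a (-l))) ≤ nrm a
  solid_mem : ∀ a : G → ℂ, ∀ b ∈ carrier, (∀ l, ‖a l‖ ≤ ‖b l‖) → a ∈ carrier
  nrm_solid_le : ∀ a : G → ℂ, ∀ b ∈ carrier, (∀ l, ‖a l‖ ≤ ‖b l‖) → nrm a ≤ nrm b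
  delta_mem : ∀ l : G, Set.indicator {l} (fun _ => (1 : ℂ)) ∈ carrier

/-! ### Phase space and amalgam spaces -/

/-- Configuration space `ℝᵈ`. -/
abbrev Conf (d : ℕ) := EuclideanSpace ℝ (Fin d)

/-- Phase space `ℝ²ᵈ = ℝᵈ × ℝᵈ`, with points `z = (x, ξ)`.  Only its topology, its Lebesgue measure
and its linear structure are used; scalar products are written out below. -/
abbrev Phase (d : ℕ) := Conf d × Conf d

/-- The scalar product `z · ζ` on phase space. -/
def phaseDot {d : ℕ} (z ζ : Phase d) : ℝ := ⟪z.1, ζ.1⟫ + ⟪z.2, ζ.2⟫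

/-- `j(ζ₁, ζ₂) = (ζ₂, -ζ₁)`. -/
def symplJ {d : ℕ} (ζ : Phase d) : Phase d := (ζ.2, -ζ.1)

/-- The local suprema `a(l) = ess sup_{l + C} F` of a nonnegative function. -/
def localSup {d : ℕ} (Λ : Submodule ℤ (Phase d)) (C : Set (Phase d)) (F : Phase d → ℝ≥0∞)
    (l : Λ) : ℝ≥0∞ :=
  essSup F (volume.restrict ((fun u => (l : Phase d) + u) '' C))

/-- Membership in the amalgam space `W(𝒜)`, expressed through the absolute value `F` of the
function: `F` is measurable, locally essentially bounded, and its sequence of local suprema belongs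
to `𝒜`. -/
structure MemAmalgam {d : ℕ} {Λ : Submodule ℤ (Phase d)} (𝒜 : SolidConvAlgebra Λ)
    (C : Set (Phase d)) (F : Phase d → ℝ≥0∞) : Prop where
  aemeasurable : AEMeasurable F volume
  localSup_lt_top : ∀ l, localSup Λ C F l < ∞
  localSup_mem : (fun l => ((localSup Λ C F l).toReal : ℂ)) ∈ 𝒜.carrier

/-! ### Time-frequency shifts, short-time Fourier transform, Gabor frames on `ℝᵈ` -/

/-- The time-frequency shift `π(x, ξ) f(t) = e^{2πi ξ·t} f(t - x)`. -/
def tfShift {d : ℕ} (z : Phase d) (f : Conf d → ℂ) : Conf d → ℂ :=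
  fun t => Complex.exp (2 * Real.pi * Complex.I * (⟪z.2, t⟫ : ℝ)) * f (t - z.1)

/-- The short-time Fourier transform `V_g f(z) = ⟨f, π(z) g⟩`. -/
def stft {d : ℕ} (g f : Conf d → ℂ) (z : Phase d) : ℂ :=
  ∫ t, f t * conj (tfShift z g t)

/-- `{π(l) g : l ∈ Λ}` is a tight Gabor frame (with constant 1) for `L²(ℝᵈ)`. -/
def IsTightGaborFrame {d : ℕ} (Λ : Submodule ℤ (Phase d)) (g : Conf d → ℂ) : Prop :=
  ∀ f : Conf d → ℂ, MemLp f 2 →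
    HasSum (fun l : Λ => ‖stft g f (l : Phase d)‖ ^ 2) (∫ t, ‖f t‖ ^ 2)

/-- The Gaussian `φ(t) = e^{-π t·t}` on `ℝᵈ`. -/
def gaussConf {d : ℕ} (t : Conf d) : ℂ := Complex.exp (-(Real.pi * ‖t‖ ^ 2 : ℝ))

/-- The modulation space `M¹(ℝᵈ)`. -/
def MemM1 {d : ℕ} (f : Conf d → ℂ) : Prop :=
  MemLp f 2 ∧ Integrable (stft gaussConf f)

/-! ### The Gaussian window on phase space -/

/-- The exponent of `conj (M_ζ T_z Ψ)`, where `Ψ(u) = e^{-π u·u/2}`. -/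
def atomExponent {d : ℕ} (z ζ u : Phase d) : ℂ :=
  ((-(Real.pi / 2 * phaseDot (u - z) (u - z)) : ℝ) : ℂ)
    - ((2 * Real.pi * phaseDot ζ u : ℝ) : ℂ) * Complex.I

theorem atomExponent_hasTemperateGrowth {d : ℕ} (z ζ : Phase d) :
    (atomExponent z ζ).HasTemperateGrowth := by
  have h1 : Function.HasTemperateGrowth (fun u : Phase d => (u - z).1) :=
    (ContinuousLinearMap.fst ℝ (Conf d) (Conf d)).hasTemperateGrowth.comp
      (Function.HasTemperateGrowth.id'.sub (Function.HasTemperateGrowth.const z))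
  have h2 : Function.HasTemperateGrowth (fun u : Phase d => (u - z).2) :=
    (ContinuousLinearMap.snd ℝ (Conf d) (Conf d)).hasTemperateGrowth.comp
      (Function.HasTemperateGrowth.id'.sub (Function.HasTemperateGrowth.const z))
  have h3 : Function.HasTemperateGrowth
      (fun u : Phase d => -(Real.pi / 2 * phaseDot (u - z) (u - z))) := by
    have e : (fun u : Phase d => -(Real.pi / 2 * phaseDot (u - z) (u - z))) =
        fun u => (-(Real.pi / 2)) * (‖(u - z).1‖ ^ 2 + ‖(u - z).2‖ ^ 2) := by
      funext u
      simp only [phaseDot, real_inner_self_eq_norm_sq]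
      ring
    rw [e]
    exact (Function.HasTemperateGrowth.const _).mul
      (((Function.hasTemperateGrowth_norm_sq (Conf d)).comp h1).add
        ((Function.hasTemperateGrowth_norm_sq (Conf d)).comp h2))
  have h4 : Function.HasTemperateGrowth (fun u : Phase d => 2 * Real.pi * phaseDot ζ u) := by
    refine (Function.HasTemperateGrowth.const _).mul (Function.HasTemperateGrowth.add ?_ ?_)
    · exact ((innerSL ℝ ζ.1).comp
        (ContinuousLinearMap.fst ℝ (Conf d) (Conf d))).hasTemperateGrowth
    · exact ((innerSL ℝ ζ.2).comp
        (ContinuousLinearMap.snd ℝ (Conf d) (Conf d))).hasTemperateGrowth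
  exact (Function.Complex.hasTemperateGrowth_ofReal.comp h3).sub
    ((Function.Complex.hasTemperateGrowth_ofReal.comp h4).mul (Function.HasTemperateGrowth.const _))

theorem norm_iteratedFDeriv_cexp_le (n : ℕ) (w : ℂ) :
    ‖iteratedFDeriv ℝ n Complex.exp w‖ ≤ ‖Complex.exp w‖ := by
  induction n with
  | zero => simp
  | succ n ih =>
    let L : ℂ →L[ℝ] (ℂ →L[ℝ] ℂ) := ContinuousLinearMap.mul ℝ ℂ
    have e : fderiv ℝ Complex.exp = L ∘ Complex.exp := by
      funext v
      have h : HasFDerivAt Complex.exp (L (Complex.exp v)) v := by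
        have h0 := (Complex.hasDerivAt_exp v).hasFDerivAt.restrictScalars ℝ
        have h2 : (ContinuousLinearMap.toSpanSingleton ℂ (Complex.exp v)).restrictScalars ℝ =
            L (Complex.exp v) := by
          (ext; simp [L, mul_comm])
        exact h2 ▸ h0
      exact h.fderiv
    rw [← norm_iteratedFDeriv_fderiv, e]
    refine (L.norm_iteratedFDeriv_comp_left (N := n)
      Complex.contDiff_exp.contDiffAt le_rfl).trans ?_
    have hL : ‖L‖ ≤ 1 := ContinuousLinearMap.opNorm_mul_le ℝ ℂ
    calc ‖L‖ * ‖iteratedFDeriv ℝ n Complex.exp w‖ ≤ 1 * ‖Complex.exp w‖ := by gcongr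
      _ = _ := one_mul _

theorem exp_atomExponent_decay {d : ℕ} (z ζ : Phase d) (k n : ℕ) :
    ∃ M : ℝ, ∀ u, ‖u‖ ^ k *
      ‖iteratedFDeriv ℝ n (fun v => Complex.exp (atomExponent z ζ v)) u‖ ≤ M := by
  have hf := atomExponent_hasTemperateGrowth z ζ
  obtain ⟨m, K, hK0, hK⟩ := hf.norm_iteratedFDeriv_le_uniform n
  refine ⟨n.factorial * (K + 1) ^ n * ((1 + ‖z‖) ^ (k + m * n) *
    ((k + m * n).factorial * Real.exp 2)), fun u => ?_⟩
  have hD : ∀ i, 1 ≤ i → i ≤ n →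
      ‖iteratedFDeriv ℝ i (atomExponent z ζ) u‖ ≤ ((K + 1) * (1 + ‖u‖) ^ m) ^ i := by
    intro i hi hin
    have hone : (1 : ℝ) ≤ (1 + ‖u‖) ^ m := one_le_pow₀ (by linarith [norm_nonneg u])
    have h1 : (1 : ℝ) ≤ (K + 1) * (1 + ‖u‖) ^ m := by nlinarith
    calc ‖iteratedFDeriv ℝ i (atomExponent z ζ) u‖ ≤ K * (1 + ‖u‖) ^ m := hK i hin u
      _ ≤ (K + 1) * (1 + ‖u‖) ^ m := by nlinarith
      _ ≤ _ := le_self_pow₀ h1 (by omega)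
  have h1 := norm_iteratedFDeriv_comp_le (𝕜 := ℝ) (N := n) Complex.contDiff_exp
    (hf.1.of_le (by exact_mod_cast le_top)) le_rfl u
    (fun i _ => norm_iteratedFDeriv_cexp_le i (atomExponent z ζ u)) hD
  have hnorm : ‖Complex.exp (atomExponent z ζ u)‖ ≤ Real.exp (-‖u - z‖ ^ 2) := by
    rw [Complex.norm_exp]
    apply Real.exp_le_exp.mpr
    have hre : (atomExponent z ζ u).re = -(Real.pi / 2 * phaseDot (u - z) (u - z)) := by
      simp only [atomExponent, Complex.sub_re, Complex.ofReal_re, Complex.re_ofReal_mul,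
        Complex.I_re, mul_zero, sub_zero]
    have hp : ‖u - z‖ ^ 2 ≤ phaseDot (u - z) (u - z) := by
      simp only [phaseDot, real_inner_self_eq_norm_sq]
      rw [Prod.norm_def]
      rcases max_choice ‖(u - z).1‖ ‖(u - z).2‖ with h | h <;> rw [h]
      · linarith [sq_nonneg ‖(u - z).2‖]
      · linarith [sq_nonneg ‖(u - z).1‖]
    rw [hre]
    nlinarith [Real.two_le_pi, sq_nonneg ‖u - z‖]
  set s := ‖u - z‖ with hs
  have hs0 : 0 ≤ s := norm_nonneg _
  have hu : 1 + ‖u‖ ≤ (1 + ‖z‖) * (1 + s) := by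
    have h : ‖u‖ ≤ s + ‖z‖ := by
      simpa using norm_add_le (u - z) z
    nlinarith [norm_nonneg z]
  have hpow : (1 + s) ^ (k + m * n) ≤ (k + m * n).factorial * Real.exp (1 + s) := by
    have h := Real.pow_div_factorial_le_exp (1 + s) (by linarith) (k + m * n)
    rw [div_le_iff₀ (by positivity)] at h
    linarith
  have hexp : Real.exp (1 + s) * Real.exp (-s ^ 2) ≤ Real.exp 2 := by
    rw [← Real.exp_add]
    exact Real.exp_le_exp.mpr (by nlinarith [sq_nonneg (s - 1 / 2)])
  calc ‖u‖ ^ k * ‖iteratedFDeriv ℝ n (fun v => Complex.exp (atomExponent z ζ v)) u‖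
      ≤ (1 + ‖u‖) ^ k * (n.factorial * Real.exp (-s ^ 2) * ((K + 1) * (1 + ‖u‖) ^ m) ^ n) := by
        gcongr
        · linarith
        · exact h1.trans (by gcongr)
    _ = n.factorial * (K + 1) ^ n * ((1 + ‖u‖) ^ (k + m * n) * Real.exp (-s ^ 2)) := by
        rw [mul_pow, ← pow_mul, pow_add]; ring
    _ ≤ n.factorial * (K + 1) ^ n *
        (((1 + ‖z‖) * (1 + s)) ^ (k + m * n) * Real.exp (-s ^ 2)) := by gcongr
    _ = n.factorial * (K + 1) ^ n *
        ((1 + ‖z‖) ^ (k + m * n) * ((1 + s) ^ (k + m * n) * Real.exp (-s ^ 2))) := by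
        rw [mul_pow]; ring
    _ ≤ n.factorial * (K + 1) ^ n * ((1 + ‖z‖) ^ (k + m * n) *
        ((k + m * n).factorial * Real.exp (1 + s) * Real.exp (-s ^ 2))) := by gcongr
    _ = n.factorial * (K + 1) ^ n * ((1 + ‖z‖) ^ (k + m * n) *
        ((k + m * n).factorial * (Real.exp (1 + s) * Real.exp (-s ^ 2)))) := by ring
    _ ≤ _ := by gcongr

/-- The Schwartz function `u ↦ conj (M_ζ T_z Ψ (u)) = e^{-2πi ζ·u} Ψ(u - z)` on phase space, with
the Gaussian window `Ψ(u) = e^{-π u·u/2}`. -/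
def gaussAtomConj {d : ℕ} (z ζ : Phase d) : 𝓢(Phase d, ℂ) where
  toFun u := Complex.exp (atomExponent z ζ u)
  smooth' := (atomExponent_hasTemperateGrowth z ζ).1.cexp
  decay' := exp_atomExponent_decay z ζ

/-! ### Symbols -/

/-- The short-time Fourier transform `𝒱_Ψ σ(z, ζ) = ⟨σ, M_ζ T_z Ψ⟩` of a tempered distribution with
respect to the Gaussian window `Ψ`.  (The bracket is antilinear in its second argument.) -/
def symbolSTFT {d : ℕ} (σ : 𝓢'(Phase d, ℂ)) (z ζ : Phase d) : ℂ :=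
  σ (gaussAtomConj z ζ)

/-- The same transform `𝒱_Ψ Φ(z, ζ)` of a function `Φ` on phase space. -/
def funSTFT {d : ℕ} (Φ : Phase d → ℂ) (z ζ : Phase d) : ℂ :=
  ∫ u, Φ u * gaussAtomConj z ζ u

/-- The grand symbol `𝒢(σ)(ζ) = ess sup_z |𝒱_Ψ σ(z, ζ)|`. -/
def grandSymbol {d : ℕ} (σ : 𝓢'(Phase d, ℂ)) (ζ : Phase d) : ℝ≥0∞ :=
  essSup (fun z => ‖symbolSTFT σ z ζ‖ₑ) volume

/-- The generalized Sjöstrand class `M̃^{∞,𝒜}`: all `σ` with `𝒢(σ) ∘ j ∈ W(𝒜)`. -/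
def MemSjostrand {d : ℕ} {Λ : Submodule ℤ (Phase d)} (𝒜 : SolidConvAlgebra Λ)
    (C : Set (Phase d)) (σ : 𝓢'(Phase d, ℂ)) : Prop :=
  MemAmalgam 𝒜 C (fun ζ => grandSymbol σ (symplJ ζ))

/-- The modulation space `M^∞(ℝ²ᵈ)`. -/
def MemMInfty {d : ℕ} (σ : 𝓢'(Phase d, ℂ)) : Prop :=
  ∃ K : ℝ, ∀ z ζ, ‖symbolSTFT σ z ζ‖ ≤ K

/-! ### The Weyl calculus -/

/-- The Wigner distribution
`W(f, h)(x, ξ) = ∫ f(x + t/2) conj (h(x - t/2)) e^{-2πi t·ξ} dt`. -/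
def wigner {d : ℕ} (f h : Conf d → ℂ) (p : Phase d) : ℂ :=
  ∫ t, f (p.1 + (1 / 2 : ℝ) • t) * conj (h (p.1 - (1 / 2 : ℝ) • t)) *
    Complex.exp (-(2 * Real.pi * Complex.I * (⟪t, p.2⟫ : ℝ)))

/-- `IsWeylEntry σ f h c`: the number `⟨σ^w f, h⟩ = ⟨σ, W(h, f)⟩` is defined and equal to `c`.
It is defined for all `σ ∈ 𝒮'` when `f` and `h` are Schwartz functions, by the
action of `σ` on the Schwartz function `conj W(h, f)`.  It is also defined for `σ ∈ M^∞` and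
`f, h ∈ M¹`, by the duality bracket of `M^∞` and `M¹`,
`⟨σ, Φ⟩ = ∬ 𝒱_Ψ σ conj (𝒱_Ψ Φ)` (no constant is needed since `‖Ψ‖₂ = 1`), which
extends the bracket of `𝒮'` and `𝒮`. -/
def IsWeylEntry {d : ℕ} (σ : 𝓢'(Phase d, ℂ)) (f h : Conf d → ℂ) (c : ℂ) : Prop :=
  (∃ f₀ h₀ : 𝓢(Conf d, ℂ), f =ᵐ[volume] f₀ ∧ h =ᵐ[volume] h₀ ∧
    ∃ Φ : 𝓢(Phase d, ℂ), (∀ p, Φ p = conj (wigner h₀ f₀ p)) ∧ c = σ Φ) ∨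
  (MemMInfty σ ∧ MemM1 f ∧ MemM1 h ∧
    c = ∫ p : Phase d × Phase d,
      symbolSTFT σ p.1 p.2 * conj (funSTFT (wigner h f) p.1 p.2))

end

noncomputable section

open scoped NNReal Pointwise

/-! ### Elementary properties of solid convolution algebras -/

/-! Let φ be the Gaussian on `ℝᵈ` and F = |V_φ g|. One formula links symbols and Gabor matrices. The
window Ψ is a Gaussian average of translates of the narrower Gaussian e^{-2π|u|²}, which is a
multiple of the Wigner distribution of φ. Moyal's identity therefore expresses 𝒱_Ψ W(h,f)(p, jD) as
a constant times a Gaussian average over v of V_φ h(p+v+D/2) · conj V_φ f(p+v-D/2), up to phases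
(`funSTFT_wigner`). The two arguments differ by exactly D, which is why j enters the definition of
the symbol class.

From symbol to matrix: for h = π(w)g and f = π(z)g, integration over p turns the average into the
autocorrelation of F at w-z-D. Pairing with 𝒱_Ψσ bounds the matrix entry by a constant times the
convolution of 𝒢(σ)∘j with that autocorrelation, evaluated at w-z (`AEDom.exists_entry_bound`).

From matrix to symbol: polarising the frame identity in both factors shows that the distributions
W(π(k+u)g, π(m)g), with k, m in Λ, satisfy a Parseval identity when tested on Gaussian atoms
(`IsTightGaborFrame.hasSum_funSTFT_wigner`). Hence 𝒱_Ψσ(z, jD) is the sum of the matrix entries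
times the transforms of these distributions (`hasSum_symbolSTFT`). Inserting |entry| ≤ h(k-m) leaves
a double lattice sum of the type F * h * F whose size depends on D alone, so the bound is uniform in
z (`dom_grandSymbol`).

Three facts support these estimates. First, F itself must be dominated by a sequence of 𝒜, although
only V_g g is assumed to be. The orthogonality relations dominate F by |V_g g| convolved with a
Gaussian (`dom_stft_gauss`), and Gaussians belong to the amalgam space because ‖δ_l‖ grows at most
exponentially in |l| (`dom_gaussian`). Second, 𝒜 is contained in ℓ¹
(`SolidConvAlgebra.Has.summable`), which gives integrability and boundedness. Third, the 𝒮'–𝒮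
bracket and the M^∞–M¹ bracket are the same integral (`tempered_eq_integral_symbolSTFT`), so it does
not matter which of the two defines an entry.

Two difficulties remain for the converse. The symbol is a priori only tempered, so convergence of
the reconstruction is secured with polynomial weights. In (ii) the function H is controlled only
almost everywhere, so the matrix is sampled on a generically shifted lattice; this is the role of
the shift u. -/

/-- By commutativity an n-fold sum is determined by the multiplicities of the elements of S, so for
fixed S the sumsets grow only polynomially in n. -/
theorem card_nsmul_finset_le {G : Type*} [AddCommGroup G] [DecidableEq G] (S : Finset G) (n : ℕ) :
    (n • S).card ≤ (n + 1) ^ S.card := by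
  classical
  have hsub : n • S ⊆ Finset.image (fun c : S → Fin (n + 1) => ∑ s, (c s : ℕ) • (s : G))
      Finset.univ := by
    intro x hx
    have key : ∀ m : ℕ, ∀ y ∈ m • S, ∃ c : S → ℕ, (∀ s, c s ≤ m) ∧ y = ∑ s, c s • (s : G) := by
      intro m
      induction m with
      | zero =>
        intro y hy
        refine ⟨fun _ => 0, fun _ => le_rfl, ?_⟩
        simpa using hy
      | succ m ih =>
        intro y hy
        rw [succ_nsmul, Finset.mem_add] at hy
        obtain ⟨u, hu, t, ht, rfl⟩ := hy
        obtain ⟨c, hc, rfl⟩ := ih u hu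
        refine ⟨fun s => c s + if s = ⟨t, ht⟩ then 1 else 0, fun s => ?_, ?_⟩
        · have := hc s
          dsimp only
          split_ifs <;> omega
        · simp [add_smul, Finset.sum_add_distrib]
    obtain ⟨c, hc, rfl⟩ := key n x hx
    refine Finset.mem_image.2 ⟨fun s => ⟨c s, Nat.lt_succ_of_le (hc s)⟩, Finset.mem_univ _, rfl⟩
  refine (Finset.card_le_card hsub).trans (Finset.card_image_le.trans ?_)
  simp

/-- The power trick: a factor polynomial in n disappears on taking roots of order 2(n+1). -/
theorem le_of_pow_le_poly_mul_pow {s M C : ℝ} (hM : 0 ≤ M) (k : ℕ)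
    (h : ∀ n : ℕ, s ^ (2 * (n + 1)) ≤ C * ((n : ℝ) + 2) ^ k * M ^ (2 * (n + 1))) : s ≤ M := by
  by_contra! hlt
  have hs0 : 0 < s := hM.trans_lt hlt
  set r : ℝ := (M / s) ^ 2 with hr
  have hr0 : 0 ≤ r := by positivity
  have hr1 : r < 1 := by
    rw [hr]; exact pow_lt_one₀ (by positivity) ((div_lt_one hs0).2 hlt) two_ne_zero
  have h1 : ∀ n : ℕ, 1 ≤ C * ((n : ℝ) + 2) ^ k * r ^ (n + 1) := by
    intro n
    have := h n
    rw [hr, ← pow_mul, div_pow, ← mul_div_assoc, le_div_iff₀ (by positivity), one_mul]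
    exact this
  have hC : 0 < C := by
    by_contra! hC
    have := h1 0
    have h2 : C * (((0 : ℕ) : ℝ) + 2) ^ k * r ^ (0 + 1) ≤ 0 := by
      rw [mul_assoc]; exact mul_nonpos_of_nonpos_of_nonneg hC (by positivity)
    linarith
  have hlim := tendsto_pow_const_mul_const_pow_of_abs_lt_one k (by rwa [abs_of_nonneg hr0] : |r| < 1)
  have hlim2 : Tendsto (fun n : ℕ => C * 2 ^ k * (((n + 1 : ℕ) : ℝ) ^ k * r ^ (n + 1))) atTop
      (𝓝 (C * 2 ^ k * 0)) := ((tendsto_add_atTop_iff_nat 1).2 hlim).const_mul _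
  have : (1 : ℝ) ≤ C * 2 ^ k * 0 := by
    refine ge_of_tendsto' hlim2 fun n => (h1 n).trans ?_
    have : ((n : ℝ) + 2) ^ k ≤ 2 ^ k * ((n + 1 : ℕ) : ℝ) ^ k := by
      rw [← mul_pow]; gcongr; push_cast; linarith [(Nat.cast_nonneg n : (0 : ℝ) ≤ n)]
    calc C * ((n : ℝ) + 2) ^ k * r ^ (n + 1) ≤ C * (2 ^ k * ((n + 1 : ℕ) : ℝ) ^ k) * r ^ (n + 1) := by
          gcongr
      _ = _ := by ring
  simp at this
  linarith

namespace SolidConvAlgebra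

variable {G : Type*} [AddCommGroup G] (𝒜 : SolidConvAlgebra G)

/-- The standard sequence `δ_l`. -/
def delta (l : G) : G → ℂ := Set.indicator {l} (fun _ => (1 : ℂ))

/-- A nonnegative sequence belongs to the algebra. -/
def Has (b : G → ℝ≥0) : Prop := (fun l => ((b l : ℝ) : ℂ)) ∈ 𝒜.carrier

variable {𝒜}

theorem Has.mono {a b : G → ℝ≥0} (hb : 𝒜.Has b) (h : ∀ l, a l ≤ b l) : 𝒜.Has a :=
  𝒜.solid_mem _ _ hb fun l => by
    simpa [abs_of_nonneg] using h l

theorem has_of_mem {a : G → ℂ} (ha : a ∈ 𝒜.carrier) : 𝒜.Has (fun l => ‖a l‖₊) :=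
  𝒜.solid_mem _ _ ha fun l => by simp


theorem Has.const_mul {a : G → ℝ≥0} (ha : 𝒜.Has a) (c : ℝ≥0) : 𝒜.Has (fun l => c * a l) := by
  have := 𝒜.carrier.smul_mem ((c : ℝ) : ℂ) ha
  unfold Has
  convert this using 1
  ext l; simp


theorem Has.finset_sum {ι : Type*} (s : Finset ι) {a : ι → G → ℝ≥0} (ha : ∀ i ∈ s, 𝒜.Has (a i)) :
    𝒜.Has (fun l => ∑ i ∈ s, a i l) := by
  have := 𝒜.carrier.sum_mem ha
  unfold Has
  convert this using 1
  ext l; simp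

theorem Has.comp_neg {a : G → ℝ≥0} (ha : 𝒜.Has a) : 𝒜.Has (fun l => a (-l)) := by
  have := 𝒜.star_mem _ ha
  unfold Has
  convert this using 1
  ext l; simp

/-- Stated in `ℝ≥0∞` so that the later convolution estimates need no summability side conditions. -/
theorem Has.conv {a b : G → ℝ≥0} (ha : 𝒜.Has a) (hb : 𝒜.Has b) :
    ∃ c : G → ℝ≥0, 𝒜.Has c ∧ ∀ l, ∑' m, (a m : ℝ≥0∞) * b (l - m) = c l := by
  have hs : ∀ l, Summable fun m => a m * b (l - m) := by
    intro l
    have := (𝒜.conv_summable _ ha _ hb l).norm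
    rw [← NNReal.summable_coe]
    simpa using this
  refine ⟨fun l => ∑' m, a m * b (l - m), ?_, fun l => ?_⟩
  · have := 𝒜.conv_mem _ ha _ hb
    unfold Has
    convert this using 1
    ext l
    simp only [seqConv]
    rw [NNReal.coe_tsum, Complex.ofReal_tsum]
    simp
  · rw [ENNReal.coe_tsum (hs l)]
    simp

omit [AddCommGroup G] in
theorem delta_apply [DecidableEq G] (k l : G) : delta k l = if l = k then 1 else 0 := by
  simp [delta, Set.indicator_apply]

theorem seqConv_delta (a : G → ℂ) (k l : G) : seqConv a (delta k) l = a (l - k) := by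
  classical
  rw [seqConv, tsum_eq_single (l - k)]
  · simp [delta_apply]
  · intro m hm
    have : l - m ≠ k := fun h => hm (by rw [← h]; abel)
    simp [delta_apply, this]

theorem Has.shift {a : G → ℝ≥0} (ha : 𝒜.Has a) (k : G) : 𝒜.Has (fun l => a (l + k)) := by
  have := 𝒜.conv_mem _ ha _ (𝒜.delta_mem (-k))
  unfold Has
  convert this using 1
  ext l
  have := seqConv_delta (fun l => ((a l : ℝ) : ℂ)) (-k) l
  rw [sub_neg_eq_add] at this
  exact this.symm

theorem nrm_delta_pos (l : G) : 0 < 𝒜.nrm (delta l) := by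
  refine lt_of_le_of_ne (𝒜.nrm_nonneg _ (𝒜.delta_mem l)) fun h => ?_
  have := congrFun (𝒜.eq_zero_of_nrm_eq_zero _ (𝒜.delta_mem l) h.symm) l
  simp at this

/-- Solidity applied to the one-point truncation of a. It makes the point evaluations continuous on
the algebra. -/
theorem norm_mul_nrm_delta_le {a : G → ℂ} (ha : a ∈ 𝒜.carrier) (l : G) :
    ‖a l‖ * 𝒜.nrm (delta l) ≤ 𝒜.nrm a := by
  classical
  have e := 𝒜.nrm_smul (a l) _ (𝒜.delta_mem l)
  rw [delta, ← e]
  refine 𝒜.nrm_solid_le _ _ ha fun m => ?_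
  by_cases h : m = l <;> simp [h]

theorem nrm_delta_add_le (k l : G) :
    𝒜.nrm (delta (k + l)) ≤ 𝒜.nrm (delta k) * 𝒜.nrm (delta l) := by
  classical
  have := 𝒜.nrm_conv_le _ (𝒜.delta_mem k) _ (𝒜.delta_mem l)
  have e : seqConv (delta k) (delta l) = delta (k + l) := by
    ext m
    rw [seqConv_delta, delta_apply, delta_apply]
    simp [sub_eq_iff_eq_add]
  change 𝒜.nrm (seqConv (delta k) (delta l)) ≤ _ at this
  rwa [e] at this

/-! ### Containment in ℓ¹ by convolution powers -/

/-- Convolution powers of a sequence supported on the finite set `S`. -/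
def convPow (S : Finset G) (a : G → ℝ≥0) : ℕ → G → ℝ≥0
  | 0 => Set.indicator {0} 1
  | n + 1 => fun l => ∑ s ∈ S, a s * convPow S a n (l - s)

theorem convPow_support [DecidableEq G] (S : Finset G) (a : G → ℝ≥0) (n : ℕ) :
    ∀ l ∉ n • S, convPow S a n l = 0 := by
  induction n with
  | zero =>
    intro l hl
    have : l ≠ 0 := by simpa using hl
    simp [convPow, this]
  | succ n ih =>
    intro l hl
    refine Finset.sum_eq_zero fun s hs => ?_
    rw [ih, mul_zero]
    intro h
    exact hl (by rw [succ_nsmul]; simpa using Finset.add_mem_add h hs)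

theorem tsum_convPow (S : Finset G) (a : G → ℝ≥0) (n : ℕ) :
    ∑' l, (convPow S a n l : ℝ≥0∞) = (∑ s ∈ S, (a s : ℝ≥0∞)) ^ n := by
  induction n with
  | zero =>
    rw [tsum_eq_single 0]
    · simp [convPow]
    · intro l hl; simp [convPow, hl]
  | succ n ih =>
    have h : ∀ s ∈ S, ∑' l, (a s : ℝ≥0∞) * convPow S a n (l - s) =
        a s * (∑ s ∈ S, (a s : ℝ≥0∞)) ^ n := by
      intro s _
      rw [ENNReal.tsum_mul_left, ← ih]
      congr 1
      exact (Equiv.subRight s).tsum_eq (fun l => (convPow S a n l : ℝ≥0∞))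
    simp only [convPow, ENNReal.ofNNReal_finsetSum, ENNReal.coe_mul]
    rw [Summable.tsum_finsetSum fun _ _ => ENNReal.summable, Finset.sum_congr rfl h,
      ← Finset.sum_mul, pow_succ']

theorem has_of_support (S : Finset G) (a : G → ℝ≥0) (ha : ∀ l ∉ S, a l = 0) : 𝒜.Has a := by
  classical
  have : (fun l => ((a l : ℝ) : ℂ)) = ∑ k ∈ S, ((a k : ℝ) : ℂ) • delta k := by
    ext l
    simp only [Finset.sum_apply, Pi.smul_apply, delta_apply, smul_eq_mul, mul_ite, mul_one, mul_zero]
    rw [Finset.sum_ite_eq]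
    split_ifs with h
    · rfl
    · simp [ha l h]
  unfold Has
  rw [this]
  exact 𝒜.carrier.sum_mem fun k _ => 𝒜.carrier.smul_mem _ (𝒜.delta_mem k)

theorem convPow_mem (S : Finset G) (a : G → ℝ≥0) (ha : ∀ l ∉ S, a l = 0) (n : ℕ) :
    𝒜.Has (convPow S a n) ∧ 𝒜.nrm (fun l => ((convPow S a n l : ℝ) : ℂ)) ≤
      𝒜.nrm (delta 0) * 𝒜.nrm (fun l => ((a l : ℝ) : ℂ)) ^ n := by
  classical
  induction n with
  | zero =>
    have e : (fun l => ((convPow S a 0 l : ℝ) : ℂ)) = delta 0 := by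
      ext l
      simp only [convPow, delta, Set.indicator_apply]
      split_ifs <;> simp
    refine ⟨?_, ?_⟩
    · unfold Has; rw [e]; exact 𝒜.delta_mem 0
    · rw [e]; simp
  | succ n ih =>
    have e : (fun l => ((convPow S a (n + 1) l : ℝ) : ℂ)) =
        seqConv (fun l => ((a l : ℝ) : ℂ)) (fun l => ((convPow S a n l : ℝ) : ℂ)) := by
      ext l
      rw [seqConv, tsum_eq_sum (s := S) fun m hm => by simp [ha m hm]]
      simp [convPow]
    have hA := has_of_support (𝒜 := 𝒜) S a ha
    refine ⟨?_, ?_⟩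
    · unfold Has; rw [e]; exact 𝒜.conv_mem _ hA _ ih.1
    · rw [e]
      calc _ ≤ _ := 𝒜.nrm_conv_le _ hA _ ih.1
        _ ≤ 𝒜.nrm (fun l => ((a l : ℝ) : ℂ)) *
            (𝒜.nrm (delta 0) * 𝒜.nrm (fun l => ((a l : ℝ) : ℂ)) ^ n) := by
          gcongr
          · exact 𝒜.nrm_nonneg _ hA
          · exact ih.2
        _ = _ := by ring

/-- Let p be the convolution power of order n+1. Its total mass is (∑ a)^{n+1}, it lives on
polynomially many points, and ∑ p² = (p* * p)(0) is at most a constant times N^{2(n+1)}.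
Cauchy–Schwarz bounds (∑ a)^{2(n+1)} by a polynomial in n times N^{2(n+1)}, and the power trick
removes the polynomial. This uses the involution, solidity and submultiplicativity at once. -/
theorem sum_le_nrm_of_support (S : Finset G) (a : G → ℝ≥0) (ha : ∀ l ∉ S, a l = 0) :
    ∑ s ∈ S, (a s : ℝ) ≤ 𝒜.nrm (fun l => ((a l : ℝ) : ℂ)) := by
  classical
  have hA := has_of_support (𝒜 := 𝒜) S a ha
  set N := 𝒜.nrm (fun l => ((a l : ℝ) : ℂ)) with hN
  refine le_of_pow_le_poly_mul_pow (C := 𝒜.nrm (delta 0)) (𝒜.nrm_nonneg _ hA) S.card fun n => ?_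
  obtain ⟨hp, hpn⟩ := convPow_mem (𝒜 := 𝒜) S a ha (n + 1)
  set p := convPow S a (n + 1) with hpdef
  set P : G → ℂ := fun l => ((p l : ℝ) : ℂ) with hP
  have hsupp := convPow_support S a (n + 1)
  rw [← hpdef] at hsupp
  have hsum : ∑ l ∈ (n + 1) • S, (p l : ℝ) = (∑ s ∈ S, (a s : ℝ)) ^ (n + 1) := by
    have h := tsum_convPow S a (n + 1)
    rw [← hpdef, tsum_eq_sum (s := (n + 1) • S) fun m hm => by simp [hsupp m hm]] at h
    have h2 : ∑ l ∈ (n + 1) • S, p l = (∑ s ∈ S, a s) ^ (n + 1) := by exact_mod_cast h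
    exact_mod_cast congrArg NNReal.toReal h2
  have hcs := sq_sum_le_card_mul_sum_sq (s := (n + 1) • S) (f := fun l => (p l : ℝ))
  have hstar := 𝒜.star_mem _ hp
  -- After m ↦ -m the convolution of p* with p at 0 is the square of the ℓ² norm.
  have hval : seqConv (fun l => conj (P (-l))) P 0 = ((∑ l ∈ (n + 1) • S, (p l : ℝ) ^ 2 : ℝ) : ℂ) := by
    rw [seqConv, ← (Equiv.neg G).tsum_eq, tsum_eq_sum (s := (n + 1) • S)]
    · simp [hP, sq]
    · intro m hm; simp [hP, hsupp m hm]
  have hle := norm_mul_nrm_delta_le (𝒜.conv_mem _ hstar _ hp) 0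
  have h0 := nrm_delta_pos (𝒜 := 𝒜) (0 : G)
  have hN0 : 0 ≤ N := 𝒜.nrm_nonneg _ hA
  have hP0 : 0 ≤ 𝒜.nrm P := 𝒜.nrm_nonneg _ hp
  have h1 : (∑ l ∈ (n + 1) • S, (p l : ℝ) ^ 2) * 𝒜.nrm (delta (0 : G)) ≤
      (𝒜.nrm (delta 0) * N ^ (n + 1)) ^ 2 := by
    calc _ = ‖seqConv (fun l => conj (P (-l))) P 0‖ * 𝒜.nrm (delta (0 : G)) := by
          rw [hval, Complex.norm_real, Real.norm_of_nonneg (Finset.sum_nonneg fun _ _ => sq_nonneg _)]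
      _ ≤ _ := hle
      _ ≤ 𝒜.nrm (fun l => conj (P (-l))) * 𝒜.nrm P := 𝒜.nrm_conv_le _ hstar _ hp
      _ ≤ 𝒜.nrm P * 𝒜.nrm P := by gcongr; exact 𝒜.nrm_star_le _ hp
      _ ≤ _ := by rw [sq]; gcongr
  have h2 : ∑ l ∈ (n + 1) • S, (p l : ℝ) ^ 2 ≤ 𝒜.nrm (delta (0 : G)) * N ^ (2 * (n + 1)) := by
    refine le_of_mul_le_mul_right (h1.trans_eq ?_) h0
    ring
  have hcard : (((n + 1) • S).card : ℝ) ≤ ((n : ℝ) + 2) ^ S.card := by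
    have := card_nsmul_finset_le S (n + 1)
    calc (((n + 1) • S).card : ℝ) ≤ (((n + 1 + 1) ^ S.card : ℕ) : ℝ) := by exact_mod_cast this
      _ = _ := by push_cast; ring
  calc (∑ s ∈ S, (a s : ℝ)) ^ (2 * (n + 1)) = (∑ l ∈ (n + 1) • S, (p l : ℝ)) ^ 2 := by
        rw [hsum, ← pow_mul, mul_comm]
    _ ≤ _ := hcs
    _ ≤ ((n : ℝ) + 2) ^ S.card * (𝒜.nrm (delta (0 : G)) * N ^ (2 * (n + 1))) := by gcongr
    _ = _ := by ring

/-- A solid involutive convolution algebra is contained in `ℓ¹`. -/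
theorem Has.summable {a : G → ℝ≥0} (ha : 𝒜.Has a) : Summable a := by
  classical
  rw [← NNReal.summable_coe]
  refine summable_of_sum_le (c := 𝒜.nrm (fun l => ((a l : ℝ) : ℂ))) (fun _ => NNReal.coe_nonneg _)
    fun S => ?_
  have h := sum_le_nrm_of_support (𝒜 := 𝒜) S (fun l => if l ∈ S then a l else 0)
    (fun l hl => by simp [hl])
  refine le_trans (le_of_eq ?_) (h.trans (𝒜.nrm_solid_le _ _ ha fun l => ?_))
  · exact Finset.sum_congr rfl fun l hl => by simp [hl]
  · by_cases hl : l ∈ S <;> simp [hl]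

theorem Has.tsum_lt_top {a : G → ℝ≥0} (ha : 𝒜.Has a) : ∑' l, (a l : ℝ≥0∞) < ∞ :=
  lt_top_iff_ne_top.2 (ENNReal.tsum_coe_ne_top_iff_summable.2 ha.summable)

theorem Has.le_const {a : G → ℝ≥0} (ha : 𝒜.Has a) : ∃ K : ℝ≥0, ∀ l, a l ≤ K :=
  ⟨∑' l, a l, fun l => ha.summable.le_tsum l fun _ _ => zero_le⟩

/-- A sequence that is absolutely summable against the norms of the standard sequences belongs to
the algebra. -/
theorem has_of_summable_nrm_delta [Countable G] {b : G → ℝ≥0}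
    (hb : Summable fun l => (b l : ℝ) * 𝒜.nrm (delta l)) : 𝒜.Has b := by
  classical
  cases finite_or_infinite G
  · have := Fintype.ofFinite G
    exact has_of_support Finset.univ b (by simp)
  obtain ⟨e⟩ := nonempty_denumerable_iff.2 (⟨inferInstance, inferInstance⟩ : Countable G ∧ Infinite G)
  let φ : ℕ ≃ G := (Denumerable.eqv G).symm
  let u : ℕ → G → ℂ := fun n => ∑ k ∈ Finset.range n, ((b (φ k) : ℝ) : ℂ) • delta (φ k)
  have hu : ∀ n, u n ∈ 𝒜.carrier := fun n =>
    𝒜.carrier.sum_mem fun k _ => 𝒜.carrier.smul_mem _ (𝒜.delta_mem _)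
  have hbn : Summable fun n => (b (φ n) : ℝ) * 𝒜.nrm (delta (φ n)) := φ.summable_iff.2 hb
  have hnsum : ∀ s : Finset ℕ, 𝒜.nrm (∑ k ∈ s, ((b (φ k) : ℝ) : ℂ) • delta (φ k)) ≤
      ∑ k ∈ s, (b (φ k) : ℝ) * 𝒜.nrm (delta (φ k)) := by
    intro s
    induction s using Finset.induction_on with
    | empty =>
      have := 𝒜.nrm_smul 0 0 (𝒜.carrier.zero_mem)
      simp at this
      simp [this]
    | insert k s hk ih =>
      rw [Finset.sum_insert hk, Finset.sum_insert hk]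
      refine (𝒜.nrm_add_le _ (𝒜.carrier.smul_mem _ (𝒜.delta_mem _)) _
        (𝒜.carrier.sum_mem fun k _ => 𝒜.carrier.smul_mem _ (𝒜.delta_mem _))).trans ?_
      refine add_le_add (le_of_eq ?_) ih
      have := 𝒜.nrm_smul ((b (φ k) : ℝ) : ℂ) _ (𝒜.delta_mem (φ k))
      rw [delta, this]; simp
  have hsymm : ∀ v ∈ 𝒜.carrier, 𝒜.nrm (-v) = 𝒜.nrm v := by
    intro v hv
    have := 𝒜.nrm_smul (-1) v hv
    simpa using this
  have hdiff : ∀ m n, m ≤ n → 𝒜.nrm (u n - u m) ≤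
      ∑ k ∈ Finset.Ico m n, (b (φ k) : ℝ) * 𝒜.nrm (delta (φ k)) := by
    intro m n hmn
    have : u n - u m = ∑ k ∈ Finset.Ico m n, ((b (φ k) : ℝ) : ℂ) • delta (φ k) :=
      (Finset.sum_Ico_eq_sub _ hmn).symm
    rw [this]; exact hnsum _
  have hcau : ∀ ε > 0, ∃ N, ∀ m ≥ N, ∀ n ≥ N, 𝒜.nrm (u m - u n) < ε := by
    intro ε hε
    obtain ⟨N, hN⟩ := Metric.cauchySeq_iff.1 hbn.hasSum.tendsto_sum_nat.cauchySeq ε hε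
    have hle : ∀ m ≥ N, ∀ n ≥ N, m ≤ n → 𝒜.nrm (u n - u m) < ε := by
      intro m hm n hn hmn
      refine (hdiff m n hmn).trans_lt ?_
      have := hN n hn m hm
      rw [Real.dist_eq, ← Finset.sum_Ico_eq_sub _ hmn] at this
      exact (le_abs_self _).trans_lt this
    refine ⟨N, fun m hm n hn => ?_⟩
    rcases le_total m n with h | h
    · rw [← hsymm _ (𝒜.carrier.sub_mem (hu m) (hu n)), neg_sub]
      exact hle m hm n hn h
    · exact hle n hn m hm h
  obtain ⟨a, ha, hlim⟩ := 𝒜.complete u hu hcau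
  -- The limit supplied by completeness is identified coordinatewise, since point evaluations are
  -- norm continuous.
  have : a = fun l => ((b l : ℝ) : ℂ) := by
    ext l
    have hpt : Tendsto (fun n => u n l) atTop (𝓝 (a l)) := by
      rw [tendsto_iff_norm_sub_tendsto_zero]
      refine squeeze_zero (fun _ => norm_nonneg _) (g := fun n => 𝒜.nrm (u n - a) / 𝒜.nrm (delta l))
        (fun n => ?_) ?_
      · rw [le_div_iff₀ (nrm_delta_pos l)]
        exact norm_mul_nrm_delta_le (𝒜.carrier.sub_mem (hu n) ha) l
      · simpa using hlim.div_const _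
    refine tendsto_nhds_unique hpt (tendsto_const_nhds.congr' ?_)
    filter_upwards [eventually_gt_atTop (φ.symm l)] with n hn
    simp only [u, Finset.sum_apply, Pi.smul_apply, delta_apply, smul_eq_mul, mul_ite, mul_one, mul_zero]
    rw [Finset.sum_eq_single (φ.symm l)]
    · simp
    · intro k _ hk
      rw [if_neg]
      rintro rfl
      simp at hk
    · intro h; exact absurd (Finset.mem_range.2 hn) h
  unfold Has
  rwa [← this]

end SolidConvAlgebra
end

noncomputable section

open scoped NNReal Pointwise

/-! ### Lattices and domination by sequences of the algebra -/

instance {d : ℕ} : (volume : Measure (Phase d)).IsAddHaarMeasure := by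
  rw [Measure.volume_eq_prod]; infer_instance

instance {d : ℕ} (Λ : Submodule ℤ (Phase d)) :
    VAddInvariantMeasure Λ (Phase d) volume where
  measure_preimage_vadd c _ _ := measure_preimage_add volume (c : Phase d) _

section Lattice

variable {d : ℕ} (Λ : Submodule ℤ (Phase d)) [DiscreteTopology Λ]

theorem finite_lattice_norm_le (R : ℝ) : {l : Λ | ‖(l : Phase d)‖ ≤ R}.Finite := by
  have hcl : IsClosed (Λ : Set (Phase d)) :=
    AddSubgroup.isClosed_of_discrete (H := Λ.toAddSubgroup)
  have h := Metric.finite_isBounded_inter_isClosed (DiscreteTopology.isDiscrete)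
    (Metric.isBounded_closedBall (x := (0 : Phase d)) (r := R)) hcl
  refine Set.Finite.of_finite_image (f := ((↑) : Λ → Phase d)) (h.subset ?_)
    Subtype.val_injective.injOn
  rintro _ ⟨l, hl, rfl⟩
  exact ⟨by simpa using hl, l.2⟩

variable [IsZLattice ℝ Λ]

theorem exists_lattice_norm_sub_le : ∃ R : ℝ, 0 ≤ R ∧ ∀ y : Phase d, ∃ l : Λ, ‖y - l‖ ≤ R := by
  let b := Module.Free.chooseBasis ℤ Λ
  let B := b.ofZLatticeBasis ℝ Λ
  have hB : Submodule.span ℤ (Set.range B) = Λ := b.ofZLatticeBasis_span ℝ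
  refine ⟨∑ i, ‖B i‖, by positivity, fun y => ⟨⟨ZSpan.floor B y, ?_⟩, ?_⟩⟩
  · have : (ZSpan.floor B y : Phase d) ∈ Submodule.span ℤ (Set.range B) := (ZSpan.floor B y).2
    exact hB.le this
  · exact ZSpan.norm_fract_le (K := ℝ) B y

variable {Λ}

open SolidConvAlgebra

/-- `F` is dominated, uniformly on balls around the lattice points, by a sequence of `𝒜`. -/
def Dom (𝒜 : SolidConvAlgebra Λ) (F : Phase d → ℝ≥0∞) : Prop :=
  ∀ R : ℝ, ∃ b : Λ → ℝ≥0, 𝒜.Has b ∧ ∀ (l : Λ) (y : Phase d), ‖y - l‖ ≤ R → F y ≤ b l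

/-- `F` is dominated almost everywhere on the translates of `C` by a sequence of `𝒜`. -/
def AEDom (𝒜 : SolidConvAlgebra Λ) (C : Set (Phase d)) (F : Phase d → ℝ≥0∞) : Prop :=
  ∃ a : Λ → ℝ≥0, 𝒜.Has a ∧
    ∀ l : Λ, ∀ᵐ y ∂volume.restrict ((fun u => (l : Phase d) + u) '' C), F y ≤ a l

variable {𝒜 : SolidConvAlgebra Λ} {C : Set (Phase d)} {F Γ : Phase d → ℝ≥0∞}

omit [DiscreteTopology Λ] [IsZLattice ℝ Λ] in
theorem MemAmalgam.aeDom (h : MemAmalgam 𝒜 C F) : AEDom 𝒜 C F := by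
  refine ⟨fun l => (localSup Λ C F l).toNNReal, h.localSup_mem, fun l => ?_⟩
  rw [ENNReal.coe_toNNReal (h.localSup_lt_top l).ne]
  exact ENNReal.ae_le_essSup _

-- One covering radius suffices: a ball around l is covered by the balls of radius R₀ around
-- finitely many l + k, with k independent of l, and finite sums of shifted sequences stay in the
-- algebra.
omit [IsZLattice ℝ Λ] in
theorem dom_of_cover {R₀ : ℝ} (hR : ∀ y : Phase d, ∃ l : Λ, ‖y - l‖ ≤ R₀) {b : Λ → ℝ≥0}
    (hb : 𝒜.Has b) (h : ∀ (l : Λ) (y : Phase d), ‖y - l‖ ≤ R₀ → F y ≤ b l) : Dom 𝒜 F := by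
  intro R
  have hfin := finite_lattice_norm_le Λ (R + R₀)
  refine ⟨fun l => ∑ k ∈ hfin.toFinset, b (l + k), Has.finset_sum _ fun k _ => hb.shift k, ?_⟩
  intro l y hy
  obtain ⟨m, hm⟩ := hR y
  refine (h m y hm).trans ?_
  have hk : m - l ∈ hfin.toFinset := by
    rw [Set.Finite.mem_toFinset]
    change ‖((m - l : Λ) : Phase d)‖ ≤ _
    have : ((m - l : Λ) : Phase d) = (y - l) - (y - m) := by push_cast; abel
    rw [this]
    exact (norm_sub_le _ _).trans (add_le_add hy hm)
  have := Finset.single_le_sum (f := fun k => b (l + k)) (fun _ _ => zero_le) hk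
  simp only [add_sub_cancel] at this
  exact_mod_cast this

omit [DiscreteTopology Λ] [IsZLattice ℝ Λ] in
theorem Dom.mono (h : Dom 𝒜 Γ) (hle : ∀ y, F y ≤ Γ y) : Dom 𝒜 F := fun R => by
  obtain ⟨b, hb, h⟩ := h R
  exact ⟨b, hb, fun l y hy => (hle y).trans (h l y hy)⟩

omit [DiscreteTopology Λ] [IsZLattice ℝ Λ] in
theorem Dom.const_mul (h : Dom 𝒜 F) (c : ℝ≥0) : Dom 𝒜 (fun y => c * F y) := fun R => by
  obtain ⟨b, hb, h⟩ := h R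
  refine ⟨_, hb.const_mul c, fun l y hy => ?_⟩
  push_cast
  gcongr
  exact h l y hy

omit [DiscreteTopology Λ] [IsZLattice ℝ Λ] in
theorem Dom.comp_neg (h : Dom 𝒜 F) : Dom 𝒜 (fun y => F (-y)) := fun R => by
  obtain ⟨b, hb, h⟩ := h R
  refine ⟨_, hb.comp_neg, fun l y hy => h (-l) (-y) ?_⟩
  have : -y - ((-l : Λ) : Phase d) = -(y - l) := by push_cast; abel
  rwa [this, norm_neg]

omit [DiscreteTopology Λ] [IsZLattice ℝ Λ] in
theorem Dom.comp_add (h : Dom 𝒜 F) (u : Phase d) : Dom 𝒜 (fun y => F (y + u)) := fun R => by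
  obtain ⟨b, hb, h⟩ := h (R + ‖u‖)
  refine ⟨b, hb, fun l y hy => h l (y + u) ?_⟩
  rw [add_sub_right_comm]
  exact (norm_add_le _ _).trans (by gcongr)

omit [DiscreteTopology Λ] [IsZLattice ℝ Λ] in
theorem ae_restrict_cell_norm_sub_le (hC : IsAddFundamentalDomain Λ C volume) {R : ℝ}
    (hR : ∀ u ∈ C, ‖u‖ ≤ R) (l : Λ) :
    ∀ᵐ y ∂(volume : Measure (Phase d)).restrict ((fun u => (l : Phase d) + u) '' C),
      ‖y - (l : Phase d)‖ ≤ R := by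
  have hm : NullMeasurableSet ((fun u => (l : Phase d) + u) '' C) volume := by
    rw [Set.image_add_left]
    exact hC.nullMeasurableSet.preimage (measurePreserving_add_left _ _).quasiMeasurePreserving
  rw [ae_restrict_iff'₀ hm]
  refine ae_of_all _ ?_
  rintro _ ⟨u, hu, rfl⟩
  simpa using hR u hu

omit [DiscreteTopology Λ] [IsZLattice ℝ Λ] in
theorem Dom.aeDom (hC : IsAddFundamentalDomain Λ C volume) (hCb : Bornology.IsBounded C)
    (h : Dom 𝒜 F) : AEDom 𝒜 C F := by
  obtain ⟨R, hR⟩ := hCb.exists_norm_le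
  obtain ⟨b, hb, h⟩ := h R
  refine ⟨b, hb, fun l => ?_⟩
  filter_upwards [ae_restrict_cell_norm_sub_le hC hR l] with y hy
  exact h l y hy

omit [DiscreteTopology Λ] [IsZLattice ℝ Λ] in
theorem AEDom.memAmalgam (hF : AEMeasurable F volume) (h : AEDom 𝒜 C F) : MemAmalgam 𝒜 C F := by
  obtain ⟨a, ha, h⟩ := h
  have hle : ∀ l, localSup Λ C F l ≤ a l := fun l => essSup_le_of_ae_le _ (h l)
  refine ⟨hF, fun l => (hle l).trans_lt ENNReal.coe_lt_top, ?_⟩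
  exact Has.mono (a := fun l => (localSup Λ C F l).toNNReal) ha fun l =>
    ENNReal.toNNReal_mono ENNReal.coe_ne_top (hle l)

theorem lintegral_eq_tsum_cell (hC : IsAddFundamentalDomain Λ C volume) (F : Phase d → ℝ≥0∞) :
    ∫⁻ y, F y = ∑' l : Λ, ∫⁻ y in (fun u => (l : Phase d) + u) '' C, F y :=
  hC.lintegral_eq_tsum F

omit [DiscreteTopology Λ] [IsZLattice ℝ Λ] in
theorem volume_cell (l : Λ) :
    volume ((fun u => (l : Phase d) + u) '' C) = volume C := by
  rw [Set.image_add_left]; exact measure_preimage_add _ _ _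

/-- Cell by cell the integral is at most the volume of C times the sequence convolution of the two
bounds. Almost everywhere control of F is enough, and the result is controlled at every point:
convolution with a `Dom` function upgrades `AEDom` to `Dom`. -/
theorem AEDom.conv (hC : IsAddFundamentalDomain Λ C volume) (hCb : Bornology.IsBounded C)
    (hF : AEDom 𝒜 C F) (hΓ : Dom 𝒜 Γ) : Dom 𝒜 (fun w => ∫⁻ z, F z * Γ (w - z)) := by
  obtain ⟨R₀, -, hcov⟩ := exists_lattice_norm_sub_le Λ
  obtain ⟨R, hR⟩ := hCb.exists_norm_le
  obtain ⟨a, ha, haF⟩ := hF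
  obtain ⟨γ, hγ, hγΓ⟩ := hΓ (R₀ + R)
  obtain ⟨c, hc, hac⟩ := ha.conv hγ
  have hvol : volume C ≠ ∞ := hCb.measure_lt_top.ne
  refine dom_of_cover hcov (hc.const_mul (volume C).toNNReal) fun k w hw => ?_
  rw [lintegral_eq_tsum_cell hC]
  push_cast
  rw [← hac, ← ENNReal.tsum_mul_left, ENNReal.coe_toNNReal hvol]
  refine ENNReal.tsum_le_tsum fun l => ?_
  calc ∫⁻ y in (fun u => (l : Phase d) + u) '' C, F y * Γ (w - y)
      ≤ ∫⁻ y in (fun u => (l : Phase d) + u) '' C, (a l : ℝ≥0∞) * γ (k - l) := by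
        refine lintegral_mono_ae ?_
        filter_upwards [haF l, ae_restrict_cell_norm_sub_le hC hR l] with y hy hyR
        gcongr
        refine hγΓ _ _ ?_
        have : w - y - ((k - l : Λ) : Phase d) = (w - k) - (y - l) := by push_cast; abel
        rw [this]
        exact (norm_sub_le _ _).trans (add_le_add hw hyR)
    _ = _ := by rw [setLIntegral_const, volume_cell, mul_comm]

theorem AEDom.lintegral_lt_top (hC : IsAddFundamentalDomain Λ C volume)
    (hCb : Bornology.IsBounded C) (hF : AEDom 𝒜 C F) : ∫⁻ z, F z < ∞ := by
  obtain ⟨a, ha, haF⟩ := hF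
  rw [lintegral_eq_tsum_cell hC]
  calc _ ≤ ∑' l, (a l : ℝ≥0∞) * volume C := by
        refine ENNReal.tsum_le_tsum fun l => ?_
        rw [← volume_cell (C := C) l, ← setLIntegral_const]
        exact lintegral_mono_ae (haF l)
    _ < ∞ := by
        rw [ENNReal.tsum_mul_right]
        exact ENNReal.mul_lt_top ha.tsum_lt_top hCb.measure_lt_top

theorem AEDom.ae_le_const (hC : IsAddFundamentalDomain Λ C volume) (hF : AEDom 𝒜 C F) :
    ∃ K : ℝ≥0, ∀ᵐ z, F z ≤ K := by
  obtain ⟨a, ha, haF⟩ := hF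
  obtain ⟨K, hK⟩ := ha.le_const
  refine ⟨K, ?_⟩
  rw [← hC.sum_restrict, Measure.ae_sum_iff]
  intro l
  filter_upwards [haF l] with y hy
  exact hy.trans (by exact_mod_cast hK l)

/-- A consequence of 𝒜 ⊂ ℓ¹, after x is replaced by a nearby lattice point. -/
theorem Dom.tsum_le_const (hF : Dom 𝒜 F) :
    ∃ K : ℝ≥0, ∀ x : Phase d, ∑' m : Λ, F (x - m) ≤ K := by
  obtain ⟨R₀, -, hcov⟩ := exists_lattice_norm_sub_le Λ
  obtain ⟨f, hf, hfF⟩ := hF R₀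
  refine ⟨(∑' l, (f l : ℝ≥0∞)).toNNReal, fun x => ?_⟩
  rw [ENNReal.coe_toNNReal hf.tsum_lt_top.ne]
  obtain ⟨α, hα⟩ := hcov x
  calc _ ≤ ∑' m : Λ, (f (α - m) : ℝ≥0∞) := by
        refine ENNReal.tsum_le_tsum fun m => hfF _ _ ?_
        convert hα using 2
        push_cast; abel
    _ = _ := (Equiv.subLeft α).tsum_eq (fun l => (f l : ℝ≥0∞))

/-- The double sum is essentially a twofold convolution of h with the two dominating sequences, one
of them reflected. The bound depends on x and y only through y - x, which later makes the estimate
of the grand symbol uniform in its base point. -/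
theorem Dom.tsum_tsum_le {F₁ F₂ : Phase d → ℝ≥0∞} (h₁ : Dom 𝒜 F₁) (h₂ : Dom 𝒜 F₂) {h : Λ → ℝ≥0}
    (hh : 𝒜.Has h) (R : ℝ) : ∃ b : Λ → ℝ≥0, 𝒜.Has b ∧ ∀ (l : Λ) (x y : Phase d),
      ‖y - x - l‖ ≤ R → ∑' m : Λ, ∑' k : Λ, F₁ (x - m) * F₂ (y - k) * h (k - m) ≤ b l := by
  obtain ⟨R₀, -, hcov⟩ := exists_lattice_norm_sub_le Λ
  obtain ⟨f₁, hf₁, hF₁⟩ := h₁ R₀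
  obtain ⟨f₂, hf₂, hF₂⟩ := h₂ (R + R₀)
  obtain ⟨c, hc, hhc⟩ := hh.conv hf₂
  obtain ⟨b, hb, hbc⟩ := hf₁.comp_neg.conv hc
  refine ⟨b, hb, fun l x y hxy => ?_⟩
  -- x is rounded to α and y to α + l; the errors are R₀ and R + R₀, the radii used for the two
  -- bounds.
  obtain ⟨α, hα⟩ := hcov x
  calc ∑' m : Λ, ∑' k : Λ, F₁ (x - m) * F₂ (y - k) * h (k - m)
      ≤ ∑' m : Λ, ∑' k : Λ, (f₁ (α - m) : ℝ≥0∞) * f₂ (α + l - k) * h (k - m) := by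
        refine ENNReal.tsum_le_tsum fun m => ENNReal.tsum_le_tsum fun k => ?_
        gcongr
        · refine hF₁ _ _ ?_
          convert hα using 2
          push_cast; abel
        · refine hF₂ _ _ ?_
          have : y - k - ((α + l - k : Λ) : Phase d) = (y - x - l) + (x - α) := by push_cast; abel
          rw [this]
          exact (norm_add_le _ _).trans (add_le_add hxy hα)
    _ = ∑' m : Λ, (f₁ (α - m) : ℝ≥0∞) * c (α - m + l) := by
        refine tsum_congr fun m => ?_
        rw [← hhc, ← ENNReal.tsum_mul_left, ← (Equiv.addRight m).tsum_eq]
        refine tsum_congr fun k => ?_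
        simp only [Equiv.coe_addRight, add_sub_cancel_right]
        rw [mul_assoc, mul_comm (f₂ _ : ℝ≥0∞)]
        congr 4
        abel
    _ = b l := by
        rw [← hbc]
        refine ((Equiv.subRight α).tsum_eq
          (fun m => (f₁ (-m) : ℝ≥0∞) * c (l - m))).symm.trans (tsum_congr fun m => ?_) |>.symm
        simp only [Equiv.subRight_apply, neg_sub]
        congr 3
        abel

/-- A lattice point of norm at most n+1 is reached from one of norm at most n by a lattice step of
bounded length. Only finitely many such steps exist, and ‖δ_{k+l}‖ ≤ ‖δ_k‖‖δ_l‖. -/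
theorem exists_nrm_delta_le : ∃ M : ℝ, 1 ≤ M ∧ ∀ (n : ℕ) (l : Λ), ‖(l : Phase d)‖ ≤ n →
    𝒜.nrm (delta l) ≤ M ^ (n + 1) := by
  obtain ⟨R₀, hR0, hcov⟩ := exists_lattice_norm_sub_le Λ
  have hfin := finite_lattice_norm_le Λ (2 * R₀ + 1)
  obtain ⟨M, hM⟩ := (hfin.image fun l => 𝒜.nrm (delta l)).bddAbove
  have hM' : ∀ l : Λ, ‖(l : Phase d)‖ ≤ 2 * R₀ + 1 → 𝒜.nrm (delta l) ≤ max M 1 := fun l hl =>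
    (hM ⟨l, hl, rfl⟩).trans (le_max_left _ _)
  refine ⟨max M 1, le_max_right _ _, fun n => ?_⟩
  have h1 : (1 : ℝ) ≤ max M 1 := le_max_right _ _
  induction n with
  | zero =>
    intro l hl
    simpa using hM' l (by push_cast at hl; linarith)
  | succ n ih =>
    intro l hl
    by_cases hs : ‖(l : Phase d)‖ ≤ 2 * R₀ + 1
    · exact (hM' l hs).trans (le_self_pow₀ h1 (by omega))
    have hlpos : 0 < ‖(l : Phase d)‖ := by linarith
    -- Moving back from l by R₀ + 1 and then rounding to the lattice costs at most R₀, so the norm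
    -- drops by at least 1.
    set t : ℝ := (R₀ + 1) / ‖(l : Phase d)‖ with ht
    have ht0 : 0 ≤ t := by positivity
    have ht1 : t ≤ 1 := by rw [ht, div_le_one hlpos]; linarith
    have htl : t * ‖(l : Phase d)‖ = R₀ + 1 := div_mul_cancel₀ _ hlpos.ne'
    obtain ⟨k, hk⟩ := hcov ((1 - t) • (l : Phase d))
    have hk1 : ‖(k : Phase d)‖ ≤ n := by
      have : (k : Phase d) = (1 - t) • (l : Phase d) - ((1 - t) • (l : Phase d) - k) := by abel
      rw [this]
      refine (norm_sub_le _ _).trans ?_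
      rw [norm_smul, Real.norm_of_nonneg (by linarith)]
      push_cast at hl
      linarith
    have hk2 : ‖((l - k : Λ) : Phase d)‖ ≤ 2 * R₀ + 1 := by
      have : ((l - k : Λ) : Phase d) = t • (l : Phase d) + ((1 - t) • (l : Phase d) - k) := by
        rw [sub_smul, one_smul]; push_cast; abel
      rw [this]
      refine (norm_add_le _ _).trans ?_
      rw [norm_smul, Real.norm_of_nonneg ht0]
      linarith
    have hdec := nrm_delta_add_le (𝒜 := 𝒜) (l - k) k
    rw [sub_add_cancel] at hdec
    refine hdec.trans ?_
    rw [pow_succ' _ (n + 1)]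
    exact mul_le_mul (hM' _ hk2) (ih k hk1) (nrm_delta_pos _).le (by linarith)

/-- Gaussian decay beats the exponential growth of ‖δ_l‖, so the bounding sequence is absolutely
summable against these norms and lies in 𝒜 by completeness. -/
theorem dom_gaussian {c : ℝ} (hc : 0 < c) :
    Dom 𝒜 (fun y => ENNReal.ofReal (Real.exp (-c * ‖y‖ ^ 2))) := by
  obtain ⟨R₀, hR0, hcov⟩ := exists_lattice_norm_sub_le Λ
  obtain ⟨M, hM1, hM⟩ := exists_nrm_delta_le (𝒜 := 𝒜)
  -- for `‖y - l‖ ≤ R₀` one has `-c‖y‖² ≤ A - B‖l‖` for every `B`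
  set N : ℕ := Module.finrank ℤ Λ + 1 with hN
  -- The summand log M cancels the growth of ‖δ_l‖; the summand 1 leaves a factor e^{-‖l‖} to sum
  -- over the lattice.
  set B : ℝ := Real.log M + 1 with hB
  have hB0 : 0 < B := by have := Real.log_nonneg hM1; linarith
  set A : ℝ := B ^ 2 / (4 * c) + B * R₀ with hA
  have hle : ∀ (l : Λ) (y : Phase d), ‖y - l‖ ≤ R₀ →
      Real.exp (-c * ‖y‖ ^ 2) ≤ Real.exp (A - B * ‖(l : Phase d)‖) := by
    intro l y hy
    apply Real.exp_le_exp.2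
    have h1 : ‖(l : Phase d)‖ ≤ ‖y‖ + R₀ := by
      have : (l : Phase d) = y - (y - l) := by abel
      rw [this]; exact (norm_sub_le _ _).trans (by gcongr)
    have h2 : B * ‖y‖ ≤ c * ‖y‖ ^ 2 + B ^ 2 / (4 * c) := by
      have : c * ‖y‖ ^ 2 + B ^ 2 / (4 * c) - B * ‖y‖ = (2 * c * ‖y‖ - B) ^ 2 / (4 * c) := by
        field_simp; ring
      have h3 : 0 ≤ (2 * c * ‖y‖ - B) ^ 2 / (4 * c) := by positivity
      linarith
    nlinarith [mul_le_mul_of_nonneg_left h1 hB0.le]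
  refine dom_of_cover hcov (b := fun l => (Real.exp (A - B * ‖(l : Phase d)‖)).toNNReal) ?_
    fun l y hy => ENNReal.coe_le_coe.2 (Real.toNNReal_le_toNNReal (hle l y hy))
  refine has_of_summable_nrm_delta ?_
  have hsum : Summable fun l : Λ => ‖(l : Phase d)‖ ^ (-(N : ℤ)) :=
    ZLattice.summable_norm_zpow Λ _ (by rw [hN]; push_cast; linarith)
  refine Summable.of_norm_bounded_eventually (g := fun l : Λ =>
    (Real.exp A * M ^ 2 * N.factorial) * ‖(l : Phase d)‖ ^ (-(N : ℤ))) (hsum.mul_left _) ?_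
  -- The origin is excluded because there the negative power takes the default value 0.
  have hfin := finite_lattice_norm_le Λ 0
  filter_upwards [hfin.compl_mem_cofinite] with l hl
  have hl0 : 0 < ‖(l : Phase d)‖ := by simpa using hl
  rw [Real.norm_of_nonneg (mul_nonneg NNReal.zero_le_coe (nrm_delta_pos l).le),
    Real.coe_toNNReal _ (Real.exp_pos _).le]
  have h1 := hM ⌈‖(l : Phase d)‖⌉₊ l (Nat.le_ceil _)
  have h2 : M ^ (⌈‖(l : Phase d)‖⌉₊ + 1) ≤ M ^ 2 * Real.exp (Real.log M * ‖(l : Phase d)‖) := by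
    have hc : ((⌈‖(l : Phase d)‖⌉₊ : ℕ) : ℝ) ≤ ‖(l : Phase d)‖ + 1 := (Nat.ceil_lt_add_one hl0.le).le
    have hMpos : 0 < M := by linarith
    rw [← Real.rpow_natCast, ← Real.rpow_natCast, Real.exp_mul, Real.exp_log hMpos,
      ← Real.rpow_add hMpos]
    apply Real.rpow_le_rpow_of_exponent_le hM1
    push_cast; linarith
  have h3 : Real.exp (-‖(l : Phase d)‖) ≤ N.factorial * ‖(l : Phase d)‖ ^ (-(N : ℤ)) := by
    have := Real.pow_div_factorial_le_exp _ hl0.le N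
    rw [Real.exp_neg, zpow_neg, zpow_natCast, ← div_eq_mul_inv, inv_le_comm₀ (Real.exp_pos _)
      (by positivity), inv_div]
    exact this
  calc Real.exp (A - B * ‖(l : Phase d)‖) * 𝒜.nrm (delta l)
      ≤ Real.exp (A - B * ‖(l : Phase d)‖) * (M ^ 2 * Real.exp (Real.log M * ‖(l : Phase d)‖)) := by
        gcongr; exact h1.trans h2
    _ = Real.exp A * M ^ 2 * Real.exp (-‖(l : Phase d)‖) := by
        have : Real.exp (A - B * ‖(l : Phase d)‖) * Real.exp (Real.log M * ‖(l : Phase d)‖) =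
            Real.exp A * Real.exp (-‖(l : Phase d)‖) := by
          rw [← Real.exp_add, ← Real.exp_add, hB]; ring_nf
        linear_combination M ^ 2 * this
    _ ≤ Real.exp A * M ^ 2 * (N.factorial * ‖(l : Phase d)‖ ^ (-(N : ℤ))) := by gcongr
    _ = _ := by ring

end Lattice
end

noncomputable section

open scoped NNReal Pointwise

/-! ### Unimodular exponentials and Gaussian integrals -/

/-- The character `r ↦ e^{2πir}`. -/
def expI (r : ℝ) : ℂ := Complex.exp (2 * Real.pi * Complex.I * (r : ℝ))

theorem expI_add (r s : ℝ) : expI (r + s) = expI r * expI s := by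
  simp only [expI, ← Complex.exp_add]; congr 1; push_cast; ring

theorem expI_zero : expI 0 = 1 := by simp [expI]

theorem norm_expI (r : ℝ) : ‖expI r‖ = 1 := by
  have : expI r = Complex.exp ((2 * Real.pi * r : ℝ) * Complex.I) := by
    simp only [expI]; congr 1; push_cast; ring
  rw [this, Complex.norm_exp_ofReal_mul_I]

theorem enorm_expI (r : ℝ) : ‖expI r‖ₑ = 1 := by
  rw [← ofReal_norm, norm_expI]; simp

theorem conj_expI (r : ℝ) : conj (expI r) = expI (-r) := by
  simp only [expI, ← Complex.exp_conj]; congr 1; simp [map_ofNat]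

theorem continuous_expI : Continuous expI := by unfold expI; fun_prop

theorem expI_mul_expI_neg (r : ℝ) : expI r * expI (-r) = 1 := by
  rw [← expI_add, add_neg_cancel, expI_zero]

variable {d : ℕ}

theorem integral_gauss_expI {a : ℝ} (ha : 0 < a) (w : Conf d) :
    ∫ v : Conf d, ((Real.exp (-a * ‖v‖ ^ 2) : ℝ) : ℂ) * expI ⟪w, v⟫ =
      (((Real.pi / a) ^ ((d : ℝ) / 2) * Real.exp (-(Real.pi ^ 2 / a) * ‖w‖ ^ 2) : ℝ) : ℂ) := by
  have h := GaussianFourier.integral_cexp_neg_mul_sq_norm_add (V := Conf d) (b := (a : ℂ))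
    (by simpa using ha) (2 * Real.pi * Complex.I) w
  rw [finrank_euclideanSpace_fin] at h
  have ha' : (a : ℂ) ≠ 0 := by exact_mod_cast ha.ne'
  have e : ∀ v : Conf d, ((Real.exp (-a * ‖v‖ ^ 2) : ℝ) : ℂ) * expI ⟪w, v⟫ =
      Complex.exp (-(a : ℂ) * ‖v‖ ^ 2 + 2 * Real.pi * Complex.I * ((⟪w, v⟫ : ℝ) : ℂ)) := by
    intro v
    rw [Complex.exp_add, expI]
    push_cast; rfl
  simp_rw [e]
  rw [h, Complex.ofReal_mul, Complex.ofReal_cpow (by positivity)]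
  push_cast
  congr 2
  rw [mul_pow, mul_pow, Complex.I_sq]
  field_simp
  ring

theorem integral_gauss_sub_expI {a : ℝ} (ha : 0 < a) (b w : Conf d) :
    ∫ v : Conf d, ((Real.exp (-a * ‖v - b‖ ^ 2) : ℝ) : ℂ) * expI ⟪w, v⟫ =
      expI ⟪w, b⟫ *
      (((Real.pi / a) ^ ((d : ℝ) / 2) * Real.exp (-(Real.pi ^ 2 / a) * ‖w‖ ^ 2) : ℝ) : ℂ) := by
  rw [← integral_gauss_expI ha, ← integral_const_mul, ← integral_add_right_eq_self _ b]
  congr 1; ext v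
  rw [add_sub_cancel_right, inner_add_right, expI_add]
  ring

theorem integrable_gauss_sub {a : ℝ} (ha : 0 < a) (b : Conf d) :
    Integrable fun v : Conf d => Real.exp (-a * ‖v - b‖ ^ 2) := by
  have h := GaussianFourier.integrable_cexp_neg_mul_sq_norm_add (V := Conf d) (b := (a : ℂ))
    (by simpa using ha) 0 0
  have h2 : Integrable fun v : Conf d => Real.exp (-a * ‖v‖ ^ 2) := by
    refine h.norm.congr (ae_of_all _ fun v => ?_)
    simp only [Complex.norm_exp]
    congr 1
    have : (-(a : ℂ) * ‖v‖ ^ 2 + 0 * ((⟪(0 : Conf d), v⟫ : ℝ) : ℂ)) = ((-a * ‖v‖ ^ 2 : ℝ) : ℂ) := by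
      push_cast; ring
    rw [this, Complex.ofReal_re]
  exact h2.comp_sub_right b

theorem gaussConf_eq (t : Conf d) : gaussConf t = ((Real.exp (-Real.pi * ‖t‖ ^ 2) : ℝ) : ℂ) := by
  rw [gaussConf]; push_cast; congr 1; ring

theorem continuous_gaussConf : Continuous (gaussConf (d := d)) := by
  unfold gaussConf; fun_prop

theorem conj_gaussConf (t : Conf d) : conj (gaussConf t) = gaussConf t := by
  rw [gaussConf_eq, Complex.conj_ofReal]

theorem norm_gaussConf (t : Conf d) : ‖gaussConf t‖ = Real.exp (-Real.pi * ‖t‖ ^ 2) := by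
  rw [gaussConf_eq, Complex.norm_real, Real.norm_of_nonneg (Real.exp_pos _).le]

theorem memLp_gaussConf : MemLp (gaussConf (d := d)) 2 := by
  rw [memLp_two_iff_integrable_sq_norm continuous_gaussConf.aestronglyMeasurable]
  have := integrable_gauss_sub (d := d) (a := 2 * Real.pi) (by positivity) 0
  refine this.congr (ae_of_all _ fun t => ?_)
  simp only [norm_gaussConf, sub_zero]
  rw [← Real.exp_nat_mul]
  congr 1; push_cast; ring

/-! ### Time-frequency shifts and the short-time Fourier transform -/

theorem tfShift_apply (z : Phase d) (f : Conf d → ℂ) (t : Conf d) :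
    tfShift z f t = expI ⟪z.2, t⟫ * f (t - z.1) := rfl

theorem norm_tfShift (z : Phase d) (f : Conf d → ℂ) (t : Conf d) :
    ‖tfShift z f t‖ = ‖f (t - z.1)‖ := by
  rw [tfShift_apply, norm_mul, norm_expI, one_mul]

theorem enorm_tfShift (z : Phase d) (f : Conf d → ℂ) (t : Conf d) :
    ‖tfShift z f t‖ₑ = ‖f (t - z.1)‖ₑ := by
  rw [← ofReal_norm, norm_tfShift, ofReal_norm]

theorem tfShift_tfShift (z w : Phase d) (f : Conf d → ℂ) (t : Conf d) :
    tfShift z (tfShift w f) t = expI (-⟪w.2, z.1⟫) * tfShift (z + w) f t := by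
  simp only [tfShift_apply, Prod.fst_add, Prod.snd_add, inner_sub_right, inner_add_left]
  rw [← mul_assoc, ← mul_assoc, ← expI_add, ← expI_add, sub_sub]
  congr 2; ring

theorem tfShift_zero (f : Conf d → ℂ) : tfShift 0 f = f := by
  ext t; simp [tfShift_apply, expI_zero]

theorem tfShift_congr_ae {f f' : Conf d → ℂ} (h : f =ᵐ[volume] f') (z : Phase d) :
    tfShift z f =ᵐ[volume] tfShift z f' := by
  have := (measurePreserving_sub_right (volume : Measure (Conf d)) z.1).quasiMeasurePreserving.ae_eq h
  filter_upwards [this] with t ht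
  simp only [Function.comp_apply] at ht
  simp only [tfShift_apply, ht]

theorem memLp_tfShift {f : Conf d → ℂ} (hf : MemLp f 2) (z : Phase d) :
    MemLp (tfShift z f) 2 := by
  have h := hf.comp_measurePreserving (measurePreserving_sub_right (volume : Measure (Conf d)) z.1)
  refine h.of_le ?_ (ae_of_all _ fun t => (norm_tfShift z f t).le)
  exact (Continuous.aestronglyMeasurable (by
    have := continuous_expI; fun_prop)).mul h.1

theorem stft_apply (g f : Conf d → ℂ) (z : Phase d) :
    stft g f z = ∫ t, f t * conj (tfShift z g t) := rfl

theorem stft_congr {f f' g g' : Conf d → ℂ} (hf : f =ᵐ[volume] f') (hg : g =ᵐ[volume] g') :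
    stft g f = stft g' f' := by
  ext z
  refine integral_congr_ae ?_
  filter_upwards [hf, tfShift_congr_ae hg z] with t h1 h2
  rw [h1, h2]

theorem stft_tfShift_right (g f : Conf d → ℂ) (z s : Phase d) :
    stft g (tfShift z f) s = expI (-⟪s.2 - z.2, z.1⟫) * stft g f (s - z) := by
  rw [stft_apply, stft_apply, ← integral_const_mul, ← integral_add_right_eq_self _ z.1]
  congr 1; ext t
  have e : expI ⟪z.2, t + z.1⟫ * expI (-⟪s.2, t + z.1⟫) =
      expI (-⟪s.2 - z.2, z.1⟫) * expI (-⟪s.2 - z.2, t⟫) := by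
    rw [← expI_add, ← expI_add]
    simp only [inner_add_right, inner_sub_left]
    congr 1; ring
  simp only [tfShift_apply, map_mul, conj_expI, Prod.fst_sub, Prod.snd_sub, add_sub_cancel_right]
  rw [show t + z.1 - s.1 = t - (s.1 - z.1) by abel]
  linear_combination f t * conj (g (t - (s.1 - z.1))) * e

theorem enorm_stft_tfShift_right (g f : Conf d → ℂ) (z s : Phase d) :
    ‖stft g (tfShift z f) s‖ₑ = ‖stft g f (s - z)‖ₑ := by
  rw [stft_tfShift_right, enorm_mul, enorm_expI, one_mul]

theorem stft_tfShift_left (g f : Conf d → ℂ) (z s : Phase d) :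
    stft (tfShift z g) f s = expI ⟪z.2, s.1⟫ * stft g f (s + z) := by
  rw [stft_apply, stft_apply, ← integral_const_mul]
  congr 1; ext t
  rw [tfShift_tfShift, map_mul, conj_expI, neg_neg]
  ring

theorem enorm_stft_tfShift_left (g f : Conf d → ℂ) (z s : Phase d) :
    ‖stft (tfShift z g) f s‖ₑ = ‖stft g f (s + z)‖ₑ := by
  rw [stft_tfShift_left, enorm_mul, enorm_expI, one_mul]

theorem stft_swap (g f : Conf d → ℂ) (z : Phase d) :
    stft g f z = expI (-⟪z.2, z.1⟫) * conj (stft f g (-z)) := by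
  rw [stft_apply, stft_apply, ← integral_conj, ← integral_const_mul,
    ← integral_add_right_eq_self _ z.1]
  congr 1; ext t
  simp only [tfShift_apply, map_mul, conj_expI, Prod.fst_neg, Prod.snd_neg, add_sub_cancel_right,
    inner_neg_left, sub_neg_eq_add, Complex.conj_conj, neg_neg]
  have e : expI (-⟪z.2, t + z.1⟫) = expI (-⟪z.2, z.1⟫) * expI (-⟪z.2, t⟫) := by
    rw [← expI_add, inner_add_right]
    congr 1; ring
  rw [e]; ring

theorem enorm_stft_swap (g f : Conf d → ℂ) (z : Phase d) :
    ‖stft g f z‖ₑ = ‖stft f g (-z)‖ₑ := by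
  rw [stft_swap, enorm_mul, enorm_expI, one_mul, ← ofReal_norm, RCLike.norm_conj, ofReal_norm]

theorem lintegral_enorm_mul_le {f k : Conf d → ℂ} (hf : AEStronglyMeasurable f)
    (hk : AEStronglyMeasurable k) :
    ∫⁻ t, ‖f t‖ₑ * ‖k t‖ₑ ≤ eLpNorm f 2 volume * eLpNorm k 2 volume := by
  have := ENNReal.lintegral_mul_le_Lp_mul_Lq volume Real.HolderConjugate.two_two hf.enorm hk.enorm
  simpa [eLpNorm_eq_lintegral_rpow_enorm_toReal] using this

theorem eLpNorm_comp_sub (f : Conf d → ℂ) (hf : AEStronglyMeasurable f) (a : Conf d) :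
    eLpNorm (fun t => f (t - a)) 2 volume = eLpNorm f 2 volume :=
  eLpNorm_comp_measurePreserving hf (measurePreserving_sub_right (volume : Measure (Conf d)) a)

theorem integrable_mul_conj {f k : Conf d → ℂ} (hf : MemLp f 2) (hk : MemLp k 2) :
    Integrable (fun t => f t * conj (k t)) := by
  have := hf.integrable_mul hk.star
  exact this

theorem enorm_stft_le {f g : Conf d → ℂ} (hf : MemLp f 2) (hg : MemLp g 2) (z : Phase d) :
    ‖stft g f z‖ₑ ≤ eLpNorm f 2 volume * eLpNorm g 2 volume := by
  calc _ ≤ ∫⁻ t, ‖f t * conj (tfShift z g t)‖ₑ := enorm_integral_le_lintegral_enorm _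
    _ = ∫⁻ t, ‖f t‖ₑ * ‖g (t - z.1)‖ₑ := by
        congr 1; ext t
        rw [enorm_mul, ← enorm_tfShift, ← ofReal_norm (conj _), RCLike.norm_conj, ofReal_norm]
    _ ≤ _ := by
        rw [← eLpNorm_comp_sub g hg.1 z.1]
        exact lintegral_enorm_mul_le hf.1
          (hg.1.comp_measurePreserving (measurePreserving_sub_right _ z.1))

theorem stronglyMeasurable_stft {f g : Conf d → ℂ} (hf : StronglyMeasurable f)
    (hg : StronglyMeasurable g) : StronglyMeasurable (stft g f) := by
  have h : StronglyMeasurable (fun p : Phase d × Conf d => f p.2 * conj (tfShift p.1 g p.2)) := by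
    refine (hf.comp_measurable measurable_snd).mul ?_
    refine Complex.continuous_conj.comp_stronglyMeasurable ?_
    refine StronglyMeasurable.mul ?_ ?_
    · exact Continuous.stronglyMeasurable (by have := continuous_expI; fun_prop)
    · exact hg.comp_measurable (by fun_prop)
  exact h.integral_prod_right

theorem stronglyMeasurable_stft' {f g : Conf d → ℂ} (hf : AEStronglyMeasurable f)
    (hg : AEStronglyMeasurable g) : StronglyMeasurable (stft g f) := by
  rw [stft_congr hf.ae_eq_mk hg.ae_eq_mk]
  exact stronglyMeasurable_stft hf.stronglyMeasurable_mk hg.stronglyMeasurable_mk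

end

/-! ### Integration of a short-time Fourier transform against a kernel -/

noncomputable section

open scoped NNReal Pointwise

variable {d : ℕ}

theorem enorm_conj (a : ℂ) : ‖conj a‖ₑ = ‖a‖ₑ := by
  rw [← ofReal_norm, RCLike.norm_conj, ofReal_norm]

/-- Integration of `V_k f` against a function whose partial Fourier transform factorizes. -/
theorem integral_stft_mul {f k : Conf d → ℂ} (hf : MemLp f 2) (hk : MemLp k 2)
    {N : Phase d → ℂ} (hN : Integrable N) (hNx : ∀ x, Integrable fun ξ => N (x, ξ))
    {α β : Conf d → ℂ} (hfα : Integrable fun t => f t * α t)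
    (hkβ : Integrable fun t => conj (k t) * β t)
    (h : ∀ x t, ∫ ξ, N (x, ξ) * expI (-⟪ξ, t⟫) = α t * β (t - x)) :
    ∫ z, stft k f z * N z = (∫ t, f t * α t) * ∫ t, conj (k t) * β t := by
  have hbd : Integrable (fun z => stft k f z * N z) := by
    refine hN.bdd_mul (c := (eLpNorm f 2 volume * eLpNorm k 2 volume).toReal)
      (stronglyMeasurable_stft' hf.1 hk.1).aestronglyMeasurable (ae_of_all _ fun z => ?_)
    rw [← toReal_enorm]
    exact ENNReal.toReal_mono (ENNReal.mul_lt_top hf.2 hk.2).ne (enorm_stft_le hf hk z)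
  -- Integrating in ξ first replaces N(x,·) by its partial Fourier transform α(t) β(t - x);
  -- afterwards the integral in x decouples from t.
  have hx : ∀ x, ∫ ξ, stft k f (x, ξ) * N (x, ξ) =
      ∫ t, (f t * α t) * (conj (k (t - x)) * β (t - x)) := by
    intro x
    have hkx : MemLp (fun t => k (t - x)) 2 :=
      hk.comp_measurePreserving (measurePreserving_sub_right (volume : Measure (Conf d)) x)
    have e1 : ∀ ξ, stft k f (x, ξ) * N (x, ξ) =
        ∫ t, (N (x, ξ) * (f t * conj (k (t - x)))) * expI (-⟪ξ, t⟫) := by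
      intro ξ
      rw [stft_apply, ← integral_mul_const]
      congr 1; ext t
      simp only [tfShift_apply, map_mul, conj_expI]
      ring
    simp_rw [e1]
    rw [integral_integral_swap]
    · congr 1; ext t
      have : ∀ ξ, N (x, ξ) * (f t * conj (k (t - x))) * expI (-⟪ξ, t⟫) =
          (f t * conj (k (t - x))) * (N (x, ξ) * expI (-⟪ξ, t⟫)) := fun ξ => by ring
      simp_rw [this]
      rw [integral_const_mul, h]
      ring
    · refine ((hNx x).mul_prod (integrable_mul_conj hf hkx)).mul_bdd (c := 1) ?_
        (ae_of_all _ fun p => (norm_expI _).le)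
      exact Continuous.aestronglyMeasurable (by have := continuous_expI; fun_prop)
  rw [Measure.volume_eq_prod] at hbd ⊢
  rw [integral_prod _ hbd]
  simp_rw [hx]
  rw [integral_integral_swap]
  · rw [← integral_mul_const]
    congr 1; ext t
    rw [integral_const_mul]
    congr 1
    exact integral_sub_left_eq_self (fun s => conj (k s) * β s) volume t
  · have := hfα.convolution_integrand (ContinuousLinearMap.mul ℂ ℂ) hkβ.comp_neg
    simp only [ContinuousLinearMap.mul_apply', neg_sub] at this
    exact this

/-! ### Gaussian windows -/

theorem stft_gauss_gauss (z : Phase d) :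
    stft gaussConf gaussConf z =
      (((1 / 2 : ℝ) ^ ((d : ℝ) / 2) * Real.exp (-(Real.pi / 2) * ‖z.1‖ ^ 2) *
        Real.exp (-(Real.pi / 2) * ‖z.2‖ ^ 2) : ℝ) : ℂ) * expI (-(⟪z.2, z.1⟫ / 2)) := by
  have e : ∀ t, gaussConf t * conj (tfShift z gaussConf t) =
      ((Real.exp (-(Real.pi / 2) * ‖z.1‖ ^ 2) : ℝ) : ℂ) *
      (((Real.exp (-(2 * Real.pi) * ‖t - (1 / 2 : ℝ) • z.1‖ ^ 2) : ℝ) : ℂ) * expI ⟪-z.2, t⟫) := by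
    intro t
    rw [tfShift_apply, map_mul, conj_expI, conj_gaussConf, gaussConf_eq, gaussConf_eq,
      inner_neg_left]
    rw [mul_left_comm, ← Complex.ofReal_mul, ← Real.exp_add, ← mul_assoc, ← Complex.ofReal_mul,
      ← Real.exp_add, mul_comm]
    congr 3
    simp only [norm_sub_sq_real, norm_smul, inner_smul_right, mul_pow, Real.norm_eq_abs, sq_abs]
    ring
  rw [stft_apply]
  simp_rw [e]
  rw [integral_const_mul, integral_gauss_sub_expI (by positivity), norm_neg, inner_neg_left,
    inner_smul_right]
  rw [show Real.pi / (2 * Real.pi) = 1 / 2 by field_simp,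
    show Real.pi ^ 2 / (2 * Real.pi) = Real.pi / 2 by field_simp,
    show -(1 / 2 * ⟪z.2, z.1⟫ : ℝ) = -(⟪z.2, z.1⟫ / 2) by ring]
  push_cast
  ring

theorem integrable_gauss_prod {a : ℝ} (ha : 0 < a) :
    Integrable fun z : Phase d => Real.exp (-a * ‖z.1‖ ^ 2) * Real.exp (-a * ‖z.2‖ ^ 2) := by
  have h := integrable_gauss_sub (d := d) ha 0
  simp only [sub_zero] at h
  exact h.mul_prod h

theorem integrable_stft_gauss_gauss : Integrable (stft (gaussConf (d := d)) gaussConf) := by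
  have h := (integrable_gauss_prod (d := d) (a := Real.pi / 2) (by positivity)).const_mul
    ((1 / 2 : ℝ) ^ ((d : ℝ) / 2))
  refine h.mono' (stronglyMeasurable_stft' continuous_gaussConf.aestronglyMeasurable
    continuous_gaussConf.aestronglyMeasurable).aestronglyMeasurable (ae_of_all _ fun z => ?_)
  rw [stft_gauss_gauss, norm_mul, norm_expI, Complex.norm_real, Real.norm_of_nonneg (by positivity)]
  rw [mul_one, mul_assoc]

theorem integrable_mul_gauss {f : Conf d → ℂ} (hf : MemLp f 2) :
    Integrable fun t => f t * gaussConf t := by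
  have := integrable_mul_conj hf memLp_gaussConf
  simpa only [conj_gaussConf] using this

/-- The orthogonality relation with one pair Gaussian. In this case V_φ φ is integrable, so Fubini
applies directly and no density argument is required. -/
theorem integral_stft_mul_conj_gauss {f k : Conf d → ℂ} (hf : MemLp f 2) (hk : MemLp k 2) :
    ∫ z, stft k f z * conj (stft gaussConf gaussConf z) =
      stft gaussConf f 0 * conj (stft gaussConf k 0) := by
  have hA : stft gaussConf f 0 = ∫ t, f t * gaussConf t := by
    simp only [stft_apply, tfShift_zero, conj_gaussConf]
  have hB : conj (stft gaussConf k 0) = ∫ t, conj (k t) * gaussConf t := by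
    simp only [stft_apply, tfShift_zero, conj_gaussConf, ← integral_conj, map_mul]
  rw [hA, hB]
  have hcont : Continuous fun z : Phase d => stft gaussConf gaussConf z := by
    simp_rw [stft_gauss_gauss]
    have := continuous_expI
    fun_prop
  refine integral_stft_mul hf hk (Complex.continuous_conj.comp_aestronglyMeasurable
    hcont.aestronglyMeasurable |> fun h => (integrable_stft_gauss_gauss.norm.mono' h
      (ae_of_all _ fun z => by simp))) (fun x => ?_) (integrable_mul_gauss hf)
      (integrable_mul_gauss hk.star) fun x t => ?_
  · have h := (integrable_gauss_sub (d := d) (a := Real.pi / 2) (by positivity) 0).const_mul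
      ((1 / 2 : ℝ) ^ ((d : ℝ) / 2) * Real.exp (-(Real.pi / 2) * ‖x‖ ^ 2))
    refine h.mono' (Continuous.aestronglyMeasurable (by fun_prop)) (ae_of_all _ fun ξ => ?_)
    rw [RCLike.norm_conj, stft_gauss_gauss, norm_mul, norm_expI, Complex.norm_real,
      Real.norm_of_nonneg (by positivity), mul_one, sub_zero]
  · have e : ∀ ξ, conj (stft gaussConf gaussConf (x, ξ)) * expI (-⟪ξ, t⟫) =
        (((1 / 2 : ℝ) ^ ((d : ℝ) / 2) * Real.exp (-(Real.pi / 2) * ‖x‖ ^ 2) : ℝ) : ℂ) *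
        (((Real.exp (-(Real.pi / 2) * ‖ξ‖ ^ 2) : ℝ) : ℂ) *
          expI ⟪(1 / 2 : ℝ) • x - t, ξ⟫) := by
      intro ξ
      have : expI ⟪(1 / 2 : ℝ) • x - t, ξ⟫ = expI (⟪ξ, x⟫ / 2) * expI (-⟪ξ, t⟫) := by
        rw [← expI_add, inner_sub_left, real_inner_smul_left, real_inner_comm x, real_inner_comm t]
        congr 1; ring
      rw [this, stft_gauss_gauss, map_mul, conj_expI, Complex.conj_ofReal, neg_neg]
      push_cast; ring
    simp_rw [e]
    rw [integral_const_mul, integral_gauss_expI (by positivity), gaussConf_eq, gaussConf_eq,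
      ← Complex.ofReal_mul, ← Complex.ofReal_mul]
    congr 1
    rw [show Real.pi / (Real.pi / 2) = 2 by field_simp,
      show Real.pi ^ 2 / (Real.pi / 2) = 2 * Real.pi by field_simp]
    have h2 : (1 / 2 : ℝ) ^ ((d : ℝ) / 2) * 2 ^ ((d : ℝ) / 2) = 1 := by
      rw [← Real.mul_rpow (by norm_num) (by norm_num)]; norm_num
    have h3 : Real.exp (-(Real.pi / 2) * ‖x‖ ^ 2) *
        Real.exp (-(2 * Real.pi) * ‖(1 / 2 : ℝ) • x - t‖ ^ 2) =
        Real.exp (-Real.pi * ‖t‖ ^ 2) * Real.exp (-Real.pi * ‖t - x‖ ^ 2) := by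
      rw [← Real.exp_add, ← Real.exp_add]
      congr 1
      simp only [norm_sub_sq_real, norm_smul, real_inner_smul_left, mul_pow, Real.norm_eq_abs,
        sq_abs]
      rw [real_inner_comm t x]
      ring
    -- The normalising powers of 2 cancel, and the two exponents agree by completing the square.
    linear_combination h3 + (Real.exp (-(Real.pi / 2) * ‖x‖ ^ 2) *
        Real.exp (-(2 * Real.pi) * ‖(1 / 2 : ℝ) • x - t‖ ^ 2)) * h2


/-! ### Tight frames -/

/-- Polarisation of the frame identity over f + c k with c = ±1, ±i. -/
theorem hasSum_mul_conj_of_tight {ι : Type*} {e : ι → Conf d → ℂ} (he : ∀ l, MemLp (e l) 2)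
    (h : ∀ f : Conf d → ℂ, MemLp f 2 →
      HasSum (fun l => ‖∫ t, f t * conj (e l t)‖ ^ 2) (∫ t, ‖f t‖ ^ 2))
    {f k : Conf d → ℂ} (hf : MemLp f 2) (hk : MemLp k 2) :
    HasSum (fun l => (∫ t, f t * conj (e l t)) * conj (∫ t, k t * conj (e l t)))
      (∫ t, f t * conj (k t)) := by
  have pol : ∀ a b : ℂ, a * conj b = (1 / 4 : ℂ) * (((‖a + 1 * b‖ ^ 2 : ℝ) : ℂ) -
      ((‖a + (-1) * b‖ ^ 2 : ℝ) : ℂ) + Complex.I * ((‖a + Complex.I * b‖ ^ 2 : ℝ) : ℂ) -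
      Complex.I * ((‖a + (-Complex.I) * b‖ ^ 2 : ℝ) : ℂ)) := by
    intro a b
    simp only [Complex.ofReal_pow, ← Complex.mul_conj', map_add, map_mul, map_neg, map_one,
      Complex.conj_I]
    ring_nf
    simp only [Complex.I_sq]
    ring
  have hc : ∀ c : ℂ, MemLp (fun t => f t + c * k t) 2 := fun c => hf.add (hk.const_mul c)
  have hS : ∀ c : ℂ, HasSum (fun l => ((‖(∫ t, f t * conj (e l t)) +
      c * (∫ t, k t * conj (e l t))‖ ^ 2 : ℝ) : ℂ)) (∫ t, ((‖f t + c * k t‖ ^ 2 : ℝ) : ℂ)) := by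
    intro c
    rw [integral_complex_ofReal]
    refine Complex.hasSum_ofReal.2 ?_
    have := h _ (hc c)
    convert this using 4 with l
    rw [← integral_const_mul, ← integral_add (integrable_mul_conj hf (he l))
      ((integrable_mul_conj hk (he l)).const_mul c)]
    congr 1; ext t; ring
  have hI : ∀ c : ℂ, Integrable fun t => ((‖f t + c * k t‖ ^ 2 : ℝ) : ℂ) := fun c =>
    ((memLp_two_iff_integrable_sq_norm (hc c).1).1 (hc c)).ofReal
  have key := ((((hS 1).sub (hS (-1))).add ((hS Complex.I).mul_left Complex.I)).sub
      ((hS (-Complex.I)).mul_left Complex.I)).mul_left (1 / 4 : ℂ)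
  have hint : ∫ t, f t * conj (k t) = (1 / 4 : ℂ) * ((∫ t, ((‖f t + 1 * k t‖ ^ 2 : ℝ) : ℂ)) -
      (∫ t, ((‖f t + (-1) * k t‖ ^ 2 : ℝ) : ℂ)) +
      Complex.I * (∫ t, ((‖f t + Complex.I * k t‖ ^ 2 : ℝ) : ℂ)) -
      Complex.I * (∫ t, ((‖f t + (-Complex.I) * k t‖ ^ 2 : ℝ) : ℂ))) := by
    have i1 : Integrable fun t => ((‖f t + 1 * k t‖ ^ 2 : ℝ) : ℂ) -
        ((‖f t + (-1) * k t‖ ^ 2 : ℝ) : ℂ) := (hI 1).sub (hI (-1))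
    have i2 : Integrable fun t => ((‖f t + 1 * k t‖ ^ 2 : ℝ) : ℂ) -
        ((‖f t + (-1) * k t‖ ^ 2 : ℝ) : ℂ) +
        Complex.I * ((‖f t + Complex.I * k t‖ ^ 2 : ℝ) : ℂ) := i1.add ((hI _).const_mul _)
    rw [← integral_const_mul Complex.I, ← integral_const_mul Complex.I,
      ← integral_sub (hI 1) (hI (-1)), ← integral_add i1 ((hI _).const_mul _),
      ← integral_sub i2 ((hI _).const_mul _), ← integral_const_mul]
    exact integral_congr_ae (ae_of_all _ fun t => pol (f t) (k t))
  rw [hint]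
  exact key.congr_fun fun l => pol _ _

theorem stft_eq_tfShift_neg (g f : Conf d → ℂ) (z u : Phase d) :
    ‖stft g f (z + u)‖ = ‖stft g (tfShift (-u) f) z‖ := by
  rw [stft_tfShift_right, norm_mul, norm_expI, one_mul, sub_neg_eq_add]

/-- A translate of a tight Gabor frame is a tight frame. -/
theorem IsTightGaborFrame.hasSum_add {Λ : Submodule ℤ (Phase d)} {g : Conf d → ℂ}
    (h : IsTightGaborFrame Λ g) (u : Phase d) {f : Conf d → ℂ} (hf : MemLp f 2) :
    HasSum (fun l : Λ => ‖stft g f ((l : Phase d) + u)‖ ^ 2) (∫ t, ‖f t‖ ^ 2) := by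
  have := h _ (memLp_tfShift hf (-u))
  simp_rw [stft_eq_tfShift_neg]
  convert this using 1
  simp_rw [norm_tfShift]
  exact (integral_sub_right_eq_self (fun t => ‖f t‖ ^ 2) _).symm

theorem IsTightGaborFrame.hasSum_mul_conj {Λ : Submodule ℤ (Phase d)} {g : Conf d → ℂ}
    (hg : MemLp g 2) (h : IsTightGaborFrame Λ g) (u : Phase d) {f k : Conf d → ℂ}
    (hf : MemLp f 2) (hk : MemLp k 2) :
    HasSum (fun l : Λ => stft g f ((l : Phase d) + u) * conj (stft g k ((l : Phase d) + u)))
      (∫ t, f t * conj (k t)) :=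
  hasSum_mul_conj_of_tight (e := fun l : Λ => tfShift ((l : Phase d) + u) g)
    (fun _ => memLp_tfShift hg _) (fun _ hf => h.hasSum_add u hf) hf hk

theorem integral_norm_gaussConf_sq_pos : 0 < ∫ t : Conf d, ‖gaussConf t‖ ^ 2 := by
  have h : ∀ t : Conf d, ‖gaussConf t‖ ^ 2 = Real.exp (-(2 * Real.pi) * ‖t‖ ^ 2) := by
    intro t
    rw [norm_gaussConf, ← Real.exp_nat_mul]
    congr 1; push_cast; ring
  simp_rw [h]
  rw [GaussianFourier.integral_rexp_neg_mul_sq_norm (by positivity)]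
  positivity

/-- Otherwise φ would be orthogonal to the whole frame and the frame identity would give ‖φ‖₂ = 0.
The nonzero value is the divisor in `dom_stft_gauss`. -/
theorem IsTightGaborFrame.exists_stft_gauss_ne_zero {Λ : Submodule ℤ (Phase d)} {g : Conf d → ℂ}
    (h : IsTightGaborFrame Λ g) : ∃ z, stft g gaussConf z ≠ 0 := by
  by_contra! hz
  have := h _ memLp_gaussConf
  simp only [hz, norm_zero, ne_eq, OfNat.ofNat_ne_zero, not_false_eq_true, zero_pow] at this
  exact integral_norm_gaussConf_sq_pos.ne (hasSum_zero.unique this)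

theorem norm_sq_le_fst_snd (z : Phase d) : ‖z‖ ^ 2 ≤ ‖z.1‖ ^ 2 + ‖z.2‖ ^ 2 := by
  rw [Prod.norm_def]
  rcases max_choice ‖z.1‖ ‖z.2‖ with h | h <;> rw [h]
  · linarith [sq_nonneg ‖z.2‖]
  · linarith [sq_nonneg ‖z.1‖]

theorem enorm_stft_gauss_gauss_le (z : Phase d) :
    ‖stft gaussConf gaussConf z‖ₑ ≤ ENNReal.ofReal (Real.exp (-(Real.pi / 2) * ‖z‖ ^ 2)) := by
  rw [← ofReal_norm]
  apply ENNReal.ofReal_le_ofReal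
  rw [stft_gauss_gauss, norm_mul, norm_expI, Complex.norm_real, Real.norm_of_nonneg (by positivity),
    mul_one, mul_assoc, ← Real.exp_add]
  calc _ ≤ 1 * Real.exp (-(Real.pi / 2) * ‖z.1‖ ^ 2 + -(Real.pi / 2) * ‖z.2‖ ^ 2) := by
        gcongr
        exact Real.rpow_le_one (by norm_num) (by norm_num) (by positivity)
    _ ≤ _ := by
        rw [one_mul]
        apply Real.exp_le_exp.2
        nlinarith [norm_sq_le_fst_snd z, Real.pi_pos]

/-- Passage from the window g to the Gaussian window. Orthogonality for π(-w)g and π(z₀)g gives |V_φ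
g(w)| |V_φ g(-z₀)| ≤ ∫ |V_g g(z + z₀ + w)| |V_φ φ(z)| dz, a convolution of an amalgam function with
a Gaussian; z₀ is chosen so that the second factor on the left is nonzero. The control becomes
pointwise on the way. -/
theorem dom_stft_gauss {Λ : Submodule ℤ (Phase d)} [DiscreteTopology Λ] [IsZLattice ℝ Λ]
    {𝒜 : SolidConvAlgebra Λ} {C : Set (Phase d)} (hC : IsAddFundamentalDomain Λ C volume)
    (hCb : Bornology.IsBounded C) {g : Conf d → ℂ} (hg : MemLp g 2)
    (hgA : AEDom 𝒜 C (fun z => ‖stft g g z‖ₑ)) (hframe : IsTightGaborFrame Λ g) :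
    Dom 𝒜 (fun z => ‖stft gaussConf g z‖ₑ) := by
  obtain ⟨z₀, hz₀⟩ := hframe.exists_stft_gauss_ne_zero
  set c := ‖stft gaussConf g (-z₀)‖ₑ with hc
  have hc0 : c ≠ 0 := by
    rw [hc, ← enorm_stft_swap]; simpa using hz₀
  have hct : c ≠ ∞ := by simp [hc]
  have hΓ : Dom 𝒜 (fun y => ‖stft (gaussConf (d := d)) gaussConf (-y - z₀)‖ₑ) := by
    have h1 : Dom 𝒜 (fun y : Phase d => ‖stft (gaussConf (d := d)) gaussConf y‖ₑ) :=
      (dom_gaussian (c := Real.pi / 2) (by positivity)).mono enorm_stft_gauss_gauss_le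
    simpa only [sub_eq_add_neg] using (h1.comp_add (-z₀)).comp_neg
  have hD := (AEDom.conv hC hCb hgA hΓ).const_mul (c⁻¹).toNNReal
  refine hD.mono fun w => ?_
  rw [ENNReal.coe_toNNReal (ENNReal.inv_ne_top.2 hc0), ← ENNReal.div_eq_inv_mul,
    ENNReal.le_div_iff_mul_le (Or.inl hc0) (Or.inl hct)]
  have hR := integral_stft_mul_conj_gauss (memLp_tfShift hg (-w)) (memLp_tfShift hg z₀)
  have h1 : ‖stft gaussConf g w‖ₑ * c = ‖stft gaussConf (tfShift (-w) g) 0 *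
      conj (stft gaussConf (tfShift z₀ g) 0)‖ₑ := by
    rw [enorm_mul, enorm_conj, enorm_stft_tfShift_right, enorm_stft_tfShift_right, sub_neg_eq_add,
      zero_add, zero_sub]
  rw [h1, ← hR]
  refine (enorm_integral_le_lintegral_enorm _).trans (le_of_eq ?_)
  rw [← lintegral_sub_right_eq_self _ (z₀ + w)]
  congr 1; ext z
  rw [enorm_mul, enorm_conj, enorm_stft_tfShift_left, enorm_stft_tfShift_right]
  congr 3 <;> abel

end

noncomputable section

open scoped NNReal Pointwise

variable {d : ℕ}

/-! ### Wigner distributions and their short-time Fourier transforms -/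

/-- The Gaussian atom `e^{-2π|u-m|²} e^{-2πi jD·u}` on phase space. -/
def narrowAtom (m D u : Phase d) : ℂ :=
  ((Real.exp (-(2 * Real.pi) * ‖u.1 - m.1‖ ^ 2) * Real.exp (-(2 * Real.pi) * ‖u.2 - m.2‖ ^ 2) : ℝ) : ℂ)
    * expI (-(⟪D.2, u.1⟫ - ⟪D.1, u.2⟫))

/-- The Gaussian weight `e^{-2π v·v/3}` on phase space. -/
def mixWeight (v : Phase d) : ℝ :=
  Real.exp (-(2 * Real.pi / 3) * ‖v.1‖ ^ 2) * Real.exp (-(2 * Real.pi / 3) * ‖v.2‖ ^ 2)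

theorem mixWeight_pos (v : Phase d) : 0 < mixWeight v := by unfold mixWeight; positivity

theorem continuous_mixWeight : Continuous (mixWeight (d := d)) := by unfold mixWeight; fun_prop

theorem integrable_mixWeight : Integrable (mixWeight (d := d)) :=
  integrable_gauss_prod (by positivity)

theorem gaussAtomConj_apply (p D u : Phase d) :
    gaussAtomConj p (symplJ D) u =
      ((Real.exp (-(Real.pi / 2) * ‖u.1 - p.1‖ ^ 2) *
        Real.exp (-(Real.pi / 2) * ‖u.2 - p.2‖ ^ 2) : ℝ) : ℂ) *
      expI (-(⟪D.2, u.1⟫ - ⟪D.1, u.2⟫)) := by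
  change Complex.exp (atomExponent p (symplJ D) u) = _
  rw [← Real.exp_add, expI, Complex.ofReal_exp, ← Complex.exp_add]
  congr 1
  simp only [atomExponent, phaseDot, symplJ, real_inner_self_eq_norm_sq, inner_neg_left,
    Prod.fst_sub, Prod.snd_sub]
  push_cast; ring

/-- Reciprocal rates add under convolution of Gaussians: 3/(2π) + 1/(2π) = 2/π. Thus 2π/3 is exactly
the rate that widens e^{-2π|·|²} to e^{-π|·|²/2}. -/
theorem integral_mix_one (b : Conf d) :
    ∫ v : Conf d, Real.exp (-(2 * Real.pi / 3) * ‖v‖ ^ 2) * Real.exp (-(2 * Real.pi) * ‖b - v‖ ^ 2) =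
      (3 / 8 : ℝ) ^ ((d : ℝ) / 2) * Real.exp (-(Real.pi / 2) * ‖b‖ ^ 2) := by
  have e : ∀ v : Conf d, Real.exp (-(2 * Real.pi / 3) * ‖v‖ ^ 2) *
      Real.exp (-(2 * Real.pi) * ‖b - v‖ ^ 2) = Real.exp (-(Real.pi / 2) * ‖b‖ ^ 2) *
        Real.exp (-(8 * Real.pi / 3) * ‖v - (3 / 4 : ℝ) • b‖ ^ 2) := by
    intro v
    rw [← Real.exp_add, ← Real.exp_add]
    congr 1
    simp only [norm_sub_sq_real, norm_smul, inner_smul_right, mul_pow, Real.norm_eq_abs, sq_abs]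
    rw [real_inner_comm v b]
    ring
  simp_rw [e]
  rw [integral_const_mul,
    integral_sub_right_eq_self (fun v : Conf d => Real.exp (-(8 * Real.pi / 3) * ‖v‖ ^ 2)),
    GaussianFourier.integral_rexp_neg_mul_sq_norm (by positivity), finrank_euclideanSpace_fin,
    show Real.pi / (8 * Real.pi / 3) = 3 / 8 by field_simp, mul_comm]

/-- The modulation of a narrow atom does not depend on its centre, so averaging over centres only
widens the Gaussian. The atoms of Ψ thereby become mixtures of atoms that can be paired with Wigner
distributions in closed form. -/
theorem integral_mixWeight_mul_narrowAtom (p D u : Phase d) :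
    ∫ v, (mixWeight v : ℂ) * narrowAtom (p + v) D u =
      (((3 / 8 : ℝ) ^ (d : ℝ) : ℝ) : ℂ) * gaussAtomConj p (symplJ D) u := by
  have e : ∀ v : Phase d, (mixWeight v : ℂ) * narrowAtom (p + v) D u =
      expI (-(⟪D.2, u.1⟫ - ⟪D.1, u.2⟫)) *
      ((((fun v : Conf d => Real.exp (-(2 * Real.pi / 3) * ‖v‖ ^ 2) *
          Real.exp (-(2 * Real.pi) * ‖(u.1 - p.1) - v‖ ^ 2)) v.1 *
        (fun v : Conf d => Real.exp (-(2 * Real.pi / 3) * ‖v‖ ^ 2) *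
          Real.exp (-(2 * Real.pi) * ‖(u.2 - p.2) - v‖ ^ 2)) v.2 : ℝ)) : ℂ) := by
    intro v
    simp only [narrowAtom, mixWeight, Prod.fst_add, Prod.snd_add, sub_add_eq_sub_sub]
    push_cast; ring
  simp_rw [e]
  rw [integral_const_mul, integral_complex_ofReal, Measure.volume_eq_prod,
    integral_prod_mul (L := ℝ) (fun v : Conf d => Real.exp (-(2 * Real.pi / 3) * ‖v‖ ^ 2) *
          Real.exp (-(2 * Real.pi) * ‖(u.1 - p.1) - v‖ ^ 2))
      (fun v : Conf d => Real.exp (-(2 * Real.pi / 3) * ‖v‖ ^ 2) *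
          Real.exp (-(2 * Real.pi) * ‖(u.2 - p.2) - v‖ ^ 2)), integral_mix_one, integral_mix_one,
    gaussAtomConj_apply]
  have : ((3 / 8 : ℝ) ^ ((d : ℝ) / 2)) * ((3 / 8 : ℝ) ^ ((d : ℝ) / 2)) = (3 / 8 : ℝ) ^ (d : ℝ) := by
    rw [← Real.rpow_add (by norm_num)]; ring_nf
  rw [← this]
  push_cast; ring

/-- The Wigner distribution as a short-time Fourier transform. -/
theorem wigner_half (h f : Conf d → ℂ) (z : Phase d) :
    wigner h f ((1 / 2 : ℝ) • z) =
      (2 : ℂ) ^ d * expI (⟪z.1, z.2⟫ / 2) * stft (fun t => f (-t)) h z := by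
  have h1 : wigner h f ((1 / 2 : ℝ) • z) = ∫ t : Conf d, (fun s : Conf d => h s * conj (f (z.1 - s)) *
      expI (-⟪z.2, s⟫) * expI (⟪z.1, z.2⟫ / 2)) ((1 / 2 : ℝ) • z.1 + (1 / 2 : ℝ) • t) := by
    unfold wigner
    congr 1; ext t
    have e1 : Complex.exp (-(2 * Real.pi * Complex.I * (⟪t, ((1 / 2 : ℝ) • z).2⟫ : ℝ))) =
        expI (-⟪z.2, (1 / 2 : ℝ) • z.1 + (1 / 2 : ℝ) • t⟫) * expI (⟪z.1, z.2⟫ / 2) := by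
      rw [← expI_add, expI]
      congr 1
      simp only [Prod.smul_snd, inner_smul_right, inner_add_right, real_inner_comm z.2]
      push_cast; ring
    rw [e1]
    simp only [Prod.smul_fst]
    have e2 : z.1 - ((1 / 2 : ℝ) • z.1 + (1 / 2 : ℝ) • t) = (1 / 2 : ℝ) • z.1 - (1 / 2 : ℝ) • t := by
      module
    rw [e2]; ring
  rw [h1, Measure.integral_comp_smul (volume : Measure (Conf d))
    (fun t => (fun s : Conf d => h s * conj (f (z.1 - s)) *
      expI (-⟪z.2, s⟫) * expI (⟪z.1, z.2⟫ / 2)) ((1 / 2 : ℝ) • z.1 + t)),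
    integral_add_left_eq_self (fun s : Conf d => h s * conj (f (z.1 - s)) *
      expI (-⟪z.2, s⟫) * expI (⟪z.1, z.2⟫ / 2)), finrank_euclideanSpace_fin, integral_mul_const,
    stft_apply]
  have e3 : ∀ t, h t * conj (tfShift z (fun t => f (-t)) t) =
      h t * conj (f (z.1 - t)) * expI (-⟪z.2, t⟫) := by
    intro t
    rw [tfShift_apply, map_mul, conj_expI, neg_sub]; ring
  simp_rw [e3]
  have e4 : |((1 / 2 : ℝ) ^ d)⁻¹| = 2 ^ d := by
    rw [abs_of_pos (by positivity)]; simp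
  rw [e4, Complex.real_smul]
  push_cast; ring

theorem wigner_eq_stft (h f : Conf d → ℂ) (u : Phase d) :
    wigner h f u = (2 : ℂ) ^ d * expI (2 * ⟪u.1, u.2⟫) * stft (fun t => f (-t)) h ((2 : ℝ) • u) := by
  have := wigner_half h f ((2 : ℝ) • u)
  rw [smul_smul, show (1 / 2 * 2 : ℝ) = 1 by norm_num, one_smul] at this
  rw [this]
  congr 3
  simp only [Prod.smul_fst, Prod.smul_snd, inner_smul_left, inner_smul_right]
  simp

theorem wigner_congr {f f' h h' : Conf d → ℂ} (hf : f =ᵐ[volume] f') (hh : h =ᵐ[volume] h') :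
    wigner h f = wigner h' f' := by
  have hf' : (fun t => f (-t)) =ᵐ[volume] fun t => f' (-t) :=
    (Measure.measurePreserving_neg (volume : Measure (Conf d))).quasiMeasurePreserving.ae_eq hf
  ext u
  rw [wigner_eq_stft, wigner_eq_stft, stft_congr hh hf']

theorem memLp_comp_neg {f : Conf d → ℂ} (hf : MemLp f 2) : MemLp (fun t => f (-t)) 2 :=
  hf.comp_measurePreserving (Measure.measurePreserving_neg volume)

theorem stronglyMeasurable_wigner {f h : Conf d → ℂ} (hf : MemLp f 2) (hh : MemLp h 2) :
    StronglyMeasurable (wigner h f) := by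
  have : wigner h f = fun u => (2 : ℂ) ^ d * expI (2 * ⟪u.1, u.2⟫) *
      stft (fun t => f (-t)) h ((2 : ℝ) • u) := funext (wigner_eq_stft h f)
  rw [this]
  refine StronglyMeasurable.mul ?_ ?_
  · exact Continuous.stronglyMeasurable (by have := continuous_expI; fun_prop)
  · exact (stronglyMeasurable_stft' hh.1 (memLp_comp_neg hf).1).comp_measurable (by fun_prop)

theorem exists_norm_wigner_le {f h : Conf d → ℂ} (hf : MemLp f 2) (hh : MemLp h 2) :
    ∃ K : ℝ, ∀ u, ‖wigner h f u‖ ≤ K := by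
  refine ⟨2 ^ d * (eLpNorm h 2 volume * eLpNorm (fun t => f (-t)) 2 volume).toReal, fun u => ?_⟩
  rw [wigner_eq_stft, norm_mul, norm_mul, norm_expI, norm_pow, mul_one, Complex.norm_ofNat]
  gcongr
  rw [← toReal_enorm]
  exact ENNReal.toReal_mono (ENNReal.mul_lt_top hh.2 (memLp_comp_neg hf).2).ne
    (enorm_stft_le hh (memLp_comp_neg hf) _)


theorem norm_narrowAtom (m D u : Phase d) :
    ‖narrowAtom m D u‖ = Real.exp (-(2 * Real.pi) * ‖u.1 - m.1‖ ^ 2) *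
      Real.exp (-(2 * Real.pi) * ‖u.2 - m.2‖ ^ 2) := by
  rw [narrowAtom, norm_mul, norm_expI, mul_one, Complex.norm_real, Real.norm_of_nonneg (by positivity)]

/-- The kernel against which the short-time Fourier transform is integrated in order to pair a
Wigner distribution with an atom. -/
def pairingKernel (m D z : Phase d) : ℂ :=
  ((1 / 2 : ℂ) ^ d * expI (⟪z.1, z.2⟫ / 2)) * narrowAtom m D ((1 / 2 : ℝ) • z)

theorem neg_two_pi_mul_norm_half_smul_sub (a b : Conf d) :
    -(2 * Real.pi) * ‖(1 / 2 : ℝ) • a - b‖ ^ 2 = -(Real.pi / 2) * ‖a - (2 : ℝ) • b‖ ^ 2 := by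
  have : (1 / 2 : ℝ) • a - b = (1 / 2 : ℝ) • (a - (2 : ℝ) • b) := by module
  rw [this, norm_smul, mul_pow]; norm_num; ring

theorem continuous_pairingKernel (m D : Phase d) : Continuous (pairingKernel m D) := by
  have h0 : Continuous (narrowAtom m D) := by
    unfold narrowAtom
    have := continuous_expI
    fun_prop
  have h1 : Continuous fun z : Phase d => narrowAtom m D ((1 / 2 : ℝ) • z) :=
    h0.comp (g := narrowAtom m D) (f := fun z : Phase d => (1 / 2 : ℝ) • z) (continuous_const_smul _)
  exact (continuous_const.mul (continuous_expI.comp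
    ((continuous_fst.inner continuous_snd).div_const 2))).mul h1

theorem norm_pairingKernel (m D z : Phase d) : ‖pairingKernel m D z‖ = (1 / 2 : ℝ) ^ d *
      (Real.exp (-(Real.pi / 2) * ‖z.1 - (2 : ℝ) • m.1‖ ^ 2) *
      Real.exp (-(Real.pi / 2) * ‖z.2 - (2 : ℝ) • m.2‖ ^ 2)) := by
  have h1 : ‖(1 / 2 : ℂ) ^ d‖ = (1 / 2 : ℝ) ^ d := by simp
  rw [pairingKernel, norm_mul, norm_mul, norm_expI, h1, mul_one, norm_narrowAtom]
  congr 3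
  · exact neg_two_pi_mul_norm_half_smul_sub _ _
  · exact neg_two_pi_mul_norm_half_smul_sub _ _

/-- Supplies the factorisation required by `integral_stft_mul`. The parallelogram law splits the two
quadratic exponents into Gaussians centred at the positions of m + D/2 and m - D/2. -/
theorem integral_pairingKernel (m D : Phase d) (x t : Conf d) :
    ∫ ξ, pairingKernel m D (x, ξ) * expI (-⟪ξ, t⟫) =
      conj (tfShift (m + (1 / 2 : ℝ) • D) gaussConf t) *
        (((((1 / 2 : ℝ) ^ ((d : ℝ) / 2) : ℝ) : ℂ) * expI ⟪m.2, D.1⟫) *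
          tfShift (m - (1 / 2 : ℝ) • D) gaussConf (-(t - x))) := by
  have e : ∀ ξ, pairingKernel m D (x, ξ) * expI (-⟪ξ, t⟫) =
      ((1 / 2 : ℂ) ^ d * ((Real.exp (-(2 * Real.pi) * ‖(1 / 2 : ℝ) • x - m.1‖ ^ 2) : ℝ) : ℂ) *
        expI (-(⟪D.2, x⟫ / 2))) *
      (((Real.exp (-(Real.pi / 2) * ‖ξ - (2 : ℝ) • m.2‖ ^ 2) : ℝ) : ℂ) *
        expI ⟪(1 / 2 : ℝ) • x + (1 / 2 : ℝ) • D.1 - t, ξ⟫) := by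
    intro ξ
    have hsc := neg_two_pi_mul_norm_half_smul_sub ξ m.2
    have hph : expI (⟪x, ξ⟫ / 2) * expI (-(⟪D.2, (1 / 2 : ℝ) • x⟫ - ⟪D.1, (1 / 2 : ℝ) • ξ⟫)) *
        expI (-⟪ξ, t⟫) = expI (-(⟪D.2, x⟫ / 2)) *
          expI ⟪(1 / 2 : ℝ) • x + (1 / 2 : ℝ) • D.1 - t, ξ⟫ := by
      simp only [← expI_add, inner_sub_left, inner_add_left, real_inner_smul_left,
        inner_smul_right, real_inner_comm t ξ]
      congr 1; ring
    simp only [pairingKernel, narrowAtom, Prod.smul_fst, Prod.smul_snd, hsc]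
    push_cast
    linear_combination ((1 / 2 : ℂ) ^ d *
      Complex.exp (-(2 * Real.pi) * ‖(1 / 2 : ℝ) • x - m.1‖ ^ 2) *
      Complex.exp (-(Real.pi / 2) * ‖ξ - (2 : ℝ) • m.2‖ ^ 2)) * hph
  simp_rw [e]
  rw [integral_const_mul, integral_gauss_sub_expI (by positivity)]
  rw [show Real.pi / (Real.pi / 2) = 2 by field_simp,
    show Real.pi ^ 2 / (Real.pi / 2) = 2 * Real.pi by field_simp]
  have hexp : Real.exp (-(2 * Real.pi) * ‖(1 / 2 : ℝ) • x - m.1‖ ^ 2) *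
      Real.exp (-(2 * Real.pi) * ‖(1 / 2 : ℝ) • x + (1 / 2 : ℝ) • D.1 - t‖ ^ 2) =
      Real.exp (-Real.pi * ‖t - (m + (1 / 2 : ℝ) • D).1‖ ^ 2) *
      Real.exp (-Real.pi * ‖-(t - x) - (m - (1 / 2 : ℝ) • D).1‖ ^ 2) := by
    rw [← Real.exp_add, ← Real.exp_add]
    congr 1
    have h1 := parallelogram_law_with_norm ℝ (t - (m + (1 / 2 : ℝ) • D).1)
      (-(t - x) - (m - (1 / 2 : ℝ) • D).1)
    have e1 : (t - (m + (1 / 2 : ℝ) • D).1) + (-(t - x) - (m - (1 / 2 : ℝ) • D).1) =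
        (2 : ℝ) • ((1 / 2 : ℝ) • x - m.1) := by
      simp only [Prod.fst_add, Prod.fst_sub, Prod.smul_fst]; module
    have e2 : (t - (m + (1 / 2 : ℝ) • D).1) - (-(t - x) - (m - (1 / 2 : ℝ) • D).1) =
        (-2 : ℝ) • ((1 / 2 : ℝ) • x + (1 / 2 : ℝ) • D.1 - t) := by
      simp only [Prod.fst_add, Prod.fst_sub, Prod.smul_fst]; module
    rw [e1, e2, norm_smul, norm_smul, norm_neg, Real.norm_ofNat] at h1
    linear_combination (-Real.pi / 2) * h1
  have hph : expI (-(⟪D.2, x⟫ / 2)) *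
      expI ⟪(1 / 2 : ℝ) • x + (1 / 2 : ℝ) • D.1 - t, (2 : ℝ) • m.2⟫ =
      expI (-⟪(m + (1 / 2 : ℝ) • D).2, t⟫) * (expI ⟪m.2, D.1⟫ *
        expI ⟪(m - (1 / 2 : ℝ) • D).2, -(t - x)⟫) := by
    simp only [← expI_add, Prod.snd_add, Prod.snd_sub, Prod.smul_snd, inner_sub_left,
      inner_add_left, real_inner_smul_left, inner_smul_right, inner_neg_right, inner_sub_right]
    simp only [real_inner_comm m.2]
    congr 1; ring
  -- The factor (1/2)^d belongs to the kernel; 2^{d/2} comes from the Gaussian integral in ξ.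
  have hc : (1 / 2 : ℝ) ^ d * 2 ^ ((d : ℝ) / 2) = (1 / 2 : ℝ) ^ ((d : ℝ) / 2) := by
    have : (1 / 2 : ℝ) ^ d = (1 / 2 : ℝ) ^ ((d : ℝ) / 2) * (1 / 2 : ℝ) ^ ((d : ℝ) / 2) := by
      rw [← Real.rpow_add (by norm_num), add_halves, Real.rpow_natCast]
    rw [this, mul_assoc, ← Real.mul_rpow (by norm_num) (by norm_num)]; norm_num
  have hc' : (1 / 2 : ℂ) ^ d * ((2 ^ ((d : ℝ) / 2) : ℝ) : ℂ) =
      (((1 / 2 : ℝ) ^ ((d : ℝ) / 2) : ℝ) : ℂ) := by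
    rw [← hc]; push_cast; ring
  have hexp' := congrArg (fun r : ℝ => (r : ℂ)) hexp
  simp only [Complex.ofReal_mul] at hexp'
  simp only [tfShift_apply, map_mul, conj_expI, gaussConf_eq, Complex.conj_ofReal]
  rw [Complex.ofReal_mul (2 ^ _), ← hc']
  linear_combination ((1 / 2 : ℂ) ^ d * ((2 ^ ((d : ℝ) / 2) : ℝ) : ℂ) *
    expI (-(⟪D.2, x⟫ / 2)) *
      expI ⟪(1 / 2 : ℝ) • x + (1 / 2 : ℝ) • D.1 - t, (2 : ℝ) • m.2⟫) * hexp' +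
    ((1 / 2 : ℂ) ^ d * ((2 ^ ((d : ℝ) / 2) : ℝ) : ℂ) *
      ((Real.exp (-Real.pi * ‖t - (m + (1 / 2 : ℝ) • D).1‖ ^ 2) : ℝ) : ℂ) *
      ((Real.exp (-Real.pi * ‖-(t - x) - (m - (1 / 2 : ℝ) • D).1‖ ^ 2) : ℝ) : ℂ)) * hph

/-- Moyal's identity: up to a constant and a phase, the narrow atom is the conjugate of the Wigner
distribution of π(m + D/2)φ and π(m - D/2)φ. The proof rewrites the Wigner distribution as a
short-time Fourier transform with reflected window. -/
theorem integral_wigner_mul_narrowAtom {f h : Conf d → ℂ} (hf : MemLp f 2) (hh : MemLp h 2)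
    (m D : Phase d) :
    ∫ u, wigner h f u * narrowAtom m D u =
      (((1 / 2 : ℝ) ^ ((d : ℝ) / 2) : ℝ) : ℂ) * expI ⟪m.2, D.1⟫ *
        stft gaussConf h (m + (1 / 2 : ℝ) • D) * conj (stft gaussConf f (m - (1 / 2 : ℝ) • D)) := by
  set α : Conf d → ℂ := fun t => conj (tfShift (m + (1 / 2 : ℝ) • D) gaussConf t) with hα
  set β : Conf d → ℂ := fun s => ((((1 / 2 : ℝ) ^ ((d : ℝ) / 2) : ℝ) : ℂ) * expI ⟪m.2, D.1⟫) *
    tfShift (m - (1 / 2 : ℝ) • D) gaussConf (-s) with hβ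
  have h1 := integral_stft_mul (f := h) (k := fun t => f (-t)) hh (memLp_comp_neg hf) (N := pairingKernel m D)
    (α := α) (β := β) ?_ ?_ ?_ ?_ ?_
  · have h2 : ∫ z, stft (fun t => f (-t)) h z * pairingKernel m D z =
        ∫ u, wigner h f u * narrowAtom m D u := by
      -- The factor (1/4)^d offsets the Jacobian of z ↦ z/2 on the 2d-dimensional phase space.
      have e : ∀ z, stft (fun t => f (-t)) h z * pairingKernel m D z = (1 / 4 : ℂ) ^ d *
          (fun u => wigner h f u * narrowAtom m D u) ((1 / 2 : ℝ) • z) := by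
        intro z
        simp only [wigner_half, pairingKernel]
        have : (1 / 4 : ℂ) ^ d * 2 ^ d = (1 / 2) ^ d := by rw [← mul_pow]; norm_num
        rw [← this]; ring
      simp_rw [e]
      rw [integral_const_mul, Measure.integral_comp_smul volume
        (fun u => wigner h f u * narrowAtom m D u)]
      have hfr : Module.finrank ℝ (Phase d) = 2 * d := by
        simp [Phase, Module.finrank_prod, two_mul]
      rw [hfr, pow_mul, Complex.real_smul, ← mul_assoc]
      have : (1 / 4 : ℂ) ^ d * ((|(((1 / 2 : ℝ) ^ 2) ^ d)⁻¹| : ℝ) : ℂ) = 1 := by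
        rw [abs_of_pos (by positivity)]
        push_cast
        rw [← inv_pow, ← mul_pow]; norm_num
      rw [this, one_mul]
    have h3 : ∫ t, conj (f (-t)) * β t = ((((1 / 2 : ℝ) ^ ((d : ℝ) / 2) : ℝ) : ℂ) *
        expI ⟪m.2, D.1⟫) * conj (stft gaussConf f (m - (1 / 2 : ℝ) • D)) := by
      rw [stft_apply, ← integral_conj, ← integral_const_mul,
        ← integral_neg_eq_self (fun t => _ * conj (f t * conj (tfShift (m - (1 / 2 : ℝ) • D)
          gaussConf t)))]
      refine integral_congr_ae (ae_of_all _ fun t => ?_)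
      simp only [hβ, map_mul, Complex.conj_conj]
      ring
    rw [← h2, h1, h3, hα, stft_apply gaussConf h]
    ring
  · refine Integrable.mono' (g := fun z : Phase d => (1 / 2 : ℝ) ^ d *
      (Real.exp (-(Real.pi / 2) * ‖z.1 - (2 : ℝ) • m.1‖ ^ 2) *
      Real.exp (-(Real.pi / 2) * ‖z.2 - (2 : ℝ) • m.2‖ ^ 2))) ?_ (continuous_pairingKernel m D).aestronglyMeasurable
      (ae_of_all _ fun z => (norm_pairingKernel m D z).le)
    exact ((integrable_gauss_sub (by positivity) _).mul_prod
      (integrable_gauss_sub (by positivity) _)).const_mul _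
  · intro x
    refine Integrable.mono' (g := fun ξ : Conf d => (1 / 2 : ℝ) ^ d *
      (Real.exp (-(Real.pi / 2) * ‖x - (2 : ℝ) • m.1‖ ^ 2) *
      Real.exp (-(Real.pi / 2) * ‖ξ - (2 : ℝ) • m.2‖ ^ 2))) ?_
      ((continuous_pairingKernel m D).comp (by fun_prop : Continuous fun ξ : Conf d => (x, ξ))).aestronglyMeasurable
      (ae_of_all _ fun ξ => (norm_pairingKernel m D (x, ξ)).le)
    exact ((integrable_gauss_sub (by positivity) _).const_mul _).const_mul _
  · exact integrable_mul_conj hh (memLp_tfShift memLp_gaussConf _)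
  · have := (integrable_mul_conj (memLp_tfShift memLp_gaussConf (m - (1 / 2 : ℝ) • D)) hf).comp_neg
    refine (this.const_mul ((((1 / 2 : ℝ) ^ ((d : ℝ) / 2) : ℝ) : ℂ) * expI ⟪m.2, D.1⟫)).congr
      (ae_of_all _ fun t => ?_)
    simp only [hβ]; ring
  · exact integral_pairingKernel m D

end

/-! ### Short-time Fourier transforms of Wigner distributions as Gaussian mixtures -/

noncomputable section

open scoped NNReal Pointwise

variable {d : ℕ}

/-- The constant in the formula for the short-time Fourier transform of a Wigner distribution. -/
def wignerConst (d : ℕ) : ℝ := (1 / 2 : ℝ) ^ ((d : ℝ) / 2) * ((3 / 8 : ℝ) ^ (d : ℝ))⁻¹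

theorem integrable_narrow_mix {W : Phase d → ℂ} (hW : StronglyMeasurable W) {K : ℝ}
    (hK : ∀ u, ‖W u‖ ≤ K) (p D : Phase d) :
    Integrable (fun q : Phase d × Phase d => W q.1 * ((mixWeight q.2 : ℂ) * narrowAtom (p + q.2) D q.1))
      (volume.prod volume) := by
  have h1 := (integrable_gauss_prod (d := d) (a := 2 * Real.pi) (by positivity)).comp_sub_right p
  have h2 := (integrable_mixWeight (d := d)).convolution_integrand (ContinuousLinearMap.mul ℝ ℝ) h1
  refine (h2.const_mul K).mono' ?_ (ae_of_all _ fun q => ?_)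
  · refine (hW.comp_measurable measurable_fst).aestronglyMeasurable.mul
      (Continuous.aestronglyMeasurable ?_)
    have := continuous_expI
    unfold mixWeight narrowAtom
    fun_prop
  · rw [norm_mul, norm_mul, norm_narrowAtom, Complex.norm_real,
      Real.norm_of_nonneg (mixWeight_pos _).le]
    simp only [ContinuousLinearMap.mul_apply', Prod.fst_add, Prod.snd_add, Prod.fst_sub,
      Prod.snd_sub]
    rw [sub_add_eq_sub_sub_swap q.1.1, sub_add_eq_sub_sub_swap q.1.2]
    have := (mixWeight_pos q.2).le
    gcongr
    exact hK _

theorem integral_mul_gaussAtomConj {W : Phase d → ℂ} (hW : StronglyMeasurable W) {K : ℝ}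
    (hK : ∀ u, ‖W u‖ ≤ K) (p D : Phase d) :
    ∫ v, (mixWeight v : ℂ) * ∫ u, W u * narrowAtom (p + v) D u =
      (((3 / 8 : ℝ) ^ (d : ℝ) : ℝ) : ℂ) * ∫ u, W u * gaussAtomConj p (symplJ D) u := by
  have h := integral_integral_swap (μ := (volume : Measure (Phase d))) (ν := (volume : Measure (Phase d)))
    (f := fun u v => W u * ((mixWeight v : ℂ) * narrowAtom (p + v) D u))
    (integrable_narrow_mix hW hK p D)
  simp only [integral_const_mul, integral_mixWeight_mul_narrowAtom] at h
  rw [← integral_const_mul]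
  calc _ = ∫ v, ∫ u, W u * ((mixWeight v : ℂ) * narrowAtom (p + v) D u) := by
        congr 1; ext v
        rw [← integral_const_mul]
        congr 1; ext u; ring
    _ = _ := by
        rw [← h]; congr 1; ext u; ring

/-- The atom of Ψ is written as a mixture of narrow atoms and Moyal's identity is applied to each.
At frequency `symplJ D` the arguments of the two transforms differ by D for every centre p + v; all
off-diagonal estimates rest on this. -/
theorem funSTFT_wigner {f h : Conf d → ℂ} (hf : MemLp f 2) (hh : MemLp h 2) (p D : Phase d) :
    funSTFT (wigner h f) p (symplJ D) = (wignerConst d : ℂ) * ∫ v, (mixWeight v : ℂ) *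
      (expI ⟪(p + v).2, D.1⟫ * stft gaussConf h (p + v + (1 / 2 : ℝ) • D) *
        conj (stft gaussConf f (p + v - (1 / 2 : ℝ) • D))) := by
  obtain ⟨K, hK⟩ := exists_norm_wigner_le hf hh
  have h1 := integral_mul_gaussAtomConj (stronglyMeasurable_wigner hf hh) hK p D
  have h0 : (((3 / 8 : ℝ) ^ (d : ℝ) : ℝ) : ℂ) ≠ 0 := by
    rw [Complex.ofReal_ne_zero]
    positivity
  rw [funSTFT, ← inv_mul_cancel_left₀ h0 (∫ u, _), ← h1, wignerConst, Complex.ofReal_mul,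
    Complex.ofReal_inv, mul_assoc, mul_left_comm]
  congr 1
  rw [← integral_const_mul]
  congr 1; ext v
  rw [integral_wigner_mul_narrowAtom hf hh]
  ring

theorem enorm_funSTFT_wigner_le {f h : Conf d → ℂ} (hf : MemLp f 2) (hh : MemLp h 2)
    (p D : Phase d) :
    ‖funSTFT (wigner h f) p (symplJ D)‖ₑ ≤ ENNReal.ofReal (wignerConst d) *
      ∫⁻ v, ENNReal.ofReal (mixWeight v) * (‖stft gaussConf h (p + v + (1 / 2 : ℝ) • D)‖ₑ *
        ‖stft gaussConf f (p + v - (1 / 2 : ℝ) • D)‖ₑ) := by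
  have hc : 0 ≤ wignerConst d := by unfold wignerConst; positivity
  rw [funSTFT_wigner hf hh, enorm_mul, ← ofReal_norm, Complex.norm_real, Real.norm_of_nonneg hc]
  gcongr
  refine (enorm_integral_le_lintegral_enorm _).trans (lintegral_mono fun v => ?_)
  rw [enorm_mul, enorm_mul, enorm_mul, enorm_expI, enorm_conj, one_mul, ← ofReal_norm (mixWeight v : ℂ),
    Complex.norm_real, Real.norm_of_nonneg (mixWeight_pos v).le]

/-! ### Summation of Wigner distributions over the frame -/

theorem stft_tfShift_eq_conj (g k : Conf d → ℂ) (y w : Phase d) :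
    stft k (tfShift w g) y = conj (stft g (tfShift y k) w) := by
  rw [stft_apply, stft_apply, ← integral_conj]
  congr 1; ext t
  rw [map_mul, Complex.conj_conj, mul_comm]

theorem tfShift_neg_gaussConf (x : Phase d) (t : Conf d) :
    tfShift x gaussConf (-t) = tfShift (-x) gaussConf t := by
  simp only [tfShift_apply, gaussConf_eq, Prod.fst_neg, Prod.snd_neg, inner_neg_left,
    inner_neg_right, sub_neg_eq_add]
  rw [← norm_neg (-t - x.1), neg_sub, sub_neg_eq_add, add_comm x.1]

/-- Narrow atoms are conjugates of Wigner distributions, up to constants and phases. Hence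
`funSTFT_wigner` also applies to them, which identifies the limit of the frame sums. -/
theorem wigner_tfShift_gaussConf (m D u : Phase d) :
    wigner (tfShift (m + (1 / 2 : ℝ) • D) gaussConf) (tfShift (m - (1 / 2 : ℝ) • D) gaussConf) u =
      ((2 ^ ((d : ℝ) / 2) : ℝ) : ℂ) * expI ⟪m.2, D.1⟫ * conj (narrowAtom m D u) := by
  set y := m + (1 / 2 : ℝ) • D with hy
  set x := m - (1 / 2 : ℝ) • D with hx
  have e1 : (fun t => tfShift x gaussConf (-t)) = tfShift (-x) gaussConf :=
    funext (tfShift_neg_gaussConf x)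
  have e2 : (2 : ℝ) • u - y + -x = (2 : ℝ) • (u - m) := by rw [hx, hy]; module
  have e3 : ∀ a : Conf d, -(Real.pi / 2) * ‖(2 : ℝ) • a‖ ^ 2 = -(2 * Real.pi) * ‖a‖ ^ 2 := by
    intro a; rw [norm_smul, Real.norm_ofNat]; ring
  have e4 : (2 : ℝ) ^ d * (1 / 2 : ℝ) ^ ((d : ℝ) / 2) = 2 ^ ((d : ℝ) / 2) := by
    have : (2 : ℝ) ^ d = (2 : ℝ) ^ ((d : ℝ) / 2) * (2 : ℝ) ^ ((d : ℝ) / 2) := by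
      rw [← Real.rpow_add (by norm_num), add_halves, Real.rpow_natCast]
    rw [this, mul_assoc, ← Real.mul_rpow (by norm_num) (by norm_num)]; norm_num
  have e4' : (2 : ℂ) ^ d * (((1 / 2 : ℝ) ^ ((d : ℝ) / 2) : ℝ) : ℂ) =
      ((2 ^ ((d : ℝ) / 2) : ℝ) : ℂ) := by
    rw [← e4]; push_cast; ring
  have hph : expI (2 * ⟪u.1, u.2⟫) * (expI (-⟪((2 : ℝ) • u).2 - y.2, y.1⟫) *
      (expI ⟪(-x).2, ((2 : ℝ) • u - y).1⟫ *
      expI (-(⟪((2 : ℝ) • (u - m)).2, ((2 : ℝ) • (u - m)).1⟫ / 2)))) =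
      expI ⟪m.2, D.1⟫ * expI (⟪D.2, u.1⟫ - ⟪D.1, u.2⟫) := by
    simp only [← expI_add]
    congr 1
    simp only [hx, hy, Prod.smul_fst, Prod.smul_snd, Prod.fst_add, Prod.snd_add, Prod.fst_sub,
      Prod.snd_sub, Prod.snd_neg, inner_sub_left, inner_sub_right, inner_add_left,
      inner_add_right, inner_neg_left, real_inner_smul_left, real_inner_smul_right]
    simp only [real_inner_comm u.1 u.2, real_inner_comm u.1 m.2, real_inner_comm u.1 D.2,
      real_inner_comm m.1 u.2, real_inner_comm m.1 m.2, real_inner_comm m.1 D.2,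
      real_inner_comm D.1 u.2, real_inner_comm D.1 m.2, real_inner_comm D.1 D.2]
    ring
  rw [wigner_eq_stft, e1, stft_tfShift_right, stft_tfShift_left, e2, stft_gauss_gauss, narrowAtom,
    map_mul, conj_expI, Complex.conj_ofReal, neg_neg, ← e4']
  simp only [Prod.smul_fst, Prod.smul_snd, Prod.fst_sub, Prod.snd_sub] at hph ⊢
  rw [e3, e3]
  push_cast at hph ⊢
  linear_combination ((2 : ℂ) ^ d * ((1 / 2 : ℝ) ^ ((d : ℝ) / 2) : ℝ) *
    Complex.exp (-(2 * Real.pi) * ‖u.1 - m.1‖ ^ 2) *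
    Complex.exp (-(2 * Real.pi) * ‖u.2 - m.2‖ ^ 2)) * hph

theorem hasSum_integral_of_tsum_enorm_le {ι α : Type*} [Countable ι] [MeasurableSpace α]
    {μ : Measure α} {F : ι → α → ℂ} {f : α → ℂ} (hF : ∀ i, AEStronglyMeasurable (F i) μ)
    (hf : ∀ a, HasSum (fun i => F i a) (f a)) {G : α → ℝ≥0∞}
    (hG : ∀ a, ∑' i, ‖F i a‖ₑ ≤ G a) (hGi : ∫⁻ a, G a ∂μ ≠ ∞) :
    HasSum (fun i => ∫ a, F i a ∂μ) (∫ a, f a ∂μ) := by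
  have h1 : ∑' i, ∫⁻ a, ‖F i a‖ₑ ∂μ ≠ ∞ := by
    rw [← lintegral_tsum fun i => (hF i).enorm]
    exact ((lintegral_mono hG).trans_lt hGi.lt_top).ne
  have h2 : ∀ i, Integrable (F i) μ := fun i =>
    ⟨hF i, (ENNReal.ne_top_of_tsum_ne_top h1 i).lt_top⟩
  have h3 : Summable fun i => ∫ a, ‖F i a‖ ∂μ := by
    have := ENNReal.summable_toReal h1
    refine this.congr fun i => ?_
    rw [integral_norm_eq_lintegral_enorm (hF i)]
  have h4 := hasSum_integral_of_summable_integral_norm h2 h3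
  rwa [funext fun a => (hf a).tsum_eq] at h4

theorem IsTightGaborFrame.tsum_enorm_mul_le {Λ : Submodule ℤ (Phase d)} {g : Conf d → ℂ}
    (h : IsTightGaborFrame Λ g) (u : Phase d) {f k : Conf d → ℂ} (hf : MemLp f 2)
    (hk : MemLp k 2) :
    ∑' l : Λ, ‖stft g f ((l : Phase d) + u)‖ₑ * ‖stft g k ((l : Phase d) + u)‖ₑ ≤
      ENNReal.ofReal (∫ t, ‖f t‖ ^ 2) + ENNReal.ofReal (∫ t, ‖k t‖ ^ 2) := by
  have key : ∀ {f : Conf d → ℂ}, MemLp f 2 → ∑' l : Λ, ‖stft g f ((l : Phase d) + u)‖ₑ ^ 2 =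
      ENNReal.ofReal (∫ t, ‖f t‖ ^ 2) := by
    intro f hf
    have := h.hasSum_add u hf
    rw [← this.tsum_eq, ENNReal.ofReal_tsum_of_nonneg (fun _ => by positivity) this.summable]
    congr 1; ext l
    rw [ENNReal.ofReal_pow (norm_nonneg _), ofReal_norm]
  rw [← key hf, ← key hk, ← ENNReal.tsum_add]
  refine ENNReal.tsum_le_tsum fun l => ?_
  rcases le_total ‖stft g f ((l : Phase d) + u)‖ₑ ‖stft g k ((l : Phase d) + u)‖ₑ with h | h
  · exact (mul_le_mul_left h _).trans (by rw [← sq]; exact le_add_self)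
  · exact (mul_le_mul_right h _).trans (by rw [← sq]; exact le_self_add)

theorem integral_norm_tfShift_sq (f : Conf d → ℂ) (z : Phase d) :
    ∫ t, ‖tfShift z f t‖ ^ 2 = ∫ t, ‖f t‖ ^ 2 := by
  simp_rw [norm_tfShift]
  exact integral_sub_right_eq_self (fun t => ‖f t‖ ^ 2) z.1

theorem IsTightGaborFrame.hasSum_stft_gauss {Λ : Submodule ℤ (Phase d)} {g : Conf d → ℂ}
    (hg : MemLp g 2) (h : IsTightGaborFrame Λ g) (u y y' : Phase d) :
    HasSum (fun l : Λ => stft gaussConf (tfShift ((l : Phase d) + u) g) y *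
      conj (stft gaussConf (tfShift ((l : Phase d) + u) g) y'))
      (stft gaussConf (tfShift y' gaussConf) y) := by
  have := h.hasSum_mul_conj hg u (memLp_tfShift memLp_gaussConf y')
    (memLp_tfShift memLp_gaussConf y)
  refine this.congr_fun fun l => ?_
  rw [stft_tfShift_eq_conj, stft_tfShift_eq_conj g _ y', Complex.conj_conj, mul_comm]

/-- The bound does not depend on y or y', so it serves as the dominating constant when the frame sum
is exchanged with the mixture integrals. -/
theorem IsTightGaborFrame.tsum_enorm_stft_gauss_le {Λ : Submodule ℤ (Phase d)} {g : Conf d → ℂ}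
    (h : IsTightGaborFrame Λ g) (u y y' : Phase d) :
    ∑' l : Λ, ‖stft gaussConf (tfShift ((l : Phase d) + u) g) y *
      conj (stft gaussConf (tfShift ((l : Phase d) + u) g) y')‖ₑ ≤
      2 * ENNReal.ofReal (∫ t : Conf d, ‖gaussConf t‖ ^ 2) := by
  have := h.tsum_enorm_mul_le u (memLp_tfShift memLp_gaussConf y)
    (memLp_tfShift memLp_gaussConf y')
  rw [integral_norm_tfShift_sq, integral_norm_tfShift_sq, ← two_mul] at this
  refine le_trans (le_of_eq ?_) this
  congr 1; ext l
  rw [stft_tfShift_eq_conj, stft_tfShift_eq_conj g _ y', Complex.conj_conj, enorm_mul, enorm_conj]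

theorem continuous_stft_gauss_tfShift :
    Continuous fun q : Phase d × Phase d => stft gaussConf (tfShift q.1 gaussConf) q.2 := by
  have := continuous_expI
  simp only [stft_tfShift_right, stft_gauss_gauss]
  fun_prop

theorem hasSum_mul_conj_of_tsum_enorm_le {ι : Type*} {a b : ι → ℂ} {A B : ℂ} (ha : HasSum a A)
    (hb : HasSum b B) {M : ℝ≥0∞} (hM : M ≠ ∞) (hae : ∑' i, ‖a i‖ₑ ≤ M) (hbe : ∑' i, ‖b i‖ₑ ≤ M) :
    (∑' q : ι × ι, ‖a q.1 * conj (b q.2)‖ₑ ≤ M * M) ∧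
      HasSum (fun q : ι × ι => a q.1 * conj (b q.2)) (A * conj B) := by
  have h : ∑' q : ι × ι, ‖a q.1 * conj (b q.2)‖ₑ ≤ M * M := by
    simp only [enorm_mul, enorm_conj]
    rw [ENNReal.tsum_prod (f := fun i j : ι => ‖a i‖ₑ * ‖b j‖ₑ)]
    simp_rw [ENNReal.tsum_mul_left, ENNReal.tsum_mul_right]
    exact mul_le_mul' hae hbe
  have h2 : HasSum (fun i => conj (b i)) (conj B) := hb.map (starRingEnd ℂ) Complex.continuous_conj
  have h3 := ENNReal.summable_toReal (h.trans_lt (ENNReal.mul_lt_top hM.lt_top hM.lt_top)).ne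
  have h4 : Summable fun q : ι × ι => ‖a q.1 * conj (b q.2)‖ := by
    simpa only [toReal_enorm] using h3
  exact ⟨h, HasSum.mul (g := fun i => conj (b i)) ha h2 h4.of_norm⟩

theorem norm_gaussAtomConj_le (p D w : Phase d) : ‖gaussAtomConj p (symplJ D) w‖ ≤ 1 := by
  rw [gaussAtomConj_apply, norm_mul, norm_expI, mul_one, Complex.norm_real,
    Real.norm_of_nonneg (by positivity)]
  refine mul_le_one₀ ?_ (by positivity) ?_ <;>
  · rw [Real.exp_le_one_iff, neg_mul, neg_nonpos]
    positivity

/-- The phase factors and weights in the double integral for a product of two short-time Fourier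
transforms of Wigner distributions. -/
def crossWeight (z D p D' : Phase d) (r : Phase d × Phase d) : ℂ :=
  (wignerConst d : ℂ) * (wignerConst d : ℂ) * ((mixWeight r.1 : ℂ) * (mixWeight r.2 : ℂ)) *
    (conj (expI ⟪(z + r.1).2, D.1⟫) * expI ⟪(p + r.2).2, D'.1⟫)

/-- The Gaussian cross term obtained after summation over a tight frame. -/
def crossGauss (z D p D' : Phase d) (r : Phase d × Phase d) : ℂ :=
  stft gaussConf (tfShift (z + r.1 + (1 / 2 : ℝ) • D) gaussConf) (p + r.2 + (1 / 2 : ℝ) • D') *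
    conj (stft gaussConf (tfShift (z + r.1 - (1 / 2 : ℝ) • D) gaussConf)
      (p + r.2 - (1 / 2 : ℝ) • D'))

theorem continuous_crossWeight (z D p D' : Phase d) : Continuous (crossWeight z D p D') := by
  have := continuous_expI
  have := continuous_mixWeight (d := d)
  have := Complex.continuous_conj
  unfold crossWeight
  fun_prop

theorem integrable_crossWeight (z D p D' : Phase d) :
    Integrable (crossWeight z D p D') (volume.prod volume) := by
  refine ((integrable_mixWeight (d := d)).mul_prod (integrable_mixWeight (d := d))).const_mul
    (‖(wignerConst d : ℂ)‖ * ‖(wignerConst d : ℂ)‖) |>.mono'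
    (continuous_crossWeight z D p D').aestronglyMeasurable (ae_of_all _ fun r => le_of_eq ?_)
  simp only [crossWeight, norm_mul, RCLike.norm_conj, norm_expI, Complex.norm_real, mul_one,
    Real.norm_of_nonneg (mixWeight_pos _).le]

theorem continuous_crossGauss (z D p D' : Phase d) : Continuous (crossGauss z D p D') := by
  have h1 := (continuous_stft_gauss_tfShift (d := d)).comp (by fun_prop : Continuous
    fun r : Phase d × Phase d => (z + r.1 + (1 / 2 : ℝ) • D, p + r.2 + (1 / 2 : ℝ) • D'))
  have h2 := (continuous_stft_gauss_tfShift (d := d)).comp (by fun_prop : Continuous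
    fun r : Phase d × Phase d => (z + r.1 - (1 / 2 : ℝ) • D, p + r.2 - (1 / 2 : ℝ) • D'))
  exact h1.mul (Complex.continuous_conj.comp h2)

/-- The mixture is undone twice. The inner integral is `funSTFT_wigner` for two shifted Gaussians,
whose Wigner distribution is a narrow atom; the outer integral recombines the narrow atoms into an
atom of Ψ. -/
theorem integral_crossWeight_mul_crossGauss (z D p D' : Phase d)
    (hint : Integrable (fun r => crossWeight z D p D' r * crossGauss z D p D' r)
      (volume.prod volume)) :
    ∫ r, crossWeight z D p D' r * crossGauss z D p D' r ∂(volume.prod volume) =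
      ∫ w, conj (gaussAtomConj z (symplJ D) w) * gaussAtomConj p (symplJ D') w := by
  -- One `wignerConst` is absorbed by the inner formula; the other cancels the constants of the
  -- narrow Wigner distribution and of the outer mixture.
  have hconst : (wignerConst d : ℂ) * (((2 ^ ((d : ℝ) / 2) : ℝ) : ℂ) * (((3 / 8 : ℝ) ^ (d : ℝ) : ℝ) : ℂ)) = 1 := by
    rw [wignerConst, ← Complex.ofReal_mul, ← Complex.ofReal_mul, ← Complex.ofReal_one]
    congr 1
    have h0 : ((3 / 8 : ℝ) ^ (d : ℝ)) ≠ 0 := by positivity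
    rw [mul_mul_mul_comm, inv_mul_cancel₀ h0, mul_one, ← Real.mul_rpow (by norm_num) (by norm_num)]
    norm_num
  have hb : ∀ w, ‖conj (gaussAtomConj p (symplJ D') w)‖ ≤ 1 := fun w => by
    rw [RCLike.norm_conj]; exact norm_gaussAtomConj_le p D' w
  have hsm : StronglyMeasurable fun w => conj (gaussAtomConj p (symplJ D') w) :=
    (Complex.continuous_conj.comp (gaussAtomConj p (symplJ D')).continuous).stronglyMeasurable
  have h3 := congrArg conj (integral_mul_gaussAtomConj hsm hb z D)
  rw [map_mul, Complex.conj_ofReal, ← integral_conj, ← integral_conj] at h3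
  have h4 : ∀ w, conj (conj (gaussAtomConj p (symplJ D') w) * gaussAtomConj z (symplJ D) w) =
      conj (gaussAtomConj z (symplJ D) w) * gaussAtomConj p (symplJ D') w := by
    intro w; rw [map_mul, Complex.conj_conj, mul_comm]
  simp_rw [h4] at h3
  rw [integral_prod _ hint, ← one_mul (∫ w, conj _ * _), ← hconst, mul_assoc (wignerConst d : ℂ), mul_assoc, ← h3,
    ← mul_assoc, ← integral_const_mul]
  congr 1; ext v'
  have h5 : ∀ v, crossWeight z D p D' (v', v) * crossGauss z D p D' (v', v) = ((wignerConst d : ℂ) * (mixWeight v' : ℂ) *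
      conj (expI ⟪(z + v').2, D.1⟫)) * ((wignerConst d : ℂ) * ((mixWeight v : ℂ) * (expI ⟪(p + v).2, D'.1⟫ *
      stft gaussConf (tfShift (z + v' + (1 / 2 : ℝ) • D) gaussConf) (p + v + (1 / 2 : ℝ) • D') *
      conj (stft gaussConf (tfShift (z + v' - (1 / 2 : ℝ) • D) gaussConf)
        (p + v - (1 / 2 : ℝ) • D'))))) := by
    intro v; simp only [crossWeight, crossGauss]; ring
  simp_rw [h5]
  rw [integral_const_mul, integral_const_mul,
    ← funSTFT_wigner (memLp_tfShift memLp_gaussConf _) (memLp_tfShift memLp_gaussConf _), funSTFT]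
  simp_rw [wigner_tfShift_gaussConf]
  rw [map_mul, Complex.conj_ofReal, ← integral_conj, conj_expI]
  have h6 : ∀ w, ((2 ^ ((d : ℝ) / 2) : ℝ) : ℂ) * expI ⟪(z + v').2, D.1⟫ *
      conj (narrowAtom (z + v') D w) * gaussAtomConj p (symplJ D') w =
      (((2 ^ ((d : ℝ) / 2) : ℝ) : ℂ) * expI ⟪(z + v').2, D.1⟫) *
      conj (conj (gaussAtomConj p (symplJ D') w) * narrowAtom (z + v') D w) := by
    intro w; rw [map_mul, Complex.conj_conj]; ring
  simp_rw [h6]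
  rw [integral_const_mul]
  linear_combination ((wignerConst d : ℂ) * (mixWeight v' : ℂ) * ((2 ^ ((d : ℝ) / 2) : ℝ) : ℂ) *
    ∫ w, conj (conj (gaussAtomConj p (symplJ D') w) * narrowAtom (z + v') D w)) *
    expI_mul_expI_neg ⟪(z + v').2, D.1⟫

/-- A Parseval identity on phase space tested on two Gaussian atoms. By the mixture formula each
term is a double Gaussian average. Under the average the sum over pairs is a product of two sums
over Λ, each given by the polarised frame identity. The first factor may be shifted by u because
translates of the frame are again tight. -/
theorem IsTightGaborFrame.hasSum_funSTFT_wigner {Λ : Submodule ℤ (Phase d)} [Countable Λ]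
    {g : Conf d → ℂ} (hg : MemLp g 2) (hframe : IsTightGaborFrame Λ g) (u p D' z D : Phase d) :
    HasSum (fun q : Λ × Λ =>
      funSTFT (wigner (tfShift ((q.1 : Phase d) + u) g) (tfShift (q.2 : Phase d) g)) p (symplJ D') *
        conj (funSTFT (wigner (tfShift ((q.1 : Phase d) + u) g) (tfShift (q.2 : Phase d) g)) z
          (symplJ D)))
      (∫ w, conj (gaussAtomConj z (symplJ D) w) * gaussAtomConj p (symplJ D') w) := by
  set M : ℝ≥0∞ := 2 * ENNReal.ofReal (∫ t : Conf d, ‖gaussConf t‖ ^ 2)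
  have hMt : M ≠ ∞ := ENNReal.mul_ne_top (by simp) ENNReal.ofReal_ne_top
  set w0 := crossWeight z D p D' with hw0
  set S := crossGauss z D p D' with hS
  -- The integrand for the pair q, without its weight. The shift 0 in the second factor lets the
  -- shifted frame lemmas serve both factors.
  let T : Λ × Λ → Phase d × Phase d → ℂ := fun q r =>
    (stft gaussConf (tfShift ((q.1 : Phase d) + u) g) (p + r.2 + (1 / 2 : ℝ) • D') *
      conj (stft gaussConf (tfShift ((q.1 : Phase d) + u) g) (z + r.1 + (1 / 2 : ℝ) • D))) *
    conj (stft gaussConf (tfShift ((q.2 : Phase d) + 0) g) (p + r.2 - (1 / 2 : ℝ) • D') *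
      conj (stft gaussConf (tfShift ((q.2 : Phase d) + 0) g) (z + r.1 - (1 / 2 : ℝ) • D)))
  have hTr : ∀ r, (∑' q, ‖T q r‖ₑ ≤ M * M) ∧ HasSum (fun q => T q r) (S r) := fun r =>
    hasSum_mul_conj_of_tsum_enorm_le (hframe.hasSum_stft_gauss hg u _ _)
      (hframe.hasSum_stft_gauss hg 0 _ _) hMt (hframe.tsum_enorm_stft_gauss_le u _ _)
      (hframe.tsum_enorm_stft_gauss_le 0 _ _)
  have hw0i : Integrable w0 (volume.prod volume) := integrable_crossWeight z D p D'
  have hF : ∀ q, AEStronglyMeasurable (fun r => w0 r * T q r) (volume.prod volume) := by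
    intro q
    have hs : ∀ w, StronglyMeasurable (stft gaussConf (tfShift w g)) := fun w =>
      stronglyMeasurable_stft' (memLp_tfShift hg w).1 continuous_gaussConf.aestronglyMeasurable
    have hc : ∀ {k : Phase d × Phase d → ℂ}, StronglyMeasurable k →
        StronglyMeasurable fun r => conj (k r) :=
      fun hk => Complex.continuous_conj.comp_stronglyMeasurable hk
    have h1 : Measurable fun r : Phase d × Phase d => p + r.2 + (1 / 2 : ℝ) • D' := by fun_prop
    have h2 : Measurable fun r : Phase d × Phase d => z + r.1 + (1 / 2 : ℝ) • D := by fun_prop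
    have h3 : Measurable fun r : Phase d × Phase d => p + r.2 - (1 / 2 : ℝ) • D' := by fun_prop
    have h4 : Measurable fun r : Phase d × Phase d => z + r.1 - (1 / 2 : ℝ) • D := by fun_prop
    exact hw0i.1.mul ((((hs _).comp_measurable h1).mul (hc ((hs _).comp_measurable h2))).mul
      (hc (((hs _).comp_measurable h3).mul (hc ((hs _).comp_measurable h4))))).aestronglyMeasurable
  clear_value w0 S
  have hG : ∀ r, ∑' q, ‖w0 r * T q r‖ₑ ≤ ‖w0 r‖ₑ * (M * M) := by
    intro r
    simp_rw [enorm_mul (w0 r), ENNReal.tsum_mul_left]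
    gcongr
    exact (hTr r).1
  have hGi : ∫⁻ r, ‖w0 r‖ₑ * (M * M) ∂(volume.prod volume) ≠ ∞ := by
    rw [lintegral_mul_const'' _ hw0i.1.enorm]
    exact (ENNReal.mul_lt_top hw0i.2 (ENNReal.mul_lt_top hMt.lt_top hMt.lt_top)).ne
  have main := hasSum_integral_of_tsum_enorm_le hF (fun r => (hTr r).2.mul_left (w0 r)) hG hGi
  have hint : Integrable (fun r => w0 r * S r) (volume.prod volume) := by
    refine ⟨?_, lt_of_le_of_lt (lintegral_mono fun r => ?_) hGi.lt_top⟩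
    · rw [hw0, hS]
      exact ((continuous_crossWeight z D p D').mul
        (continuous_crossGauss z D p D')).aestronglyMeasurable
    · change ‖w0 r * S r‖ₑ ≤ _
      rw [← ((hTr r).2.mul_left (w0 r)).tsum_eq]
      exact (enorm_tsum_le_tsum_enorm).trans (hG r)
  rw [hw0, hS] at hint
  rw [← integral_crossWeight_mul_crossGauss z D p D' hint, ← hw0, ← hS]
  refine main.congr_fun fun q => ?_
  have hE : ∀ (x E : Phase d),
      funSTFT (wigner (tfShift ((q.1 : Phase d) + u) g) (tfShift (q.2 : Phase d) g)) x (symplJ E) =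
      (wignerConst d : ℂ) * ∫ v, (mixWeight v : ℂ) * (expI ⟪(x + v).2, E.1⟫ *
        stft gaussConf (tfShift ((q.1 : Phase d) + u) g) (x + v + (1 / 2 : ℝ) • E) *
        conj (stft gaussConf (tfShift ((q.2 : Phase d) + 0) g) (x + v - (1 / 2 : ℝ) • E))) := by
    intro x E
    rw [funSTFT_wigner (memLp_tfShift hg _) (memLp_tfShift hg _), add_zero]
  rw [hE, hE, map_mul, ← integral_conj, mul_mul_mul_comm, mul_comm (∫ v, _),
    ← integral_prod_mul (L := ℂ), ← integral_const_mul]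
  congr 1; ext r
  simp only [hw0, crossWeight, T, map_mul, Complex.conj_conj, Complex.conj_ofReal]
  ring

end

noncomputable section

open scoped NNReal Pointwise ContDiff BoundedContinuousFunction

/-! ### Integrals of Schwartz functions depending on a parameter -/

section Interchange

variable {E : Type*} [NormedAddCommGroup E] [NormedSpace ℝ E]

theorem ContinuousMultilinearMap.norm_le_of_unit_ball {n : ℕ}
    (m : ContinuousMultilinearMap ℝ (fun _ : Fin n => E) ℂ) {M : ℝ} (hM : 0 ≤ M)
    (h : ∀ v : Fin n → E, (∀ i, ‖v i‖ ≤ 1) → ‖m v‖ ≤ M) : ‖m‖ ≤ M := by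
  refine m.opNorm_le_bound hM fun v => ?_
  by_cases hv : ∃ i, v i = 0
  · obtain ⟨i, hi⟩ := hv
    rw [m.map_coord_zero i hi, norm_zero]
    positivity
  · push Not at hv
    have h1 := h (fun i => ‖v i‖⁻¹ • v i) fun i => by
      rw [norm_smul, norm_inv, norm_norm, inv_mul_cancel₀ (norm_ne_zero_iff.2 (hv i))]
    rw [m.map_smul_univ, norm_smul, Finset.prod_inv_distrib, norm_inv,
      Real.norm_of_nonneg (by positivity)] at h1
    rwa [inv_mul_le_iff₀ (Finset.prod_pos fun i _ => norm_pos_iff.2 (hv i)), mul_comm] at h1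

/-- A point together with `n` directions in the unit ball. -/
abbrev PointedDirections (E : Type*) [NormedAddCommGroup E] (n : ℕ) :=
  E × (Fin n → Metric.closedBall (0 : E) 1)

theorem SchwartzMap.norm_weighted_iteratedFDeriv_le (k n : ℕ) (f : 𝓢(E, ℂ))
    (q : PointedDirections E n) :
    ‖((‖q.1‖ : ℂ) ^ k * iteratedFDeriv ℝ n f q.1 fun i => (q.2 i : E))‖ ≤
      SchwartzMap.seminorm ℝ k n f := by
  rw [norm_mul, norm_pow, Complex.norm_real, norm_norm]
  refine le_trans ?_ (f.le_seminorm ℝ k n q.1)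
  gcongr
  refine (ContinuousMultilinearMap.le_opNorm _ _).trans (mul_le_of_le_one_right (norm_nonneg _) ?_)
  exact Finset.prod_le_one (fun i _ => norm_nonneg _) fun i _ => by
    exact mem_closedBall_zero_iff.1 (q.2 i).2

/-- The weighted derivative `‖u‖ ^ k D^n f(u)(v)` as a bounded continuous function of `u` and of
directions `v` in the unit ball. -/
def SchwartzMap.weightedDeriv (k n : ℕ) (f : 𝓢(E, ℂ)) : PointedDirections E n →ᵇ ℂ :=
  BoundedContinuousFunction.ofNormedAddCommGroup
    (fun q => (‖q.1‖ : ℂ) ^ k * iteratedFDeriv ℝ n f q.1 fun i => (q.2 i : E))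
    (by
      have h1 : Continuous (iteratedFDeriv ℝ n f) :=
        (f.smooth ⊤).continuous_iteratedFDeriv (by exact_mod_cast le_top)
      have h2 : Continuous fun q : PointedDirections E n => iteratedFDeriv ℝ n f q.1 :=
        h1.comp continuous_fst
      have h3 : Continuous fun q : PointedDirections E n => (fun i => (q.2 i : E)) := by fun_prop
      have h4 : Continuous fun q : PointedDirections E n => (‖q.1‖ : ℂ) ^ k :=
        (Complex.continuous_ofReal.comp continuous_fst.norm).pow k
      exact h4.mul (h2.eval h3))
    (SchwartzMap.seminorm ℝ k n f) (SchwartzMap.norm_weighted_iteratedFDeriv_le k n f)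

theorem SchwartzMap.weightedDeriv_apply (k n : ℕ) (f : 𝓢(E, ℂ)) (q : PointedDirections E n) :
    SchwartzMap.weightedDeriv k n f q =
      (‖q.1‖ : ℂ) ^ k * iteratedFDeriv ℝ n f q.1 fun i => (q.2 i : E) := rfl

theorem SchwartzMap.weightedDeriv_add (k n : ℕ) (f g : 𝓢(E, ℂ)) :
    SchwartzMap.weightedDeriv k n (f + g) =
      SchwartzMap.weightedDeriv k n f + SchwartzMap.weightedDeriv k n g := by
  ext1 q
  rw [BoundedContinuousFunction.add_apply]
  simp only [SchwartzMap.weightedDeriv_apply]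
  have : iteratedFDeriv ℝ n (f + g : 𝓢(E, ℂ)) q.1 = iteratedFDeriv ℝ n f q.1 + iteratedFDeriv ℝ n g q.1 :=
    iteratedFDeriv_add_apply ((f.smooth ⊤).of_le (by exact_mod_cast le_top)).contDiffAt
      ((g.smooth ⊤).of_le (by exact_mod_cast le_top)).contDiffAt
  rw [this, add_apply, mul_add]

theorem SchwartzMap.weightedDeriv_smul (k n : ℕ) (c : ℝ) (f : 𝓢(E, ℂ)) :
    SchwartzMap.weightedDeriv k n (c • f) = c • SchwartzMap.weightedDeriv k n f := by
  ext1 q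
  rw [BoundedContinuousFunction.smul_apply]
  simp only [SchwartzMap.weightedDeriv_apply]
  have : iteratedFDeriv ℝ n (c • f : 𝓢(E, ℂ)) q.1 = c • iteratedFDeriv ℝ n f q.1 :=
    iteratedFDeriv_const_smul_apply ((f.smooth ⊤).of_le (by exact_mod_cast le_top)).contDiffAt
  rw [this, smul_apply, mul_smul_comm]

/-- Each Schwartz seminorm is the pullback of a Banach space norm. Bochner integration thus becomes
available although the Schwartz space is not normed. -/
theorem SchwartzMap.norm_weightedDeriv (k n : ℕ) (f : 𝓢(E, ℂ)) :
    ‖SchwartzMap.weightedDeriv k n f‖ = SchwartzMap.seminorm ℝ k n f := by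
  apply le_antisymm
  · exact (BoundedContinuousFunction.norm_le (apply_nonneg _ _)).2
      (SchwartzMap.norm_weighted_iteratedFDeriv_le k n f)
  · refine f.seminorm_le_bound ℝ k n (norm_nonneg (SchwartzMap.weightedDeriv k n f)) fun u => ?_
    rcases eq_or_ne (‖u‖ ^ k) 0 with h0 | h0
    · rw [h0, zero_mul]; exact norm_nonneg _
    have hpos : 0 < ‖u‖ ^ k := lt_of_le_of_ne (by positivity) h0.symm
    rw [← le_div_iff₀' hpos]
    refine ContinuousMultilinearMap.norm_le_of_unit_ball _ (by positivity) fun v hv => ?_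
    have := (SchwartzMap.weightedDeriv k n f).norm_coe_le_norm (u, fun i => ⟨v i, by simpa using hv i⟩)
    rw [SchwartzMap.weightedDeriv_apply, norm_mul, norm_pow, Complex.norm_real, norm_norm] at this
    rwa [le_div_iff₀' hpos]

theorem SchwartzMap.continuous_weightedDeriv (k n : ℕ) :
    Continuous (SchwartzMap.weightedDeriv (E := E) k n) := by
  have h := (schwartz_withSeminorms ℝ E ℂ).continuous_seminorm (k, n)
  rw [continuous_iff_continuousAt]
  intro f
  rw [ContinuousAt, tendsto_iff_norm_sub_tendsto_zero]
  have h2 : Continuous fun g : 𝓢(E, ℂ) => SchwartzMap.seminorm ℝ k n (g - f) :=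
    h.comp (continuous_id.sub continuous_const)
  have h3 := h2.tendsto f
  rw [sub_self, map_zero] at h3
  refine h3.congr fun g => ?_
  have := SchwartzMap.weightedDeriv_add k n (g - f) f
  rw [sub_add_cancel] at this
  rw [this, add_sub_cancel_right, SchwartzMap.norm_weightedDeriv]

variable {X : Type*} [TopologicalSpace X] [MeasurableSpace X]
  [BorelSpace X] {μ : Measure X}

theorem SchwartzMap.integrable_weightedDeriv [SecondCountableTopology X] {θ : X → 𝓢(E, ℂ)} (hθ : Continuous θ)
    (hint : ∀ k n, Integrable (fun x => SchwartzMap.seminorm ℝ k n (θ x)) μ) (k n : ℕ) :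
    Integrable (fun x => SchwartzMap.weightedDeriv k n (θ x)) μ := by
  refine (hint k n).mono' ((SchwartzMap.continuous_weightedDeriv k n).comp
    hθ).aestronglyMeasurable (ae_of_all _ fun x => ?_)
  rw [SchwartzMap.norm_weightedDeriv]

theorem SchwartzMap.norm_iteratedFDeriv_apply_le (n : ℕ) (f : 𝓢(E, ℂ)) (u : E) (v : Fin n → E) :
    ‖iteratedFDeriv ℝ n f u v‖ ≤ SchwartzMap.seminorm ℝ 0 n f * ∏ i, ‖v i‖ :=
  (ContinuousMultilinearMap.le_opNorm _ _).trans
    (by gcongr; exact f.norm_iteratedFDeriv_le_seminorm ℝ n u)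

theorem SchwartzMap.integrable_iteratedFDeriv_param {θ : X → 𝓢(E, ℂ)} (hθ : Continuous θ)
    (hint : ∀ k n, Integrable (fun x => SchwartzMap.seminorm ℝ k n (θ x)) μ) (n : ℕ) (u : E)
    (v : Fin n → E) : Integrable (fun x => iteratedFDeriv ℝ n (θ x) u v) μ := by
  refine ((hint 0 n).mul_const (∏ i, ‖v i‖)).mono' (Continuous.aestronglyMeasurable ?_)
    (ae_of_all _ fun x => SchwartzMap.norm_iteratedFDeriv_apply_le n (θ x) u v)
  rw [continuous_iff_continuousAt]
  intro x
  rw [ContinuousAt, tendsto_iff_norm_sub_tendsto_zero]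
  have h2 : Continuous fun y => SchwartzMap.seminorm ℝ 0 n (θ y - θ x) * ∏ i, ‖v i‖ :=
    (((schwartz_withSeminorms ℝ E ℂ).continuous_seminorm (0, n)).comp
      (hθ.sub continuous_const)).mul continuous_const
  have h3 := h2.tendsto x
  rw [sub_self, map_zero, zero_mul] at h3
  refine squeeze_zero (fun _ => norm_nonneg _) (fun y => ?_) h3
  have h4 : iteratedFDeriv ℝ n (θ y) u v - iteratedFDeriv ℝ n (θ x) u v =
      iteratedFDeriv ℝ n (θ y - θ x : 𝓢(E, ℂ)) u v := by
    have : iteratedFDeriv ℝ n (θ y - θ x : 𝓢(E, ℂ)) u =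
        iteratedFDeriv ℝ n (θ y) u - iteratedFDeriv ℝ n (θ x) u :=
      iteratedFDeriv_sub_apply (((θ y).smooth ⊤).of_le (by exact_mod_cast le_top)).contDiffAt
        (((θ x).smooth ⊤).of_le (by exact_mod_cast le_top)).contDiffAt
    rw [this, sub_apply]
  rw [h4]
  exact SchwartzMap.norm_iteratedFDeriv_apply_le n _ u v

theorem SchwartzMap.hasDerivAt_iteratedFDeriv_apply (f : 𝓢(E, ℂ)) (n : ℕ) (u : E)
    (v : Fin (n + 1) → E) (t : ℝ) :
    HasDerivAt (fun t : ℝ => iteratedFDeriv ℝ n f (u + t • v 0) (Fin.tail v))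
      (iteratedFDeriv ℝ (n + 1) f (u + t • v 0) v) t := by
  have hd : DifferentiableAt ℝ (iteratedFDeriv ℝ n f) (u + t • v 0) :=
    (f.smooth ⊤).differentiable_iteratedFDeriv (by exact_mod_cast WithTop.coe_lt_top n) _
  have h1 := (ContinuousMultilinearMap.apply ℝ (fun _ : Fin n => E) ℂ (Fin.tail v)).hasFDerivAt.comp
    (u + t • v 0) hd.hasFDerivAt
  have h2 : HasDerivAt (fun t : ℝ => u + t • v 0) (v 0) t := by
    simpa using ((hasDerivAt_id t).smul_const (v 0)).const_add u
  exact h1.comp_hasDerivAt t h2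

/-- Differentiation under the integral along the line in direction `v 0`, dominated by a seminorm of
next order. -/
theorem SchwartzMap.iteratedFDeriv_eq_integral {θ : X → 𝓢(E, ℂ)} (hθ : Continuous θ)
    (hint : ∀ k n, Integrable (fun x => SchwartzMap.seminorm ℝ k n (θ x)) μ) {Θ : 𝓢(E, ℂ)}
    (hΘ : ∀ u, Θ u = ∫ x, θ x u ∂μ) (n : ℕ) (u : E) (v : Fin n → E) :
    iteratedFDeriv ℝ n Θ u v = ∫ x, iteratedFDeriv ℝ n (θ x) u v ∂μ := by
  induction n generalizing u with
  | zero => simpa using hΘ u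
  | succ n ih =>
    have key := (hasDerivAt_integral_of_dominated_loc_of_deriv_le (𝕜 := ℝ) (μ := μ)
      (F := fun t x => iteratedFDeriv ℝ n (θ x) (u + t • v 0) (Fin.tail v))
      (F' := fun t x => iteratedFDeriv ℝ (n + 1) (θ x) (u + t • v 0) v) (x₀ := 0)
      (s := Set.univ) (bound := fun x => SchwartzMap.seminorm ℝ 0 (n + 1) (θ x) * ∏ i, ‖v i‖)
      univ_mem
      (Eventually.of_forall fun t => (SchwartzMap.integrable_iteratedFDeriv_param hθ hint n _ _).1)
      (SchwartzMap.integrable_iteratedFDeriv_param hθ hint n _ _)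
      (SchwartzMap.integrable_iteratedFDeriv_param hθ hint (n + 1) _ _).1
      (ae_of_all _ fun x t _ => SchwartzMap.norm_iteratedFDeriv_apply_le (n + 1) (θ x) _ v)
      ((hint 0 (n + 1)).mul_const _)
      (ae_of_all _ fun x t _ => SchwartzMap.hasDerivAt_iteratedFDeriv_apply (θ x) n u v t)).2
    have h2 := SchwartzMap.hasDerivAt_iteratedFDeriv_apply Θ n u v 0
    simp_rw [← ih] at key
    simpa using h2.unique key

theorem SchwartzMap.weightedDeriv_eq_integral [SecondCountableTopology X] {θ : X → 𝓢(E, ℂ)} (hθ : Continuous θ)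
    (hint : ∀ k n, Integrable (fun x => SchwartzMap.seminorm ℝ k n (θ x)) μ) {Θ : 𝓢(E, ℂ)}
    (hΘ : ∀ u, Θ u = ∫ x, θ x u ∂μ) (k n : ℕ) :
    SchwartzMap.weightedDeriv k n Θ = ∫ x, SchwartzMap.weightedDeriv k n (θ x) ∂μ := by
  ext1 q
  have := (BoundedContinuousFunction.evalCLM ℝ q).integral_comp_comm
    (SchwartzMap.integrable_weightedDeriv hθ hint k n)
  refine Eq.trans ?_ this
  simp only [BoundedContinuousFunction.evalCLM_apply, SchwartzMap.weightedDeriv_apply]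
  rw [integral_const_mul, SchwartzMap.iteratedFDeriv_eq_integral hθ hint hΘ]

theorem SchwartzMap.exists_seminorm_bound (σ : 𝓢'(E, ℂ)) :
    ∃ (s : Finset (ℕ × ℕ)) (C : ℝ), 0 ≤ C ∧
      ∀ f, ‖σ f‖ ≤ C * ∑ i ∈ s, SchwartzMap.seminorm ℝ i.1 i.2 f := by
  let q : Seminorm ℂ 𝓢(E, ℂ) := (normSeminorm ℂ ℂ).comp (σ : 𝓢(E, ℂ) →ₗ[ℂ] ℂ)
  have hq : Continuous q := continuous_norm.comp (map_continuous σ)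
  obtain ⟨s, C, -, hC⟩ := Seminorm.bound_of_continuous (schwartz_withSeminorms ℂ E ℂ) q hq
  refine ⟨s, C, C.2, fun f => (hC f).trans ?_⟩
  have h1 : (C • s.sup (schwartzSeminormFamily ℂ E ℂ)) f =
      (C : ℝ) * (s.sup (schwartzSeminormFamily ℂ E ℂ)) f := rfl
  rw [h1]
  gcongr
  refine Seminorm.finset_sup_apply_le (Finset.sum_nonneg fun i _ => apply_nonneg _ _) fun i hi => ?_
  exact Finset.single_le_sum (f := fun i : ℕ × ℕ => SchwartzMap.seminorm ℝ i.1 i.2 f)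
    (fun i _ => apply_nonneg _ _) hi

/-- Finite families of bounded continuous functions of points and directions. -/
abbrev JetSpace (E : Type*) [NormedAddCommGroup E] (s : Finset (ℕ × ℕ)) :=
  (i : s) → (PointedDirections E i.1.2 →ᵇ ℂ)

/-- The finite family of weighted derivatives together with the value of a tempered distribution,
as a map into a Banach space. -/
def SchwartzMap.jetAndValue (σ : 𝓢'(E, ℂ)) (s : Finset (ℕ × ℕ)) :
    𝓢(E, ℂ) →ₗ[ℝ] JetSpace E s × ℂ where
  toFun f := (fun i => SchwartzMap.weightedDeriv i.1.1 i.1.2 f, σ f)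
  map_add' f g := by
    refine Prod.ext (funext fun i => SchwartzMap.weightedDeriv_add _ _ f g) (map_add σ f g)
  map_smul' c f := by
    refine Prod.ext (funext fun i => SchwartzMap.weightedDeriv_smul _ _ c f) ?_
    have : c • f = (c : ℂ) • f := by ext u; simp
    change σ (c • f) = c • σ f
    rw [this, map_smul]; simp

/-- Continuity of σ means a bound by finitely many seminorms, so on Schwartz functions the value of
σ is controlled by a finite jet. The pair (jet, value) takes values in a Banach space and is Bochner
integrable. Its integral has the same jet as Θ, and the control forces the same value. -/
theorem SchwartzMap.tempered_eq_integral [SecondCountableTopology X] (σ : 𝓢'(E, ℂ)) {θ : X → 𝓢(E, ℂ)} (hθ : Continuous θ)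
    (hint : ∀ k n, Integrable (fun x => SchwartzMap.seminorm ℝ k n (θ x)) μ) {Θ : 𝓢(E, ℂ)}
    (hΘ : ∀ u, Θ u = ∫ x, θ x u ∂μ) :
    Integrable (fun x => σ (θ x)) μ ∧ σ Θ = ∫ x, σ (θ x) ∂μ := by
  obtain ⟨s, C, hC0, hC⟩ := SchwartzMap.exists_seminorm_bound σ
  have hσi : Integrable (fun x => σ (θ x)) μ := by
    refine ((integrable_finsetSum s fun i _ => hint i.1 i.2).const_mul C).mono'
      ((map_continuous σ).comp hθ).aestronglyMeasurable (ae_of_all _ fun x => hC _)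
  refine ⟨hσi, ?_⟩
  set J := SchwartzMap.jetAndValue σ s with hJdef
  have hJ1 : ∀ f i, (J f).1 i = SchwartzMap.weightedDeriv i.1.1 i.1.2 f := fun _ _ => rfl
  have hJ2 : ∀ f, (J f).2 = σ f := fun _ => rfl
  have hJc : Continuous fun x => J (θ x) :=
    (continuous_pi fun i => (SchwartzMap.continuous_weightedDeriv _ _).comp hθ).prodMk
      ((map_continuous σ).comp hθ)
  clear_value J
  -- The integral need not be the pair of a Schwartz function, but it lies in the closure of such
  -- pairs, and the seminorm bound passes to the closure.
  let R := (LinearMap.range J).topologicalClosure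
  have hR : ∀ a ∈ R, ‖a.2‖ ≤ C * ∑ i : s, ‖a.1 i‖ := by
    intro a ha
    refine closure_minimal (s := (LinearMap.range J : Set (JetSpace E s × ℂ)))
      (t := {a : JetSpace E s × ℂ | ‖a.2‖ ≤ C * ∑ i : s, ‖a.1 i‖}) ?_ ?_ ha
    · rintro _ ⟨f, rfl⟩
      simp only [Set.mem_ofPred_eq, hJ1, hJ2, SchwartzMap.norm_weightedDeriv]
      rw [Finset.sum_coe_sort s (fun i => SchwartzMap.seminorm ℝ i.1 i.2 f)]
      exact hC f
    · refine isClosed_le (by fun_prop) ?_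
      refine continuous_const.mul (continuous_finsetSum _ fun i _ => ?_)
      exact continuous_norm.comp ((continuous_apply i).comp continuous_fst)
  have hmem : ∀ x, J (θ x) ∈ R := fun x => (LinearMap.range J).le_topologicalClosure ⟨θ x, rfl⟩
  let j : X → R := fun x => ⟨J (θ x), hmem x⟩
  have : CompleteSpace R := (LinearMap.range J).isClosed_topologicalClosure.completeSpace_coe
  have := secondCountableTopologyEither_of_left X R
  have hj : Integrable j μ := by
    have hb : Integrable (fun x => (∑ i : s, ‖(J (θ x)).1 i‖) + ‖(J (θ x)).2‖) μ := by
      refine (integrable_finsetSum _ fun i _ => ?_).add (by simpa only [hJ2] using hσi.norm)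
      simp only [hJ1, SchwartzMap.norm_weightedDeriv]
      exact hint _ _
    refine hb.mono' (hJc.subtype_mk hmem).aestronglyMeasurable (ae_of_all _ fun x => ?_)
    change ‖J (θ x)‖ ≤ _
    rw [Prod.norm_def]
    refine max_le ?_ (le_add_of_nonneg_left (Finset.sum_nonneg fun i _ => norm_nonneg _))
    refine le_add_of_le_of_nonneg ?_ (norm_nonneg _)
    refine (pi_norm_le_iff_of_nonneg (Finset.sum_nonneg fun i _ => norm_nonneg _)).2 fun i => ?_
    exact Finset.single_le_sum (f := fun i : s => ‖(J (θ x)).1 i‖) (fun i _ => norm_nonneg _)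
      (Finset.mem_univ i)
  have hI1 : ∀ i, ((∫ x, j x ∂μ : R) : JetSpace E s × ℂ).1 i = (J Θ).1 i := by
    intro i
    have h := (((ContinuousLinearMap.proj (R := ℝ) (φ := fun i : s =>
      (PointedDirections E i.1.2 →ᵇ ℂ)) i).comp (ContinuousLinearMap.fst ℝ (JetSpace E s) ℂ)).comp
      R.subtypeL).integral_comp_comm hj
    rw [hJ1, SchwartzMap.weightedDeriv_eq_integral hθ hint hΘ]
    refine Eq.trans h.symm ?_
    congr 1; ext1 x
    exact hJ1 _ _
  have hI2 : ((∫ x, j x ∂μ : R) : JetSpace E s × ℂ).2 = ∫ x, σ (θ x) ∂μ := by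
    have h := ((ContinuousLinearMap.snd ℝ (JetSpace E s) ℂ).comp R.subtypeL).integral_comp_comm hj
    refine Eq.trans h.symm ?_
    congr 1; ext1 x
    exact hJ2 _
  -- The difference of the two pairs has zero jet, so its value component vanishes.
  have h5 := hR _ (R.sub_mem (∫ x, j x ∂μ : R).2
    ((LinearMap.range J).le_topologicalClosure ⟨Θ, rfl⟩))
  simp only [Prod.fst_sub, Prod.snd_sub, Pi.sub_apply, hI1, sub_self, norm_zero,
    Finset.sum_const_zero, mul_zero, hI2, hJ2] at h5
  exact (sub_eq_zero.1 (norm_le_zero_iff.1 h5)).symm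

end Interchange

end

noncomputable section

open scoped NNReal Pointwise ContDiff

variable {d : ℕ}

/-! ### The family of Gaussian atoms -/

/-- The exponent of the Gaussian atoms as a function of all variables. -/
def jointExponent (w : (Phase d × Phase d) × Phase d) : ℂ := atomExponent w.1.1 w.1.2 w.2

theorem hasTemperateGrowth_jointExponent : (jointExponent (d := d)).HasTemperateGrowth := by
  let W := (Phase d × Phase d) × Phase d
  have hcl : ∀ L : W →L[ℝ] Conf d, Function.HasTemperateGrowth (fun w => ‖L w‖ ^ 2) := fun L =>
    (Function.hasTemperateGrowth_norm_sq (Conf d)).comp L.hasTemperateGrowth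
  let X := ContinuousLinearMap.fst ℝ (Phase d × Phase d) (Phase d)
  let U := ContinuousLinearMap.snd ℝ (Phase d × Phase d) (Phase d)
  let Z := (ContinuousLinearMap.fst ℝ (Phase d) (Phase d)).comp X
  let Y := (ContinuousLinearMap.snd ℝ (Phase d) (Phase d)).comp X
  let p1 := ContinuousLinearMap.fst ℝ (Conf d) (Conf d)
  let p2 := ContinuousLinearMap.snd ℝ (Conf d) (Conf d)
  have h3 : Function.HasTemperateGrowth (fun w : W =>
      -(Real.pi / 2 * phaseDot (w.2 - w.1.1) (w.2 - w.1.1))) := by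
    have e : (fun w : W => -(Real.pi / 2 * phaseDot (w.2 - w.1.1) (w.2 - w.1.1))) =
        fun w => (-(Real.pi / 2)) * (‖(p1.comp (U - Z)) w‖ ^ 2 + ‖(p2.comp (U - Z)) w‖ ^ 2) := by
      funext w
      simp only [phaseDot, real_inner_self_eq_norm_sq]
      rw [neg_mul]; rfl
    rw [e]
    exact (Function.HasTemperateGrowth.const _).mul ((hcl _).add (hcl _))
  have hin : ∀ L M : W →L[ℝ] Conf d, Function.HasTemperateGrowth (fun w => (⟪L w, M w⟫ : ℝ)) := by
    intro L M
    have e : (fun w => (⟪L w, M w⟫ : ℝ)) =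
        fun w => (1 / 4 : ℝ) * (‖(L + M) w‖ ^ 2 - ‖(L - M) w‖ ^ 2) := by
      funext w
      simp only [add_apply, sub_apply, norm_add_sq_real, norm_sub_sq_real]
      ring
    rw [e]
    exact (Function.HasTemperateGrowth.const _).mul ((hcl _).sub (hcl _))
  have h4 : Function.HasTemperateGrowth (fun w : W => 2 * Real.pi * phaseDot w.1.2 w.2) :=
    (Function.HasTemperateGrowth.const _).mul
      ((hin (p1.comp Y) (p1.comp U)).add (hin (p2.comp Y) (p2.comp U)))
  exact (Function.Complex.hasTemperateGrowth_ofReal.comp h3).sub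
    ((Function.Complex.hasTemperateGrowth_ofReal.comp h4).mul (Function.HasTemperateGrowth.const _))

theorem norm_exp_jointExponent_le (w : (Phase d × Phase d) × Phase d) :
    ‖Complex.exp (jointExponent w)‖ ≤ Real.exp (-‖w.2 - w.1.1‖ ^ 2) := by
  rw [Complex.norm_exp]
  apply Real.exp_le_exp.mpr
  have hre : (jointExponent w).re =
      -(Real.pi / 2 * phaseDot (w.2 - w.1.1) (w.2 - w.1.1)) := by
    simp only [jointExponent, atomExponent, Complex.sub_re, Complex.ofReal_re,
      Complex.re_ofReal_mul, Complex.I_re, mul_zero, sub_zero]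
  have hp : ‖w.2 - w.1.1‖ ^ 2 ≤ phaseDot (w.2 - w.1.1) (w.2 - w.1.1) := by
    simp only [phaseDot, real_inner_self_eq_norm_sq]
    exact norm_sq_le_fst_snd _
  rw [hre]
  nlinarith [Real.two_le_pi, sq_nonneg ‖w.2 - w.1.1‖]

theorem one_add_pow_mul_exp_neg_sq_le (N : ℕ) {s : ℝ} (hs : 0 ≤ s) :
    (1 + s) ^ N * Real.exp (-s ^ 2) ≤ N.factorial * Real.exp 2 := by
  have hpow : (1 + s) ^ N ≤ N.factorial * Real.exp (1 + s) := by
    have h := Real.pow_div_factorial_le_exp (1 + s) (by linarith) N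
    rw [div_le_iff₀ (by positivity)] at h
    linarith
  have hexp : Real.exp (1 + s) * Real.exp (-s ^ 2) ≤ Real.exp 2 := by
    rw [← Real.exp_add]
    exact Real.exp_le_exp.mpr (by nlinarith [sq_nonneg (s - 1 / 2)])
  calc (1 + s) ^ N * Real.exp (-s ^ 2)
      ≤ N.factorial * Real.exp (1 + s) * Real.exp (-s ^ 2) := by gcongr
    _ = N.factorial * (Real.exp (1 + s) * Real.exp (-s ^ 2)) := by ring
    _ ≤ _ := by gcongr

/-- Derivatives of the exponential of a function of temperate growth are polynomial times the
exponential. Its Gaussian factor in u - z absorbs every power of u - z, leaving polynomial growth in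
the parameters (z, ζ) only. Differentiating jointly in parameters and u also serves the continuity
of the family. -/
theorem exists_jointExp_bound (k n : ℕ) :
    ∃ (C : ℝ) (M : ℕ), 0 ≤ C ∧ ∀ w : (Phase d × Phase d) × Phase d,
      ‖w.2‖ ^ k * ‖iteratedFDeriv ℝ n (fun w => Complex.exp (jointExponent w)) w‖ ≤
        C * (1 + ‖w.1‖) ^ M := by
  have hf := hasTemperateGrowth_jointExponent (d := d)
  obtain ⟨m, K, hK0, hK⟩ := hf.norm_iteratedFDeriv_le_uniform n
  refine ⟨n.factorial * (K + 1) ^ n * ((k + m * n).factorial * Real.exp 2), 2 * (k + m * n),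
    by positivity, fun w => ?_⟩
  have hD : ∀ i, 1 ≤ i → i ≤ n →
      ‖iteratedFDeriv ℝ i jointExponent w‖ ≤ ((K + 1) * (1 + ‖w‖) ^ m) ^ i := by
    intro i hi hin
    have hone : (1 : ℝ) ≤ (1 + ‖w‖) ^ m := one_le_pow₀ (by linarith [norm_nonneg w])
    have h1 : (1 : ℝ) ≤ (K + 1) * (1 + ‖w‖) ^ m := by nlinarith
    calc ‖iteratedFDeriv ℝ i jointExponent w‖ ≤ K * (1 + ‖w‖) ^ m := hK i hin w
      _ ≤ (K + 1) * (1 + ‖w‖) ^ m := by nlinarith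
      _ ≤ _ := le_self_pow₀ h1 (by omega)
  have h1 := norm_iteratedFDeriv_comp_le (𝕜 := ℝ) (N := n) Complex.contDiff_exp
    (hf.1.of_le (by exact_mod_cast le_top)) le_rfl w
    (fun i _ => norm_iteratedFDeriv_cexp_le i (jointExponent w)) hD
  have hnorm := norm_exp_jointExponent_le w
  set s := ‖w.2 - w.1.1‖ with hs
  set r := ‖w.1‖ with hr
  have hs0 : 0 ≤ s := norm_nonneg _
  have hr0 : 0 ≤ r := norm_nonneg _
  have hu : ‖w.2‖ ≤ s + r := by
    have h : ‖w.2‖ ≤ s + ‖w.1.1‖ := by simpa using norm_add_le (w.2 - w.1.1) w.1.1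
    linarith [norm_fst_le w.1]
  -- The product form sends the powers of 1 + s to the Gaussian and keeps those of 1 + r; with k +
  -- mn factors this gives the exponent 2(k + mn).
  have hw : 1 + ‖w‖ ≤ (1 + r) ^ 2 * (1 + s) := by
    have : ‖w‖ ≤ s + r := by
      rw [Prod.norm_def]; exact max_le (by linarith) hu
    nlinarith [mul_nonneg hr0 hs0, mul_nonneg (sq_nonneg r) hs0]
  have hu' : ‖w.2‖ ≤ (1 + r) ^ 2 * (1 + s) := by
    nlinarith [mul_nonneg hr0 hs0, mul_nonneg (sq_nonneg r) hs0]
  calc ‖w.2‖ ^ k * ‖iteratedFDeriv ℝ n (fun w => Complex.exp (jointExponent w)) w‖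
      ≤ ((1 + r) ^ 2 * (1 + s)) ^ k *
        (n.factorial * Real.exp (-s ^ 2) * ((K + 1) * ((1 + r) ^ 2 * (1 + s)) ^ m) ^ n) := by
        gcongr
        exact h1.trans (by gcongr)
    _ = n.factorial * (K + 1) ^ n * ((1 + s) ^ (k + m * n) * Real.exp (-s ^ 2)) *
          (1 + r) ^ (2 * (k + m * n)) := by
        rw [mul_pow (K + 1), ← pow_mul, pow_mul (1 + r), pow_add (1 + s), pow_add ((1 + r) ^ 2), mul_pow,
          mul_pow]; ring
    _ ≤ _ := by
        have := one_add_pow_mul_exp_neg_sq_le (k + m * n) hs0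
        exact mul_le_mul_of_nonneg_right (mul_le_mul_of_nonneg_left this (by positivity))
          (by positivity)

theorem contDiff_jointExp : ContDiff ℝ ∞ fun w : (Phase d × Phase d) × Phase d =>
    Complex.exp (jointExponent w) := hasTemperateGrowth_jointExponent.1.cexp

theorem iteratedFDeriv_gaussAtomConj (n : ℕ) (x : Phase d × Phase d) (u : Phase d) :
    iteratedFDeriv ℝ n (gaussAtomConj x.1 x.2) u =
      (iteratedFDeriv ℝ n (fun w => Complex.exp (jointExponent w)) (x, u)).compContinuousLinearMap
        fun _ => ContinuousLinearMap.inr ℝ (Phase d × Phase d) (Phase d) := by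
  have h1 : (gaussAtomConj x.1 x.2 : Phase d → ℂ) =
      (fun w => (fun w => Complex.exp (jointExponent w)) ((x, 0) + w)) ∘
        ContinuousLinearMap.inr ℝ (Phase d × Phase d) (Phase d) := by
    ext u
    change Complex.exp (atomExponent x.1 x.2 u) = _
    simp [jointExponent]
  have hc : ContDiff ℝ ∞ fun w => (fun w => Complex.exp (jointExponent (d := d) w)) ((x, 0) + w) :=
    contDiff_jointExp.comp (contDiff_const.add contDiff_id)
  have h2 := iteratedFDeriv_comp_add_left (𝕜 := ℝ)
    (f := fun w : (Phase d × Phase d) × Phase d => Complex.exp (jointExponent w)) n (x, 0) (0, u)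
  rw [Prod.mk_add_mk, add_zero, zero_add] at h2
  rw [h1, ContinuousLinearMap.iteratedFDeriv_comp_right _ hc _ (by exact_mod_cast le_top), ← h2]
  rfl

theorem norm_compContinuousLinearMap_inr_le {n : ℕ}
    (m : ContinuousMultilinearMap ℝ (fun _ : Fin n => (Phase d × Phase d) × Phase d) ℂ) :
    ‖m.compContinuousLinearMap fun _ => ContinuousLinearMap.inr ℝ (Phase d × Phase d) (Phase d)‖ ≤
      ‖m‖ := by
  refine (ContinuousMultilinearMap.norm_compContinuousLinearMap_le _ _).trans
    (mul_le_of_le_one_right (norm_nonneg _) ?_)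
  exact Finset.prod_le_one (fun _ _ => norm_nonneg _) fun _ _ =>
    ContinuousLinearMap.norm_inr_le_one ℝ _ _

theorem exists_seminorm_gaussAtomConj_le (k n : ℕ) :
    ∃ (C : ℝ) (M : ℕ), 0 ≤ C ∧ ∀ x : Phase d × Phase d,
      SchwartzMap.seminorm ℝ k n (gaussAtomConj x.1 x.2) ≤ C * (1 + ‖x‖) ^ M := by
  obtain ⟨C, M, hC, h⟩ := exists_jointExp_bound (d := d) k n
  refine ⟨C, M, hC, fun x => SchwartzMap.seminorm_le_bound ℝ k n _ (by positivity) fun u => ?_⟩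
  rw [iteratedFDeriv_gaussAtomConj]
  exact (mul_le_mul_of_nonneg_left (norm_compContinuousLinearMap_inr_le _) (by positivity)).trans
    (h (x, u))

/-- Mean value inequality in the parameter, at the cost of one more joint derivative. -/
theorem exists_seminorm_gaussAtomConj_sub_le (k n : ℕ) :
    ∃ (C : ℝ) (M : ℕ), 0 ≤ C ∧ ∀ x y : Phase d × Phase d,
      SchwartzMap.seminorm ℝ k n (gaussAtomConj y.1 y.2 - gaussAtomConj x.1 x.2) ≤
        C * (1 + (‖x‖ + ‖y - x‖)) ^ M * ‖y - x‖ := by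
  obtain ⟨C, M, hC, h⟩ := exists_jointExp_bound (d := d) k (n + 1)
  refine ⟨C, M, hC, fun x y => SchwartzMap.seminorm_le_bound ℝ k n _ (by positivity) fun u => ?_⟩
  have hsub : iteratedFDeriv ℝ n (gaussAtomConj y.1 y.2 - gaussAtomConj x.1 x.2 : 𝓢(Phase d, ℂ)) u =
      iteratedFDeriv ℝ n (gaussAtomConj y.1 y.2) u - iteratedFDeriv ℝ n (gaussAtomConj x.1 x.2) u :=
    iteratedFDeriv_sub_apply
      (((gaussAtomConj y.1 y.2).smooth ⊤).of_le (by exact_mod_cast le_top)).contDiffAt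
      (((gaussAtomConj x.1 x.2).smooth ⊤).of_le (by exact_mod_cast le_top)).contDiffAt
  set G := fun w : (Phase d × Phase d) × Phase d => Complex.exp (jointExponent w) with hG
  have hcomp : ∀ m m' : ContinuousMultilinearMap ℝ (fun _ : Fin n => (Phase d × Phase d) × Phase d) ℂ,
      m.compContinuousLinearMap (fun _ => ContinuousLinearMap.inr ℝ (Phase d × Phase d) (Phase d)) -
      m'.compContinuousLinearMap (fun _ => ContinuousLinearMap.inr ℝ (Phase d × Phase d) (Phase d)) =
      (m - m').compContinuousLinearMap
        (fun _ => ContinuousLinearMap.inr ℝ (Phase d × Phase d) (Phase d)) := by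
    intro m m'; ext v; rfl
  rw [hsub, iteratedFDeriv_gaussAtomConj, iteratedFDeriv_gaussAtomConj, hcomp]
  refine (mul_le_mul_of_nonneg_left (norm_compContinuousLinearMap_inr_le _) (by positivity)).trans ?_
  have hmv : ‖‖u‖ ^ k • iteratedFDeriv ℝ n G (y, u) - ‖u‖ ^ k • iteratedFDeriv ℝ n G (x, u)‖ ≤
      C * (1 + (‖x‖ + ‖y - x‖)) ^ M * ‖y - x‖ := by
    have hd : ∀ x' : Phase d × Phase d, HasFDerivAt (fun x' => ‖u‖ ^ k • iteratedFDeriv ℝ n G (x', u))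
        (‖u‖ ^ k • (fderiv ℝ (iteratedFDeriv ℝ n G) (x', u)).comp
          (ContinuousLinearMap.inl ℝ (Phase d × Phase d) (Phase d))) x' := by
      intro x'
      have h1 : DifferentiableAt ℝ (iteratedFDeriv ℝ n G) (x', u) :=
        contDiff_jointExp.differentiable_iteratedFDeriv (by exact_mod_cast WithTop.coe_lt_top n) _
      have h2 : HasFDerivAt (fun x' => iteratedFDeriv ℝ n G (x', u))
          ((fderiv ℝ (iteratedFDeriv ℝ n G) (x', u)).comp
            (ContinuousLinearMap.inl ℝ (Phase d × Phase d) (Phase d))) x' :=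
        HasFDerivAt.comp (f := fun e => (e, u)) x' h1.hasFDerivAt (hasFDerivAt_prodMk_left x' u)
      exact h2.const_smul (‖u‖ ^ k)
    refine Convex.norm_image_sub_le_of_norm_hasFDerivWithin_le
      (s := Metric.closedBall x ‖y - x‖) (fun x' _ => (hd x').hasFDerivWithinAt) (fun x' hx' => ?_)
      (convex_closedBall _ _) (Metric.mem_closedBall_self (norm_nonneg _))
      (by rw [mem_closedBall_iff_norm])
    rw [norm_smul, norm_pow, norm_norm]
    have h2 : ‖x'‖ ≤ ‖x‖ + ‖y - x‖ := by
      rw [mem_closedBall_iff_norm] at hx'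
      calc ‖x'‖ = ‖x + (x' - x)‖ := by rw [add_sub_cancel]
        _ ≤ _ := (norm_add_le _ _).trans (by gcongr)
    calc _ ≤ ‖u‖ ^ k * ‖fderiv ℝ (iteratedFDeriv ℝ n G) (x', u)‖ := by
          gcongr
          exact (ContinuousLinearMap.opNorm_comp_le _ _).trans
            (mul_le_of_le_one_right (norm_nonneg _) (ContinuousLinearMap.norm_inl_le_one ℝ _ _))
      _ = ‖u‖ ^ k * ‖iteratedFDeriv ℝ (n + 1) G (x', u)‖ := by rw [norm_fderiv_iteratedFDeriv]
      _ ≤ C * (1 + ‖x'‖) ^ M := h (x', u)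
      _ ≤ _ := by gcongr
  rwa [← smul_sub, norm_smul, norm_pow, norm_norm] at hmv

theorem continuous_gaussAtomConj :
    Continuous fun x : Phase d × Phase d => (gaussAtomConj x.1 x.2 : 𝓢(Phase d, ℂ)) := by
  rw [continuous_iff_continuousAt]
  intro x
  refine ((schwartz_withSeminorms ℝ (Phase d) ℂ).tendsto_nhds _ _).2 fun i ε hε => ?_
  obtain ⟨C, M, hC, h⟩ := exists_seminorm_gaussAtomConj_sub_le (d := d) i.1 i.2
  have hc : Continuous fun y : Phase d × Phase d => C * (1 + (‖x‖ + ‖y - x‖)) ^ M * ‖y - x‖ := by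
    fun_prop
  have h0 := hc.tendsto x
  simp only [sub_self, norm_zero, mul_zero] at h0
  filter_upwards [h0.eventually (gt_mem_nhds hε)] with y hy
  exact (h x y).trans_lt hy

theorem continuous_symbolSTFT (σ : 𝓢'(Phase d, ℂ)) :
    Continuous fun x : Phase d × Phase d => symbolSTFT σ x.1 x.2 :=
  (map_continuous σ).comp continuous_gaussAtomConj

theorem exists_norm_symbolSTFT_le (σ : 𝓢'(Phase d, ℂ)) :
    ∃ (C : ℝ) (M : ℕ), 0 ≤ C ∧ ∀ x : Phase d × Phase d,
      ‖symbolSTFT σ x.1 x.2‖ ≤ C * (1 + ‖x‖) ^ M := by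
  obtain ⟨s, C, hC0, hC⟩ := SchwartzMap.exists_seminorm_bound σ
  choose! A B hA hAB using fun i : ℕ × ℕ => exists_seminorm_gaussAtomConj_le (d := d) i.1 i.2
  refine ⟨C * ∑ i ∈ s, A i, s.sup B, mul_nonneg hC0 (Finset.sum_nonneg fun i _ => hA i),
    fun x => (hC _).trans ?_⟩
  rw [mul_assoc, Finset.sum_mul]
  gcongr with i hi
  refine (hAB i x).trans ?_
  have := hA i
  gcongr
  · linarith [norm_nonneg x]
  · exact Finset.le_sup hi

end

noncomputable section

open scoped NNReal Pointwise ContDiff FourierTransform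

/-! ### The Gabor transform of a Schwartz function with a Gaussian window -/

section Gabor

variable {V : Type*} [NormedAddCommGroup V] [InnerProductSpace ℝ V] [FiniteDimensional ℝ V]
  [MeasurableSpace V] [BorelSpace V]

theorem expI_eq (r : ℝ) : expI r = Complex.exp (((2 * Real.pi * r : ℝ) : ℂ) * Complex.I) := by
  simp only [expI]; congr 1; push_cast; ring

theorem fourier_eq_integral_expI (f : V → ℂ) (w : V) : 𝓕 f w = ∫ v, expI (-⟪v, w⟫) * f v := by
  rw [Real.fourier_eq']
  congr 1; ext v
  rw [expI_eq, smul_eq_mul]; congr 3; push_cast; ring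

theorem fourierInv_eq_integral_expI (f : V → ℂ) (w : V) : 𝓕⁻ f w = ∫ v, expI ⟪v, w⟫ * f v := by
  rw [Real.fourierInv_eq']
  congr 1; ext v
  rw [expI_eq, smul_eq_mul]

theorem integrable_exp_neg_mul_norm_sq {b : ℝ} (hb : 0 < b) :
    Integrable fun v : V => Real.exp (-b * ‖v‖ ^ 2) := by
  have h := GaussianFourier.integrable_cexp_neg_mul_sq_norm_add (V := V) (b := (b : ℂ))
    (by simpa using hb) 0 0
  refine h.norm.congr (ae_of_all _ fun v => ?_)
  simp only [Complex.norm_exp]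
  congr 1
  simp [← Complex.ofReal_pow]

theorem one_add_pow_mul_exp_neg_mul_sq_le (N : ℕ) {b : ℝ} (hb : 0 < b) {s : ℝ} (hs : 0 ≤ s) :
    (1 + s) ^ N * Real.exp (-b * s ^ 2) ≤
      N.factorial * Real.exp (1 + 1 / (2 * b)) * Real.exp (-(b / 2) * s ^ 2) := by
  have hpow : (1 + s) ^ N ≤ N.factorial * Real.exp (1 + s) := by
    have h := Real.pow_div_factorial_le_exp (1 + s) (by linarith) N
    rw [div_le_iff₀ (by positivity)] at h
    linarith
  have hexp : Real.exp (1 + s) * Real.exp (-b * s ^ 2) ≤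
      Real.exp (1 + 1 / (2 * b)) * Real.exp (-(b / 2) * s ^ 2) := by
    rw [← Real.exp_add, ← Real.exp_add]
    apply Real.exp_le_exp.mpr
    have h1 : 0 ≤ b / 2 * (s - 1 / b) ^ 2 := by positivity
    have h2 : b / 2 * (s - 1 / b) ^ 2 = b / 2 * s ^ 2 - s + 1 / (2 * b) := by
      field_simp; ring
    linarith
  calc _ ≤ N.factorial * Real.exp (1 + s) * Real.exp (-b * s ^ 2) := by gcongr
    _ = N.factorial * (Real.exp (1 + s) * Real.exp (-b * s ^ 2)) := by ring
    _ ≤ N.factorial * (Real.exp (1 + 1 / (2 * b)) * Real.exp (-(b / 2) * s ^ 2)) := by gcongr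
    _ = _ := by ring

theorem one_add_norm_pow_le_mul {W : Type*} [NormedAddCommGroup W] (N : ℕ) (x u : W) :
    (1 + ‖x‖) ^ N ≤ (1 + ‖u‖) ^ N * (1 + ‖u - x‖) ^ N := by
  rw [← mul_pow]
  have h : ‖x‖ ≤ ‖u‖ + ‖u - x‖ := by
    calc ‖x‖ = ‖u - (u - x)‖ := by rw [sub_sub_cancel]
      _ ≤ _ := norm_sub_le _ _
  gcongr
  nlinarith [norm_nonneg u, norm_nonneg (u - x), mul_nonneg (norm_nonneg u) (norm_nonneg (u - x))]

omit [FiniteDimensional ℝ V] [MeasurableSpace V] [BorelSpace V] in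
theorem SchwartzMap.exists_one_add_pow_mul_norm_le (f : 𝓢(V, ℂ)) (N : ℕ) :
    ∃ C, 0 ≤ C ∧ ∀ u, (1 + ‖u‖) ^ N * ‖f u‖ ≤ C := by
  refine ⟨2 ^ N * (Finset.Iic (N, 0)).sup (fun m => SchwartzMap.seminorm ℝ m.1 m.2) f, ?_, fun u => ?_⟩
  · positivity
  · have := SchwartzMap.one_add_le_sup_seminorm_apply (𝕜 := ℝ) (m := (N, 0)) le_rfl le_rfl f u
    rwa [norm_iteratedFDeriv_zero] at this

theorem SchwartzMap.exists_gauss_average_le (f : 𝓢(V, ℂ)) (N : ℕ) {b : ℝ} (hb : 0 < b) :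
    ∃ C, 0 ≤ C ∧ ∀ x, (1 + ‖x‖) ^ N * ∫ u, ‖f u‖ * Real.exp (-b * ‖u - x‖ ^ 2) ≤ C := by
  obtain ⟨C, hC0, hC⟩ := f.exists_one_add_pow_mul_norm_le N
  have hi := integrable_exp_neg_mul_norm_sq (V := V) (half_pos hb)
  refine ⟨C * (N.factorial * Real.exp (1 + 1 / (2 * b))) * ∫ v : V, Real.exp (-(b / 2) * ‖v‖ ^ 2),
    by positivity, fun x => ?_⟩
  have hi' := (integrable_exp_neg_mul_norm_sq (V := V) hb).comp_sub_right x
  have h1 : Integrable fun u => ‖f u‖ * Real.exp (-b * ‖u - x‖ ^ 2) := by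
    refine (hi'.const_mul C).mono' (by
      have := f.continuous
      exact Continuous.aestronglyMeasurable (by fun_prop)) (ae_of_all _ fun u => ?_)
    rw [norm_mul, norm_norm, Real.norm_of_nonneg (Real.exp_pos _).le]
    gcongr
    refine le_trans ?_ (hC u)
    exact le_mul_of_one_le_left (norm_nonneg _) (one_le_pow₀ (by linarith [norm_nonneg u]))
  rw [← integral_const_mul, ← integral_sub_right_eq_self (fun v : V => Real.exp (-(b / 2) * ‖v‖ ^ 2)) x,
    ← integral_const_mul]
  refine integral_mono (h1.const_mul _) ((hi.comp_sub_right x).const_mul _) fun u => ?_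
  calc (1 + ‖x‖) ^ N * (‖f u‖ * Real.exp (-b * ‖u - x‖ ^ 2))
      ≤ ((1 + ‖u‖) ^ N * (1 + ‖u - x‖) ^ N) * (‖f u‖ * Real.exp (-b * ‖u - x‖ ^ 2)) := by
        gcongr; exact one_add_norm_pow_le_mul N x u
    _ = ((1 + ‖u‖) ^ N * ‖f u‖) * ((1 + ‖u - x‖) ^ N * Real.exp (-b * ‖u - x‖ ^ 2)) := by ring
    _ ≤ C * (N.factorial * Real.exp (1 + 1 / (2 * b)) * Real.exp (-(b / 2) * ‖u - x‖ ^ 2)) := by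
        exact mul_le_mul (hC u) (one_add_pow_mul_exp_neg_mul_sq_le N hb (norm_nonneg _))
          (by positivity) hC0
    _ = _ := by ring

/-- The transform `∫ Φ(u) e^{-a|u-x|²} e^{2πi ξ·u} du`. -/
def gaborTransform (a : ℝ) (Φ : V → ℂ) (x ξ : V) : ℂ :=
  ∫ u, Φ u * ((Real.exp (-a * ‖u - x‖ ^ 2) : ℝ) : ℂ) * expI ⟪ξ, u⟫

theorem norm_gaborTransform_le (a : ℝ) (Φ : V → ℂ) (x ξ : V) :
    ‖gaborTransform a Φ x ξ‖ ≤ ∫ u, ‖Φ u‖ * Real.exp (-a * ‖u - x‖ ^ 2) := by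
  refine (norm_integral_le_integral_norm _).trans (le_of_eq ?_)
  congr 1; ext u
  rw [norm_mul, norm_mul, norm_expI, Complex.norm_real, Real.norm_of_nonneg (Real.exp_pos _).le,
    mul_one]

/-- The multiplication formula ∫ 𝓕Φ' γ = ∫ Φ' 𝓕γ with a modulated Gaussian γ. On the Fourier side ξ
is a translation, so decay in ξ follows from decay of 𝓕Φ. -/
theorem gaborTransform_eq_fourier {a : ℝ} (ha : 0 < a) (Φ : 𝓢(V, ℂ)) (x ξ : V) :
    ∃ c : ℂ, ‖c‖ ≤ ‖((a / Real.pi : ℝ) : ℂ) ^ (Module.finrank ℝ V / 2 : ℂ)‖⁻¹ ∧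
    gaborTransform a Φ x ξ = c * ∫ v, 𝓕 (Φ : V → ℂ) (v - ξ) *
      Complex.exp (-((Real.pi ^ 2 / a : ℝ) : ℂ) * ‖v‖ ^ 2 + 2 * Real.pi * Complex.I * ⟪x, v⟫) := by
  have hpi := Real.pi_pos
  have hb : 0 < (((Real.pi ^ 2 / a : ℝ) : ℂ)).re := by rw [Complex.ofReal_re]; positivity
  set γ : V → ℂ := fun v =>
    Complex.exp (-((Real.pi ^ 2 / a : ℝ) : ℂ) * ‖v‖ ^ 2 + 2 * Real.pi * Complex.I * ⟪x, v⟫) with hγ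
  have hγi : Integrable γ := GaussianFourier.integrable_cexp_neg_mul_sq_norm_add hb _ _
  have hγF : ∀ u, 𝓕 γ u = ((a / Real.pi : ℝ) : ℂ) ^ (Module.finrank ℝ V / 2 : ℂ) *
      ((Real.exp (-a * ‖u - x‖ ^ 2) : ℝ) : ℂ) := by
    intro u
    rw [hγ, fourier_gaussian_innerProductSpace' hb]
    have ha' : (a : ℂ) ≠ 0 := by exact_mod_cast ha.ne'
    have hp' : (Real.pi : ℂ) ≠ 0 := by exact_mod_cast hpi.ne'
    congr 1
    · congr 1; push_cast; field_simp
    · push_cast; congr 1; rw [norm_sub_rev]; field_simp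
  set Φ' : V → ℂ := fun u => expI ⟪ξ, u⟫ * Φ u with hΦ'
  have hΦi : Integrable Φ' := by
    refine Φ.integrable.bdd_mul (c := 1) (Continuous.aestronglyMeasurable (by
      have := continuous_expI; fun_prop)) (ae_of_all _ fun u => (norm_expI _).le)
  have hΦF : ∀ v, 𝓕 Φ' v = 𝓕 (Φ : V → ℂ) (v - ξ) := by
    intro v
    rw [fourier_eq_integral_expI, fourier_eq_integral_expI]
    congr 1; ext u
    rw [hΦ']
    simp only
    rw [← mul_assoc, ← expI_add, inner_sub_right, real_inner_comm u ξ]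
    congr 2; ring
  have key : ∫ v, 𝓕 Φ' v • γ v = ∫ u, Φ' u • 𝓕 γ u := by
    simpa using! (VectorFourier.integral_fourierIntegral_smul_eq_flip (L := innerₗ V)
      Real.continuous_fourierChar continuous_inner hΦi hγi)
  refine ⟨(((a / Real.pi : ℝ) : ℂ) ^ (Module.finrank ℝ V / 2 : ℂ))⁻¹, (norm_inv _).le, ?_⟩
  simp only [hΦF, hγF, smul_eq_mul] at key
  have hc : ((a / Real.pi : ℝ) : ℂ) ^ (Module.finrank ℝ V / 2 : ℂ) ≠ 0 := by
    rw [Complex.cpow_ne_zero_iff]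
    left
    exact_mod_cast (div_pos ha hpi).ne'
  rw [key, ← integral_const_mul, gaborTransform]
  congr 1; ext u
  rw [hΦ']
  field_simp

theorem SchwartzMap.exists_gaborTransform_decay {a : ℝ} (ha : 0 < a) (Φ : 𝓢(V, ℂ)) (N : ℕ) :
    ∃ C, 0 ≤ C ∧ ∀ x ξ, (1 + ‖x‖) ^ N * (1 + ‖ξ‖) ^ N * ‖gaborTransform a Φ x ξ‖ ≤ C := by
  obtain ⟨C₁, hC₁, h₁⟩ := Φ.exists_gauss_average_le (2 * N) ha
  have hb : 0 < Real.pi ^ 2 / a := by have := Real.pi_pos; positivity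
  set Ψ : 𝓢(V, ℂ) := 𝓕 Φ with hΨ
  have hΨc : ∀ v, Ψ v = 𝓕 (Φ : V → ℂ) v := fun v => by rw [hΨ, SchwartzMap.fourier_coe]
  obtain ⟨C₂, hC₂, h₂⟩ := Ψ.exists_gauss_average_le (2 * N) hb
  set k := ‖((a / Real.pi : ℝ) : ℂ) ^ (Module.finrank ℝ V / 2 : ℂ)‖⁻¹ with hk
  have hk0 : 0 ≤ k := by positivity
  refine ⟨C₁ + k * C₂, by positivity, fun x ξ => ?_⟩
  have e1 : (1 + ‖x‖) ^ (2 * N) * ‖gaborTransform a Φ x ξ‖ ≤ C₁ :=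
    (mul_le_mul_of_nonneg_left (norm_gaborTransform_le a Φ x ξ) (by positivity)).trans (h₁ x)
  have e2 : (1 + ‖ξ‖) ^ (2 * N) * ‖gaborTransform a Φ x ξ‖ ≤ k * C₂ := by
    obtain ⟨c, hc, hT⟩ := gaborTransform_eq_fourier ha Φ x ξ
    have e3 : ‖∫ v, 𝓕 (Φ : V → ℂ) (v - ξ) *
      Complex.exp (-((Real.pi ^ 2 / a : ℝ) : ℂ) * ‖v‖ ^ 2 + 2 * Real.pi * Complex.I * ⟪x, v⟫)‖ ≤
        ∫ u, ‖Ψ u‖ * Real.exp (-(Real.pi ^ 2 / a) * ‖u - -ξ‖ ^ 2) := by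
      refine (norm_integral_le_integral_norm _).trans (le_of_eq ?_)
      rw [← integral_sub_right_eq_self (fun u : V => ‖Ψ u‖ *
        Real.exp (-(Real.pi ^ 2 / a) * ‖u - -ξ‖ ^ 2)) ξ]
      congr 1; ext v
      rw [norm_mul, Complex.norm_exp, sub_neg_eq_add, sub_add_cancel, hΨc]
      congr 2
      have : (2 * Real.pi * Complex.I * (⟪x, v⟫ : ℝ) : ℂ) = ((2 * Real.pi * ⟪x, v⟫ : ℝ) : ℂ) * Complex.I := by
        push_cast; ring
      rw [this, ← Complex.ofReal_pow, ← Complex.ofReal_neg, ← Complex.ofReal_mul, Complex.add_re,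
        Complex.ofReal_re, Complex.re_ofReal_mul, Complex.I_re, mul_zero, add_zero]
    rw [hT, norm_mul]
    have h3 := h₂ (-ξ)
    rw [norm_neg] at h3
    calc _ ≤ (1 + ‖ξ‖) ^ (2 * N) * (k * ∫ u, ‖Ψ u‖ *
          Real.exp (-(Real.pi ^ 2 / a) * ‖u - -ξ‖ ^ 2)) := by gcongr
      _ = k * ((1 + ‖ξ‖) ^ (2 * N) * ∫ u, ‖Ψ u‖ *
          Real.exp (-(Real.pi ^ 2 / a) * ‖u - -ξ‖ ^ 2)) := by ring
      _ ≤ _ := by gcongr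
  have h0 := norm_nonneg (gaborTransform a Φ x ξ)
  -- Decay of order 2N in each variable separately gives order N jointly, since ab ≤ a² + b².
  have e3 : (1 + ‖x‖) ^ N * (1 + ‖ξ‖) ^ N ≤ (1 + ‖x‖) ^ (2 * N) + (1 + ‖ξ‖) ^ (2 * N) := by
    rw [mul_comm 2, pow_mul, pow_mul]
    nlinarith [sq_nonneg ((1 + ‖x‖) ^ N - (1 + ‖ξ‖) ^ N), sq_nonneg ((1 + ‖x‖) ^ N),
      sq_nonneg ((1 + ‖ξ‖) ^ N)]
  calc _ ≤ ((1 + ‖x‖) ^ (2 * N) + (1 + ‖ξ‖) ^ (2 * N)) * ‖gaborTransform a Φ x ξ‖ := by gcongr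
    _ ≤ _ := by rw [add_mul]; exact add_le_add e1 e2

theorem integrable_one_add_norm_pow_inv {W : Type*} [NormedAddCommGroup W] [NormedSpace ℝ W]
    [FiniteDimensional ℝ W] [MeasurableSpace W] [BorelSpace W] (μ : Measure W) [μ.IsAddHaarMeasure]
    {N : ℕ} (hN : Module.finrank ℝ W < N) : Integrable (fun v : W => ((1 + ‖v‖) ^ N)⁻¹) μ := by
  have := integrable_one_add_norm (μ := μ) (r := N) (E := W) (by exact_mod_cast hN)
  refine this.congr (ae_of_all _ fun v => ?_)
  simp only
  rw [Real.rpow_neg (by positivity), Real.rpow_natCast]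

/-- Fourier inversion for Φ times a translated Gaussian; the decay in ξ supplies the integrability
it needs. -/
theorem integral_gaborTransform_mul {a : ℝ} (ha : 0 < a) (Φ : 𝓢(V, ℂ)) (x w : V) :
    ∫ ξ, gaborTransform a Φ x ξ * expI (-⟪ξ, w⟫) = Φ w * ((Real.exp (-a * ‖w - x‖ ^ 2) : ℝ) : ℂ) := by
  set h : V → ℂ := fun u => Φ u * ((Real.exp (-a * ‖u - x‖ ^ 2) : ℝ) : ℂ) with hh
  have hc : Continuous h := Φ.continuous.mul (Complex.continuous_ofReal.comp (by fun_prop))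
  have hi : Integrable h := by
    refine Φ.integrable.mul_bdd (c := 1) (Continuous.aestronglyMeasurable (by fun_prop))
      (ae_of_all _ fun u => ?_)
    rw [Complex.norm_real, Real.norm_of_nonneg (Real.exp_pos _).le, Real.exp_le_one_iff, neg_mul,
      neg_nonpos]
    positivity
  have hT : ∀ ξ, 𝓕⁻ h ξ = gaborTransform a Φ x ξ := by
    intro ξ
    rw [fourierInv_eq_integral_expI, gaborTransform]
    congr 1; ext u
    rw [hh, real_inner_comm, mul_comm]
  have hTi : Integrable (𝓕⁻ h) := by
    obtain ⟨C, hC0, hC⟩ := Φ.exists_gaborTransform_decay ha (Module.finrank ℝ V + 1)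
    refine ((integrable_one_add_norm_pow_inv (W := V) volume (Nat.lt_succ_self _)).const_mul C).mono' ?_
      (ae_of_all _ fun ξ => ?_)
    · have : Continuous (𝓕 h) := VectorFourier.fourierIntegral_continuous
        Real.continuous_fourierChar continuous_inner hi
      rw [funext (Real.fourierInv_eq_fourier_neg h)]
      exact (this.comp continuous_neg).aestronglyMeasurable
    · rw [hT, ← div_eq_mul_inv, le_div_iff₀ (by positivity), mul_comm]
      refine le_trans ?_ (hC x ξ)
      gcongr
      exact le_mul_of_one_le_left (by positivity) (one_le_pow₀ (by linarith [norm_nonneg x]))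
  have hFi : Integrable (𝓕 h) := by
    have := hTi.comp_neg
    refine this.congr (ae_of_all _ fun ξ => ?_)
    simp only
    rw [Real.fourierInv_eq_fourier_neg, neg_neg]
  have := congrFun (hc.fourier_fourierInv_eq hi hFi) w
  rw [fourier_eq_integral_expI] at this
  refine Eq.trans ?_ this
  congr 1; ext ξ
  rw [← hT, mul_comm]

end Gabor

end

noncomputable section

open scoped NNReal Pointwise ContDiff FourierTransform

variable {d : ℕ}

/-! ### Reproducing formula for tempered distributions on phase space -/

theorem gaussAtomConj_eq (p q u : Phase d) :
    gaussAtomConj p q u =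
      ((Real.exp (-(Real.pi / 2) * phaseDot (u - p) (u - p)) : ℝ) : ℂ) * expI (-phaseDot q u) := by
  change Complex.exp (atomExponent p q u) = _
  rw [expI_eq, Complex.ofReal_exp, ← Complex.exp_add]
  congr 1
  simp only [atomExponent]
  push_cast; ring

theorem conj_gaussAtomConj (p q u : Phase d) :
    conj (gaussAtomConj p q u) = gaussAtomConj p (-q) u := by
  rw [gaussAtomConj_eq, gaussAtomConj_eq, map_mul, Complex.conj_ofReal, conj_expI]
  congr 2
  simp only [phaseDot, Prod.fst_neg, Prod.snd_neg, inner_neg_left]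
  ring

theorem conj_funSTFT_conj (Φ : Phase d → ℂ) (p q : Phase d) :
    conj (funSTFT (fun u => conj (Φ u)) p q) = funSTFT Φ p (-q) := by
  rw [funSTFT, funSTFT, ← integral_conj]
  congr 1; ext u
  rw [map_mul, Complex.conj_conj, conj_gaussAtomConj]

/-- The product carries the supremum norm. Results for inner product spaces are therefore applied on
`WithLp 2` and transported by its volume-preserving identification with phase space. -/
theorem WithLp.norm_sq_eq_phaseDot (v : WithLp 2 (Phase d)) :
    ‖v‖ ^ 2 = phaseDot v.ofLp v.ofLp := by
  rw [WithLp.prod_norm_sq_eq_of_L2, phaseDot, real_inner_self_eq_norm_sq, real_inner_self_eq_norm_sq]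
  rfl

theorem WithLp.inner_eq_phaseDot (v w : WithLp 2 (Phase d)) :
    (⟪v, w⟫ : ℝ) = phaseDot v.ofLp w.ofLp := rfl

theorem integral_comp_ofLp (G : Phase d → ℂ) :
    ∫ v : WithLp 2 (Phase d), G v.ofLp = ∫ u, G u :=
  (WithLp.volume_preserving_ofLp (U := Conf d) (V := Conf d)).integral_comp
    (MeasurableEquiv.toLp 2 (Phase d)).symm.measurableEmbedding G

/-- A Schwartz function on phase space as a function on the Euclidean phase space. -/
def SchwartzMap.toEuclidean (Φ : 𝓢(Phase d, ℂ)) : 𝓢(WithLp 2 (Phase d), ℂ) :=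
  SchwartzMap.compCLMOfContinuousLinearEquiv ℂ (WithLp.prodContinuousLinearEquiv 2 ℝ (Conf d) (Conf d)) Φ

theorem SchwartzMap.toEuclidean_apply (Φ : 𝓢(Phase d, ℂ)) (v : WithLp 2 (Phase d)) :
    Φ.toEuclidean v = Φ v.ofLp := rfl

theorem SchwartzMap.gaborTransform_toEuclidean (Φ : 𝓢(Phase d, ℂ)) (x ξ : WithLp 2 (Phase d)) :
    gaborTransform (Real.pi / 2) Φ.toEuclidean x ξ = funSTFT Φ x.ofLp (-ξ.ofLp) := by
  rw [funSTFT, ← integral_comp_ofLp, gaborTransform]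
  congr 1; ext v
  rw [SchwartzMap.toEuclidean_apply, WithLp.norm_sq_eq_phaseDot, WithLp.inner_eq_phaseDot,
    gaussAtomConj_eq, WithLp.ofLp_sub, mul_assoc]
  congr 3
  simp only [phaseDot, Prod.fst_neg, Prod.snd_neg, inner_neg_left]
  ring

theorem norm_ofLp_le (v : WithLp 2 (Phase d)) : ‖v.ofLp‖ ≤ ‖v‖ := by
  have h1 := norm_sq_le_fst_snd v.ofLp
  have h2 := WithLp.prod_norm_sq_eq_of_L2 v
  exact (pow_le_pow_iff_left₀ (norm_nonneg _) (norm_nonneg _) two_ne_zero).1 (h1.trans h2.ge)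

theorem SchwartzMap.exists_funSTFT_decay (Φ : 𝓢(Phase d, ℂ)) (N : ℕ) :
    ∃ C, 0 ≤ C ∧ ∀ p q, (1 + ‖p‖) ^ N * (1 + ‖q‖) ^ N * ‖funSTFT Φ p q‖ ≤ C := by
  obtain ⟨C, hC0, hC⟩ := Φ.toEuclidean.exists_gaborTransform_decay
    (a := Real.pi / 2) (by positivity) N
  refine ⟨C, hC0, fun p q => ?_⟩
  have h := hC (WithLp.toLp 2 p) (WithLp.toLp 2 (-q))
  rw [SchwartzMap.gaborTransform_toEuclidean, neg_neg] at h
  refine le_trans ?_ h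
  have h1 := norm_ofLp_le (WithLp.toLp 2 p)
  have h2 := norm_ofLp_le (WithLp.toLp 2 (-q))
  rw [norm_neg] at h2
  gcongr

theorem SchwartzMap.integral_funSTFT_mul (Φ : 𝓢(Phase d, ℂ)) (p w : Phase d) :
    ∫ q, funSTFT Φ p (-q) * gaussAtomConj p q w =
      Φ w * ((Real.exp (-Real.pi * phaseDot (w - p) (w - p)) : ℝ) : ℂ) := by
  have h := integral_gaborTransform_mul (a := Real.pi / 2) (by positivity) Φ.toEuclidean
    (WithLp.toLp 2 p) (WithLp.toLp 2 w)
  simp only [SchwartzMap.gaborTransform_toEuclidean, SchwartzMap.toEuclidean_apply,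
    WithLp.norm_sq_eq_phaseDot, WithLp.inner_eq_phaseDot, WithLp.ofLp_sub] at h
  rw [integral_comp_ofLp (fun q => funSTFT Φ p (-q) * expI (-phaseDot q w))] at h
  simp_rw [gaussAtomConj_eq, mul_left_comm]
  rw [integral_const_mul, h, mul_left_comm, ← Complex.ofReal_mul, ← Real.exp_add]
  congr 3; ring

theorem integral_exp_neg_pi_phaseDot (w : Phase d) :
    ∫ p, Real.exp (-Real.pi * phaseDot (w - p) (w - p)) = 1 := by
  have e0 : ∀ p, phaseDot (w - p) (w - p) = phaseDot (p - w) (p - w) := fun p => by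
    simp only [phaseDot, real_inner_self_eq_norm_sq, Prod.fst_sub, Prod.snd_sub, norm_sub_rev]
  simp_rw [e0]
  rw [integral_sub_right_eq_self (fun v : Phase d => Real.exp (-Real.pi * phaseDot v v))]
  have e : ∀ v : Phase d, Real.exp (-Real.pi * phaseDot v v) =
      (fun v : Conf d => Real.exp (-Real.pi * ‖v‖ ^ 2)) v.1 *
      (fun v : Conf d => Real.exp (-Real.pi * ‖v‖ ^ 2)) v.2 := by
    intro v
    rw [phaseDot, real_inner_self_eq_norm_sq, real_inner_self_eq_norm_sq, mul_add, Real.exp_add]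
  simp_rw [e]
  rw [Measure.volume_eq_prod, integral_prod_mul (L := ℝ) (fun v : Conf d => Real.exp (-Real.pi * ‖v‖ ^ 2))
    (fun v : Conf d => Real.exp (-Real.pi * ‖v‖ ^ 2)),
    GaussianFourier.integral_rexp_neg_mul_sq_norm Real.pi_pos]
  simp [Real.pi_ne_zero]

/-- Φ is viewed as a tempered distribution, for which joint continuity is already known. -/
theorem SchwartzMap.continuous_funSTFT (Φ : 𝓢(Phase d, ℂ)) :
    Continuous fun x : Phase d × Phase d => funSTFT Φ x.1 x.2 := by
  have h := continuous_symbolSTFT (SchwartzMap.toTemperedDistributionCLM (Phase d) ℂ volume Φ)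
  refine h.congr fun x => ?_
  refine (SchwartzMap.toTemperedDistributionCLM_apply_apply volume Φ _).trans ?_
  rw [funSTFT]
  congr 1; ext u
  rw [smul_eq_mul, mul_comm]

theorem one_add_norm_prod_le {W W' : Type*} [SeminormedAddCommGroup W] [SeminormedAddCommGroup W']
    (x : W × W') : 1 + ‖x‖ ≤ (1 + ‖x.1‖) * (1 + ‖x.2‖) := by
  have h1 := norm_nonneg x.1
  have h2 := norm_nonneg x.2
  have : ‖x‖ ≤ ‖x.1‖ + ‖x.2‖ := by
    rw [Prod.norm_def]; exact max_le (by linarith) (by linarith)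
  nlinarith [mul_nonneg h1 h2]

theorem SchwartzMap.integrable_pow_mul_funSTFT (Φ : 𝓢(Phase d, ℂ)) (M : ℕ) :
    Integrable (fun x : Phase d × Phase d => (1 + ‖x‖) ^ M * ‖funSTFT Φ x.1 (-x.2)‖)
      (volume.prod volume) := by
  obtain ⟨C, hC0, hC⟩ := Φ.exists_funSTFT_decay (M + (Module.finrank ℝ (Phase d) + 1))
  have hi := integrable_one_add_norm_pow_inv (W := Phase d) volume (Nat.lt_succ_self _)
  have hc : Continuous fun x : Phase d × Phase d => funSTFT Φ x.1 (-x.2) :=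
    Φ.continuous_funSTFT.comp (by fun_prop : Continuous fun x : Phase d × Phase d => (x.1, -x.2))
  refine ((hi.mul_prod hi).const_mul C).mono' (Continuous.aestronglyMeasurable (by fun_prop))
    (ae_of_all _ fun x => ?_)
  rw [norm_mul, norm_norm, Real.norm_of_nonneg (by positivity), ← mul_inv, ← div_eq_mul_inv,
    le_div_iff₀ (by positivity)]
  have h := hC x.1 (-x.2)
  rw [norm_neg] at h
  calc _ ≤ ((1 + ‖x.1‖) * (1 + ‖x.2‖)) ^ M * ‖funSTFT Φ x.1 (-x.2)‖ *
        ((1 + ‖x.1‖) ^ (Module.finrank ℝ (Phase d) + 1) *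
          (1 + ‖x.2‖) ^ (Module.finrank ℝ (Phase d) + 1)) := by
        gcongr
        exact one_add_norm_prod_le x
    _ = _ := by rw [mul_pow, pow_add, pow_add]; ring
    _ ≤ C := h

/-- Inversion in the frequency leaves Φ(w) Ψ(w - p)², and the integral over p is 1 because ‖Ψ‖₂ = 1.
-/
theorem SchwartzMap.apply_eq_integral_funSTFT (Φ : 𝓢(Phase d, ℂ)) (w : Phase d) :
    Φ w = ∫ x : Phase d × Phase d, funSTFT Φ x.1 (-x.2) * gaussAtomConj x.1 x.2 w
      ∂(volume.prod volume) := by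
  have hc : Continuous fun x : Phase d × Phase d => funSTFT Φ x.1 (-x.2) :=
    Φ.continuous_funSTFT.comp (by fun_prop : Continuous fun x : Phase d × Phase d => (x.1, -x.2))
  have hc2 : Continuous fun x : Phase d × Phase d => gaussAtomConj x.1 x.2 w := by
    have := continuous_expI
    simp only [gaussAtomConj_eq, phaseDot]
    fun_prop
  have hi : Integrable (fun x : Phase d × Phase d => funSTFT Φ x.1 (-x.2) * gaussAtomConj x.1 x.2 w)
      (volume.prod volume) := by
    refine (Φ.integrable_pow_mul_funSTFT 0).mono' (hc.mul hc2).aestronglyMeasurable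
      (ae_of_all _ fun x => ?_)
    rw [norm_mul, pow_zero, one_mul, gaussAtomConj_eq, norm_mul, norm_expI, mul_one, Complex.norm_real,
      Real.norm_of_nonneg (Real.exp_pos _).le]
    refine mul_le_of_le_one_right (norm_nonneg _) ?_
    rw [Real.exp_le_one_iff, phaseDot, real_inner_self_eq_norm_sq, real_inner_self_eq_norm_sq,
      neg_mul, neg_nonpos]
    positivity
  rw [integral_prod _ hi]
  simp only [Φ.integral_funSTFT_mul]
  rw [integral_const_mul, integral_complex_ofReal, integral_exp_neg_pi_phaseDot, Complex.ofReal_one,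
    mul_one]

/-- σ is applied under the integral of the inversion formula; rapid decay of the transform of Φ
beats the polynomial growth of the seminorms of the atoms. This makes the 𝒮'–𝒮 bracket an integral
of transforms, as in the M^∞–M¹ duality. -/
theorem tempered_eq_integral_symbolSTFT (σ : 𝓢'(Phase d, ℂ)) (Φ : 𝓢(Phase d, ℂ)) :
    Integrable (fun x : Phase d × Phase d => symbolSTFT σ x.1 x.2 * funSTFT Φ x.1 (-x.2)) ∧
    σ Φ = ∫ x : Phase d × Phase d, symbolSTFT σ x.1 x.2 * funSTFT Φ x.1 (-x.2) := by
  have hc : Continuous fun x : Phase d × Phase d => funSTFT Φ x.1 (-x.2) :=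
    Φ.continuous_funSTFT.comp (by fun_prop : Continuous fun x : Phase d × Phase d => (x.1, -x.2))
  have h := SchwartzMap.tempered_eq_integral (μ := (volume : Measure (Phase d × Phase d))) σ
    (θ := fun x : Phase d × Phase d => funSTFT Φ x.1 (-x.2) • gaussAtomConj x.1 x.2) (Θ := Φ)
    (hc.smul continuous_gaussAtomConj) ?_ Φ.apply_eq_integral_funSTFT
  · have e : ∀ x : Phase d × Phase d, σ (funSTFT Φ x.1 (-x.2) • gaussAtomConj x.1 x.2) =
        symbolSTFT σ x.1 x.2 * funSTFT Φ x.1 (-x.2) := by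
      intro x
      rw [map_smul, smul_eq_mul, mul_comm]; rfl
    simpa only [e] using h
  · intro k n
    obtain ⟨C, M, hC0, hC⟩ := exists_seminorm_gaussAtomConj_le (d := d) k n
    refine ((Φ.integrable_pow_mul_funSTFT M).const_mul C).mono' (Continuous.aestronglyMeasurable
      (((schwartz_withSeminorms ℝ (Phase d) ℂ).continuous_seminorm (k, n)).comp
        (hc.smul continuous_gaussAtomConj))) (ae_of_all _ fun x => ?_)
    have e : SchwartzMap.seminorm ℝ k n (funSTFT Φ x.1 (-x.2) • gaussAtomConj x.1 x.2) =
        ‖funSTFT Φ x.1 (-x.2)‖ * SchwartzMap.seminorm ℝ k n (gaussAtomConj x.1 x.2) :=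
      map_smul_eq_mul (SchwartzMap.seminorm ℂ k n) _ _
    rw [e, Real.norm_of_nonneg (by positivity)]
    calc _ ≤ ‖funSTFT Φ x.1 (-x.2)‖ * (C * (1 + ‖x‖) ^ M) := by gcongr; exact hC x
      _ = _ := by ring

theorem SchwartzMap.exists_stft_gauss_decay (f : 𝓢(Conf d, ℂ)) (N : ℕ) :
    ∃ C, 0 ≤ C ∧ ∀ z, (1 + ‖z‖) ^ N * ‖stft gaussConf f z‖ ≤ C := by
  obtain ⟨C, hC0, hC⟩ := f.exists_gaborTransform_decay Real.pi_pos N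
  refine ⟨C, hC0, fun z => ?_⟩
  have h := hC z.1 (-z.2)
  have e : gaborTransform Real.pi f z.1 (-z.2) = stft gaussConf f z := by
    rw [gaborTransform, stft_apply]
    congr 1; ext t
    rw [tfShift_apply, map_mul, conj_expI, conj_gaussConf, gaussConf_eq, inner_neg_left]
    ring
  rw [e, norm_neg] at h
  refine le_trans ?_ h
  rw [← mul_pow]
  gcongr
  exact one_add_norm_prod_le z

end

/-! ### The grand symbol: measurability and pointwise control -/

noncomputable section
open scoped NNReal Pointwise

variable {d : ℕ}

theorem forall_le_of_ae_le {X : Type*} [TopologicalSpace X] [MeasurableSpace X]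
    {μ : Measure X} [μ.IsOpenPosMeasure] {f : X → ℝ≥0∞} (hf : Continuous f) {c : ℝ≥0∞}
    (h : ∀ᵐ x ∂μ, f x ≤ c) (x : X) : f x ≤ c := by
  have hcl : IsClosed {x | f x ≤ c} := isClosed_le hf continuous_const
  have := (Measure.dense_of_ae h).closure_eq
  rw [hcl.closure_eq] at this
  exact (Set.ext_iff.mp this x).mpr (Set.mem_univ x)

/-- By continuity in z the essential supremum is a supremum of continuous functions, whence lower
semicontinuity and measurability in ζ. -/
theorem grandSymbol_eq_iSup (σ : 𝓢'(Phase d, ℂ)) (ζ : Phase d) :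
    grandSymbol σ ζ = ⨆ z, ‖symbolSTFT σ z ζ‖ₑ := by
  have hc : Continuous fun z => ‖symbolSTFT σ z ζ‖ₑ :=
    ((continuous_symbolSTFT σ).comp (Continuous.prodMk_left ζ)).enorm
  refine le_antisymm (essSup_le_of_ae_le _ (ae_of_all _ fun z =>
    le_iSup (fun z => ‖symbolSTFT σ z ζ‖ₑ) z)) (iSup_le fun z => ?_)
  exact forall_le_of_ae_le hc (ae_le_essSup (μ := volume)) z

theorem enorm_symbolSTFT_le_grandSymbol (σ : 𝓢'(Phase d, ℂ)) (z ζ : Phase d) :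
    ‖symbolSTFT σ z ζ‖ₑ ≤ grandSymbol σ ζ := by
  rw [grandSymbol_eq_iSup]
  exact le_iSup (fun z => ‖symbolSTFT σ z ζ‖ₑ) z

theorem lowerSemicontinuous_grandSymbol (σ : 𝓢'(Phase d, ℂ)) :
    LowerSemicontinuous (grandSymbol σ) := by
  have : grandSymbol σ = fun ζ => ⨆ z, ‖symbolSTFT σ z ζ‖ₑ := funext (grandSymbol_eq_iSup σ)
  rw [this]
  exact lowerSemicontinuous_iSup fun z =>
    ((continuous_symbolSTFT σ).comp (Continuous.prodMk_right z)).enorm.lowerSemicontinuous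

theorem continuous_symplJ : Continuous (symplJ (d := d)) := by unfold symplJ; fun_prop

theorem measurable_grandSymbol_symplJ (σ : 𝓢'(Phase d, ℂ)) :
    Measurable fun D => grandSymbol σ (symplJ D) :=
  (lowerSemicontinuous_grandSymbol σ).measurable.comp continuous_symplJ.measurable

theorem measurePreserving_symplJ :
    MeasurePreserving (symplJ (d := d)) volume volume :=
  ((MeasurePreserving.id (volume : Measure (Conf d))).prod
    (Measure.measurePreserving_neg (volume : Measure (Conf d)))).comp
    (Measure.measurePreserving_swap (μ := (volume : Measure (Conf d))) (ν := (volume : Measure (Conf d))))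

theorem symplJ_surjective (ζ : Phase d) : symplJ (-ζ.2, ζ.1) = ζ := by simp [symplJ]

section

variable {Λ : Submodule ℤ (Phase d)} [DiscreteTopology Λ] [IsZLattice ℝ Λ]
  {𝒜 : SolidConvAlgebra Λ} {C : Set (Phase d)}

/-- For fixed z the transform is continuous in the frequency, so an almost everywhere bound holds
everywhere. -/
theorem AEDom.memMInfty (hC : IsAddFundamentalDomain Λ C volume) {σ : 𝓢'(Phase d, ℂ)}
    (h : AEDom 𝒜 C fun D => grandSymbol σ (symplJ D)) : MemMInfty σ := by
  obtain ⟨K, hK⟩ := h.ae_le_const hC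
  refine ⟨K, fun z ζ => ?_⟩
  have hc : Continuous fun D => ‖symbolSTFT σ z (symplJ D)‖ₑ :=
    ((continuous_symbolSTFT σ).comp ((Continuous.prodMk_right z).comp continuous_symplJ)).enorm
  have := forall_le_of_ae_le hc (c := K) (hK.mono fun D hD =>
    (enorm_symbolSTFT_le_grandSymbol σ z _).trans hD) (-ζ.2, ζ.1)
  rw [symplJ_surjective] at this
  rw [← coe_nnnorm]
  exact_mod_cast this

theorem memM1_tfShift (hC : IsAddFundamentalDomain Λ C volume) (hCb : Bornology.IsBounded C)
    {g : Conf d → ℂ} (hg : MemLp g 2) (hF : Dom 𝒜 (fun z => ‖stft gaussConf g z‖ₑ))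
    (z : Phase d) : MemM1 (tfShift z g) := by
  refine ⟨memLp_tfShift hg z, (stronglyMeasurable_stft' (memLp_tfShift hg z).1
    memLp_gaussConf.1).aestronglyMeasurable, ?_⟩
  change ∫⁻ s, ‖stft gaussConf (tfShift z g) s‖ₑ < ∞
  simp only [enorm_stft_tfShift_right]
  rw [lintegral_sub_right_eq_self (fun s => ‖stft gaussConf g s‖ₑ)]
  exact (hF.aeDom hC hCb).lintegral_lt_top hC hCb

end

/-! ### Off-diagonal decay of the Gabor matrix -/

/-- The autocorrelation `y ↦ ∫ F(s) F(s + y) ds` of a nonnegative function. -/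
def autocorr (F : Phase d → ℝ≥0∞) (y : Phase d) : ℝ≥0∞ := ∫⁻ s, F s * F (s + y)

theorem measurable_autocorr {F : Phase d → ℝ≥0∞} (hF : Measurable F) : Measurable (autocorr F) := by
  refine Measurable.lintegral_prod_right (f := fun y s => F s * F (s + y)) ?_
  fun_prop

theorem Dom.autocorr {Λ : Submodule ℤ (Phase d)} [DiscreteTopology Λ] [IsZLattice ℝ Λ]
    {𝒜 : SolidConvAlgebra Λ} {C : Set (Phase d)} (hC : IsAddFundamentalDomain Λ C volume)
    (hCb : Bornology.IsBounded C) {F : Phase d → ℝ≥0∞} (hF : Dom 𝒜 F) : Dom 𝒜 (autocorr F) := by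
  refine ((hF.aeDom hC hCb).conv hC hCb hF.comp_neg).comp_neg.mono fun y => le_of_eq ?_
  refine lintegral_congr fun s => ?_
  congr 2; abel

theorem measurable_funSTFT {W : Phase d → ℂ} (hW : StronglyMeasurable W) :
    StronglyMeasurable fun x : Phase d × Phase d => funSTFT W x.1 x.2 := by
  refine StronglyMeasurable.integral_prod_right
    (f := fun (x : Phase d × Phase d) (u : Phase d) => W u * gaussAtomConj x.1 x.2 u) ?_
  refine (hW.comp_measurable measurable_snd).mul (Continuous.stronglyMeasurable ?_)
  change Continuous fun q : (Phase d × Phase d) × Phase d =>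
    Complex.exp (atomExponent q.1.1 q.1.2 q.2)
  unfold atomExponent phaseDot
  fun_prop

/-- Total mass of the mixing kernel in the pairing of symbols and Wigner distributions. -/
def pairingMass (d : ℕ) : ℝ≥0∞ :=
  ENNReal.ofReal (wignerConst d) * ∫⁻ v : Phase d, ENNReal.ofReal (mixWeight v)

theorem pairingMass_ne_top : pairingMass d ≠ ∞ := by
  refine ENNReal.mul_ne_top ENNReal.ofReal_ne_top ?_
  rw [← ofReal_integral_eq_lintegral_ofReal integrable_mixWeight
    (ae_of_all _ fun v => (mixWeight_pos v).le)]
  exact ENNReal.ofReal_ne_top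

/-- For fixed v the substitution s = p + v + D/2 - w turns the second argument into s + (w - z - D).
The p-integral does not depend on v, so the mixing weight contributes only its mass. -/
theorem lintegral_mix_mul {m F : Phase d → ℝ≥0∞} (hm : Measurable m) (hF : Measurable F)
    (z w D : Phase d) :
    ∫⁻ p, ∫⁻ v, m v * (F (p + v + (1 / 2 : ℝ) • D - w) * F (p + v - (1 / 2 : ℝ) • D - z)) =
      (∫⁻ v, m v) * autocorr F (w - z - D) := by
  rw [lintegral_lintegral_swap, ← lintegral_mul_const _ hm]
  · refine lintegral_congr fun v => ?_
    rw [lintegral_const_mul _ (by fun_prop), autocorr,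
      ← lintegral_add_right_eq_self (fun s => F s * F (s + (w - z - D)))
        (v + (1 / 2 : ℝ) • D - w)]
    congr 1
    refine lintegral_congr fun p => ?_
    congr 2
    · abel
    · module
  · refine Measurable.aemeasurable ((hm.comp measurable_snd).mul ?_)
    fun_prop

theorem lintegral_enorm_funSTFT_wigner_le {g : Conf d → ℂ} (hg : MemLp g 2) (z w D : Phase d) :
    ∫⁻ p, ‖funSTFT (wigner (tfShift w g) (tfShift z g)) p (symplJ D)‖ₑ ≤
      pairingMass d * autocorr (fun s => ‖stft gaussConf g s‖ₑ) (w - z - D) := by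
  have hFm : Measurable fun s => ‖stft gaussConf g s‖ₑ :=
    (stronglyMeasurable_stft' hg.1 memLp_gaussConf.1).enorm
  rw [pairingMass, mul_assoc, ← lintegral_mix_mul continuous_mixWeight.measurable.ennreal_ofReal hFm,
    ← lintegral_const_mul' _ _ ENNReal.ofReal_ne_top]
  refine lintegral_mono fun p => ?_
  refine (enorm_funSTFT_wigner_le (memLp_tfShift hg z) (memLp_tfShift hg w) p D).trans_eq ?_
  simp only [enorm_stft_tfShift_right]

theorem lintegral_prod_symplJ {f : Phase d × Phase d → ℝ≥0∞} (hf : Measurable f) :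
    ∫⁻ x, f x = ∫⁻ D, ∫⁻ p, f (p, symplJ D) := by
  have h₁ : ∫⁻ x, f x = ∫⁻ ζ, ∫⁻ p, f (p, ζ) := lintegral_prod_symm' _ hf
  exact h₁.trans (measurePreserving_symplJ.lintegral_comp hf.lintegral_prod_left').symm

theorem lintegral_enorm_symbolSTFT_mul_le (σ : 𝓢'(Phase d, ℂ)) {V : Phase d → ℂ}
    (hV : Measurable fun p => ‖V p‖ₑ) (ζ : Phase d) :
    ∫⁻ p, ‖symbolSTFT σ p ζ‖ₑ * ‖V p‖ₑ ≤ grandSymbol σ ζ * ∫⁻ p, ‖V p‖ₑ := by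
  rw [← lintegral_const_mul _ hV]
  exact lintegral_mono fun p => mul_le_mul_left (enorm_symbolSTFT_le_grandSymbol σ p _) _

theorem enorm_integral_symbolSTFT_le (σ : 𝓢'(Phase d, ℂ)) {W : Phase d → ℂ}
    (hW : StronglyMeasurable W) {K : Phase d → ℝ≥0∞}
    (hK : ∀ D, ∫⁻ p, ‖funSTFT W p (symplJ D)‖ₑ ≤ K D) :
    ‖∫ p : Phase d × Phase d, symbolSTFT σ p.1 p.2 * conj (funSTFT W p.1 p.2)‖ₑ ≤
    ∫⁻ D, grandSymbol σ (symplJ D) * K D := by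
  have hs : Measurable fun p : Phase d × Phase d => ‖funSTFT W p.1 p.2‖ₑ :=
    (measurable_funSTFT hW).enorm
  have hm : Measurable fun p : Phase d × Phase d => ‖symbolSTFT σ p.1 p.2‖ₑ * ‖funSTFT W p.1 p.2‖ₑ :=
    (continuous_symbolSTFT σ).enorm.measurable.mul hs
  have h₁ : ‖∫ p : Phase d × Phase d, symbolSTFT σ p.1 p.2 * conj (funSTFT W p.1 p.2)‖ₑ ≤
      ∫⁻ p : Phase d × Phase d, ‖symbolSTFT σ p.1 p.2‖ₑ * ‖funSTFT W p.1 p.2‖ₑ := by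
    refine (enorm_integral_le_lintegral_enorm _).trans_eq (lintegral_congr fun p => ?_)
    rw [enorm_mul, enorm_conj]
  refine h₁.trans ((lintegral_prod_symplJ hm).trans_le (lintegral_mono fun D => ?_))
  refine (lintegral_enorm_symbolSTFT_mul_le σ ?_ (symplJ D)).trans ?_
  · exact hs.of_uncurry_right (f := fun p ζ => ‖funSTFT W p ζ‖ₑ)
  · exact mul_le_mul_right (hK D) _

/-- Off-diagonal decay of the Gabor matrix of a symbol in the Sjöstrand class. -/
theorem AEDom.exists_entry_bound {Λ : Submodule ℤ (Phase d)} [DiscreteTopology Λ] [IsZLattice ℝ Λ]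
    {𝒜 : SolidConvAlgebra Λ} {C : Set (Phase d)} (hC : IsAddFundamentalDomain Λ C volume)
    (hCb : Bornology.IsBounded C) {g : Conf d → ℂ} (hg : MemLp g 2)
    (hF : Dom 𝒜 (fun z => ‖stft gaussConf g z‖ₑ)) {σ : 𝓢'(Phase d, ℂ)}
    (h : AEDom 𝒜 C fun D => grandSymbol σ (symplJ D)) :
    ∃ B : Phase d → ℝ≥0, Measurable B ∧ Dom 𝒜 (fun y => B y) ∧ ∀ z w : Phase d, ∃ c : ℂ,
      IsWeylEntry σ (tfShift z g) (tfShift w g) c ∧ ‖c‖ₑ ≤ B (w - z) := by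
  set F : Phase d → ℝ≥0∞ := fun s => ‖stft gaussConf g s‖ₑ with hFd
  have hFm : Measurable F := (stronglyMeasurable_stft' hg.1 memLp_gaussConf.1).enorm
  set B₀ : Phase d → ℝ≥0∞ := fun y => pairingMass d *
    ∫⁻ D, grandSymbol σ (symplJ D) * autocorr F (y - D) with hB₀
  have hdom : Dom 𝒜 B₀ := by
    have := (h.conv hC hCb (hF.autocorr hC hCb)).const_mul (pairingMass d).toNNReal
    rwa [ENNReal.coe_toNNReal pairingMass_ne_top] at this
  have hmeas : Measurable B₀ := by
    refine Measurable.const_mul ?_ _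
    refine Measurable.lintegral_prod_right
      (f := fun y D => grandSymbol σ (symplJ D) * autocorr F (y - D)) ?_
    exact ((measurable_grandSymbol_symplJ σ).comp measurable_snd).mul
      ((measurable_autocorr hFm).comp (measurable_fst.sub measurable_snd))
  -- Domination on the ball of radius ‖y‖ around the lattice point 0 already gives finiteness at y.
  have hfin : ∀ y, B₀ y ≠ ∞ := by
    intro y
    obtain ⟨b, -, hb⟩ := hdom ‖y‖
    exact ((hb 0 y (by simp)).trans_lt ENNReal.coe_lt_top).ne
  refine ⟨fun y => (B₀ y).toNNReal, hmeas.ennreal_toNNReal, ?_, fun z w => ⟨_, Or.inr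
    ⟨h.memMInfty hC, memM1_tfShift hC hCb hg hF z, memM1_tfShift hC hCb hg hF w, rfl⟩, ?_⟩⟩
  · simpa only [ENNReal.coe_toNNReal (hfin _)] using hdom
  · rw [ENNReal.coe_toNNReal (hfin _)]
    refine (enorm_integral_symbolSTFT_le σ (stronglyMeasurable_wigner (memLp_tfShift hg z)
      (memLp_tfShift hg w)) (lintegral_enorm_funSTFT_wigner_le hg z w)).trans_eq ?_
    simp only [hB₀]
    rw [← lintegral_const_mul' _ _ pairingMass_ne_top]
    refine lintegral_congr fun D => ?_
    ring

end

noncomputable section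
open scoped NNReal Pointwise

variable {d : ℕ}

/-! ### Polynomial weights -/

theorem one_add_enorm_add_le {W : Type*} [NormedAddCommGroup W] (a b : W) :
    1 + ‖a + b‖ₑ ≤ (1 + ‖a‖ₑ) * (1 + ‖b‖ₑ) := by
  calc 1 + ‖a + b‖ₑ ≤ 1 + (‖a‖ₑ + ‖b‖ₑ) := by gcongr; exact enorm_add_le a b
    _ ≤ 1 + (‖a‖ₑ + ‖b‖ₑ) + ‖a‖ₑ * ‖b‖ₑ := le_self_add
    _ = _ := by ring

theorem one_add_enorm_pow {W : Type*} [NormedAddCommGroup W] (N : ℕ) (a : W) :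
    (1 + ‖a‖ₑ) ^ N = ENNReal.ofReal ((1 + ‖a‖) ^ N) := by
  rw [ENNReal.ofReal_pow (by positivity), ENNReal.ofReal_add zero_le_one (norm_nonneg _),
    ofReal_norm, ENNReal.ofReal_one]

/-- With Y and X the two arguments in the mixture formula, p = (Y + X)/2 - v and D = Y - X. A
polynomial weight at (p, D) is thus distributed over v and the two transforms. -/
theorem one_add_enorm_phase_le (p v D : Phase d) :
    1 + ‖(p, D)‖ₑ ≤ (1 + ‖v‖ₑ) * (1 + ‖p + v + (1 / 2 : ℝ) • D‖ₑ) *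
      (1 + ‖p + v - (1 / 2 : ℝ) • D‖ₑ) := by
  set Y := p + v + (1 / 2 : ℝ) • D with hY
  set X := p + v - (1 / 2 : ℝ) • D with hX
  have h₁ : ‖p‖ ≤ ‖v‖ + ‖Y‖ + ‖X‖ := by
    have : p = (1 / 2 : ℝ) • Y + (1 / 2 : ℝ) • X - v := by rw [hY, hX]; module
    calc ‖p‖ = ‖(1 / 2 : ℝ) • Y + (1 / 2 : ℝ) • X - v‖ := by rw [← this]
      _ ≤ ‖(1 / 2 : ℝ) • Y‖ + ‖(1 / 2 : ℝ) • X‖ + ‖v‖ :=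
        (norm_sub_le _ _).trans (by gcongr; exact norm_add_le _ _)
      _ ≤ _ := by
        rw [norm_smul, norm_smul, Real.norm_of_nonneg (by norm_num)]
        linarith [norm_nonneg X, norm_nonneg Y]
  have h₂ : ‖D‖ ≤ ‖v‖ + ‖Y‖ + ‖X‖ := by
    have : D = Y - X := by rw [hY, hX]; module
    calc ‖D‖ = ‖Y - X‖ := by rw [← this]
      _ ≤ ‖Y‖ + ‖X‖ := norm_sub_le _ _
      _ ≤ _ := by linarith [norm_nonneg v]
  have h₃ : ‖(p, D)‖ₑ ≤ ‖v‖ₑ + ‖Y‖ₑ + ‖X‖ₑ := by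
    have : ‖(p, D)‖ ≤ ‖v‖ + ‖Y‖ + ‖X‖ := max_le h₁ h₂
    rw [← ofReal_norm, ← ofReal_norm, ← ofReal_norm, ← ofReal_norm,
      ← ENNReal.ofReal_add (norm_nonneg _) (norm_nonneg _),
      ← ENNReal.ofReal_add (by positivity) (norm_nonneg _)]
    exact ENNReal.ofReal_le_ofReal this
  calc 1 + ‖(p, D)‖ₑ ≤ 1 + (‖v‖ₑ + ‖Y‖ₑ + ‖X‖ₑ) := by gcongr
    _ ≤ 1 + (‖v‖ₑ + ‖Y‖ₑ + ‖X‖ₑ) + (‖v‖ₑ * ‖Y‖ₑ + ‖v‖ₑ * ‖X‖ₑ + ‖Y‖ₑ * ‖X‖ₑ +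
        ‖v‖ₑ * ‖Y‖ₑ * ‖X‖ₑ) := le_self_add
    _ = _ := by ring

/-- A nonnegative function multiplied by the polynomial weight `(1 + |s|)^N`. -/
def polyMul (N : ℕ) (F : Phase d → ℝ≥0∞) (s : Phase d) : ℝ≥0∞ := (1 + ‖s‖ₑ) ^ N * F s

theorem measurable_polyMul (N : ℕ) {F : Phase d → ℝ≥0∞} (hF : Measurable F) :
    Measurable (polyMul N F) := by
  unfold polyMul
  exact ((measurable_const.add measurable_enorm).pow_const N).mul hF

/-- The Gaussian mixing weight in `ℝ≥0∞`. -/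
def mixENN (v : Phase d) : ℝ≥0∞ := ENNReal.ofReal (mixWeight v)

theorem measurable_mixENN : Measurable (mixENN (d := d)) :=
  continuous_mixWeight.measurable.ennreal_ofReal

theorem lintegral_polyMul_mixENN_ne_top (N : ℕ) : ∫⁻ v : Phase d, polyMul N mixENN v ≠ ∞ := by
  have hb : (0 : ℝ) < 2 * Real.pi / 3 := by positivity
  set c : ℝ := N.factorial * Real.exp (1 + 1 / (2 * (2 * Real.pi / 3)))
  have hc : 0 ≤ c := by positivity
  set G : Conf d → ℝ := fun x => Real.exp (-(2 * Real.pi / 3 / 2) * ‖x‖ ^ 2) with hG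
  have key : ∀ v : Phase d, (1 + ‖v‖) ^ N * mixWeight v ≤
      (c * c) * (Real.exp (-(2 * Real.pi / 3 / 2) * ‖v.1‖ ^ 2) *
        Real.exp (-(2 * Real.pi / 3 / 2) * ‖v.2‖ ^ 2)) := by
    intro v
    have h₁ := one_add_pow_mul_exp_neg_mul_sq_le N hb (norm_nonneg v.1)
    have h₂ := one_add_pow_mul_exp_neg_mul_sq_le N hb (norm_nonneg v.2)
    have h₃ : 1 + ‖v‖ ≤ (1 + ‖v.1‖) * (1 + ‖v.2‖) := by
      have : ‖v‖ ≤ ‖v.1‖ + ‖v.2‖ :=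
        max_le (le_add_of_nonneg_right (norm_nonneg _)) (le_add_of_nonneg_left (norm_nonneg _))
      nlinarith [mul_nonneg (norm_nonneg v.1) (norm_nonneg v.2)]
    calc _ ≤ ((1 + ‖v.1‖) * (1 + ‖v.2‖)) ^ N * mixWeight v := by
          gcongr
          exact (mixWeight_pos v).le
      _ = ((1 + ‖v.1‖) ^ N * Real.exp (-(2 * Real.pi / 3) * ‖v.1‖ ^ 2)) *
          ((1 + ‖v.2‖) ^ N * Real.exp (-(2 * Real.pi / 3) * ‖v.2‖ ^ 2)) := by
          rw [mul_pow, mixWeight]; ring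
      _ ≤ _ := mul_le_mul h₁ h₂ (by positivity) (by positivity)
      _ = _ := by ring
  have hint := ((integrable_gauss_prod (d := d) (a := 2 * Real.pi / 3 / 2) (by positivity)).const_mul
    (c * c))
  refine ne_top_of_le_ne_top hint.lintegral_lt_top.ne (lintegral_mono fun v => ?_)
  rw [polyMul, one_add_enorm_pow, mixENN, ← ENNReal.ofReal_mul (by positivity)]
  exact ENNReal.ofReal_le_ofReal (key v)

theorem lintegral_autocorr_sub {F : Phase d → ℝ≥0∞} (hF : Measurable F) (y : Phase d) :
    ∫⁻ D, autocorr F (y - D) = (∫⁻ s, F s) * ∫⁻ s, F s := by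
  simp only [autocorr]
  rw [lintegral_lintegral_swap, ← lintegral_mul_const _ hF]
  · have : (volume : Measure (Phase d)).IsNegInvariant :=
      ⟨((Measure.measurePreserving_neg (volume : Measure (Conf d))).prod
        (Measure.measurePreserving_neg (volume : Measure (Conf d)))).map_eq⟩
    refine lintegral_congr fun s => ?_
    rw [lintegral_const_mul _ (by fun_prop)]
    congr 1
    have : ∀ D : Phase d, s + (y - D) = (s + y) - D := fun D => by abel
    simp only [this]
    exact lintegral_sub_left_eq_self F (s + y)
  · refine Measurable.aemeasurable ?_
    simp only [Function.uncurry_def]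
    fun_prop

section

variable {g : Conf d → ℂ}

theorem enorm_funSTFT_wigner_tfShift_le (hg : MemLp g 2) (a b p D : Phase d) :
    ‖funSTFT (wigner (tfShift a g) (tfShift b g)) p (symplJ D)‖ₑ ≤
      ENNReal.ofReal (wignerConst d) * ∫⁻ v, mixENN v *
        (‖stft gaussConf g (p + v + (1 / 2 : ℝ) • D - a)‖ₑ *
          ‖stft gaussConf g (p + v - (1 / 2 : ℝ) • D - b)‖ₑ) := by
  refine (enorm_funSTFT_wigner_le (memLp_tfShift hg b) (memLp_tfShift hg a) p D).trans_eq ?_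
  simp only [enorm_stft_tfShift_right, mixENN]

theorem measurable_enorm_stft_gauss (hg : MemLp g 2) :
    Measurable fun s => ‖stft gaussConf g s‖ₑ :=
  (stronglyMeasurable_stft' hg.1 memLp_gaussConf.1).enorm

theorem one_add_enorm_pow_le_sub (N : ℕ) (y a : Phase d) :
    (1 + ‖y‖ₑ) ^ N ≤ (1 + ‖y - a‖ₑ) ^ N * (1 + ‖a‖ₑ) ^ N := by
  rw [← mul_pow]
  gcongr
  have := one_add_enorm_add_le (y - a) a
  rwa [sub_add_cancel] at this

theorem one_add_enorm_pow_le_sub' (N : ℕ) (y a : Phase d) :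
    (1 + ‖a‖ₑ) ^ N ≤ (1 + ‖y - a‖ₑ) ^ N * (1 + ‖y‖ₑ) ^ N := by
  rw [← mul_pow]
  gcongr
  have := one_add_enorm_add_le (-(y - a)) y
  rw [enorm_neg] at this
  convert this using 3
  abel

theorem lintegral_weight_funSTFT_wigner_le (hg : MemLp g 2) (N : ℕ) (a b D : Phase d) :
    ∫⁻ p, (1 + ‖(p, D)‖ₑ) ^ N *
        ‖funSTFT (wigner (tfShift a g) (tfShift b g)) p (symplJ D)‖ₑ ≤
      ENNReal.ofReal (wignerConst d) * ((1 + ‖a‖ₑ) ^ N * (1 + ‖b‖ₑ) ^ N) *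
        ((∫⁻ v : Phase d, polyMul N mixENN v) *
          autocorr (polyMul N fun s => ‖stft gaussConf g s‖ₑ) (a - b - D)) := by
  have hF := measurable_enorm_stft_gauss hg
  set F : Phase d → ℝ≥0∞ := fun s => ‖stft gaussConf g s‖ₑ with hFd
  have hab : (1 + ‖a‖ₑ) ^ N * (1 + ‖b‖ₑ) ^ N ≠ ∞ := by simp [ENNReal.mul_eq_top, ENNReal.pow_eq_top_iff]
  rw [← lintegral_mix_mul (measurable_polyMul N measurable_mixENN) (measurable_polyMul N hF),
    ← lintegral_const_mul' _ _ (ENNReal.mul_ne_top ENNReal.ofReal_ne_top hab)]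
  refine lintegral_mono fun p => ?_
  calc _ ≤ (1 + ‖(p, D)‖ₑ) ^ N * (ENNReal.ofReal (wignerConst d) * ∫⁻ v, mixENN v *
        (F (p + v + (1 / 2 : ℝ) • D - a) * F (p + v - (1 / 2 : ℝ) • D - b))) := by
        gcongr
        exact enorm_funSTFT_wigner_tfShift_le hg a b p D
    _ = ENNReal.ofReal (wignerConst d) * ∫⁻ v, (1 + ‖(p, D)‖ₑ) ^ N * (mixENN v *
        (F (p + v + (1 / 2 : ℝ) • D - a) * F (p + v - (1 / 2 : ℝ) • D - b))) := by
        rw [lintegral_const_mul' _ _ (by simp [ENNReal.pow_eq_top_iff])]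
        ring
    _ ≤ ENNReal.ofReal (wignerConst d) * ∫⁻ v, ((1 + ‖a‖ₑ) ^ N * (1 + ‖b‖ₑ) ^ N) *
        (polyMul N mixENN v * (polyMul N F (p + v + (1 / 2 : ℝ) • D - a) *
          polyMul N F (p + v - (1 / 2 : ℝ) • D - b))) := by
        refine mul_le_mul_right (lintegral_mono fun v => ?_) _
        have h₁ := one_add_enorm_phase_le p v D
        set Y := p + v + (1 / 2 : ℝ) • D
        set X := p + v - (1 / 2 : ℝ) • D
        calc (1 + ‖(p, D)‖ₑ) ^ N * (mixENN v * (F (Y - a) * F (X - b))) ≤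
              ((1 + ‖v‖ₑ) ^ N * ((1 + ‖Y - a‖ₑ) ^ N * (1 + ‖a‖ₑ) ^ N) *
                ((1 + ‖X - b‖ₑ) ^ N * (1 + ‖b‖ₑ) ^ N)) *
              (mixENN v * (F (Y - a) * F (X - b))) := by
              refine mul_le_mul_left ?_ _
              calc _ ≤ ((1 + ‖v‖ₑ) * (1 + ‖Y‖ₑ) * (1 + ‖X‖ₑ)) ^ N := by gcongr
                _ = (1 + ‖v‖ₑ) ^ N * (1 + ‖Y‖ₑ) ^ N * (1 + ‖X‖ₑ) ^ N := by rw [mul_pow, mul_pow]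
                _ ≤ _ := by
                  gcongr
                  · exact one_add_enorm_pow_le_sub N Y a
                  · exact one_add_enorm_pow_le_sub N X b
          _ = _ := by simp only [polyMul]; ring
    _ = _ := by
        rw [lintegral_const_mul' _ _ hab]
        ring

theorem lintegral_symbolSTFT_mul_funSTFT_wigner_le (hg : MemLp g 2) {σ : 𝓢'(Phase d, ℂ)} {N : ℕ}
    {c : ℝ≥0} (hσ : ∀ p D, ‖symbolSTFT σ p (symplJ D)‖ₑ ≤ c * (1 + ‖(p, D)‖ₑ) ^ N)
    (a b : Phase d) :
    ∫⁻ x : Phase d × Phase d, ‖symbolSTFT σ x.1 x.2‖ₑ *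
        ‖funSTFT (wigner (tfShift a g) (tfShift b g)) x.1 x.2‖ₑ ≤
      c * (ENNReal.ofReal (wignerConst d) * ((1 + ‖a‖ₑ) ^ N * (1 + ‖b‖ₑ) ^ N)) *
        ((∫⁻ v : Phase d, polyMul N mixENN v) *
          ((∫⁻ s, polyMul N (fun s => ‖stft gaussConf g s‖ₑ) s) *
            ∫⁻ s, polyMul N (fun s => ‖stft gaussConf g s‖ₑ) s)) := by
  have hW : StronglyMeasurable (wigner (tfShift a g) (tfShift b g)) :=
    stronglyMeasurable_wigner (memLp_tfShift hg b) (memLp_tfShift hg a)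
  have hs : Measurable fun x : Phase d × Phase d =>
      ‖funSTFT (wigner (tfShift a g) (tfShift b g)) x.1 x.2‖ₑ := (measurable_funSTFT hW).enorm
  have hm : Measurable fun x : Phase d × Phase d => ‖symbolSTFT σ x.1 x.2‖ₑ *
      ‖funSTFT (wigner (tfShift a g) (tfShift b g)) x.1 x.2‖ₑ :=
    (continuous_symbolSTFT σ).enorm.measurable.mul hs
  have hF := measurable_polyMul N (measurable_enorm_stft_gauss hg)
  rw [lintegral_prod_symplJ hm, ← lintegral_autocorr_sub hF (a - b),
    ← lintegral_const_mul' _ _ (lintegral_polyMul_mixENN_ne_top N),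
    ← lintegral_const_mul']
  · refine lintegral_mono fun D => ?_
    calc _ ≤ ∫⁻ p, c * ((1 + ‖(p, D)‖ₑ) ^ N *
          ‖funSTFT (wigner (tfShift a g) (tfShift b g)) p (symplJ D)‖ₑ) := by
          refine lintegral_mono fun p => ?_
          rw [← mul_assoc]
          exact mul_le_mul_left (hσ p D) _
      _ = c * ∫⁻ p, ((1 + ‖(p, D)‖ₑ) ^ N *
          ‖funSTFT (wigner (tfShift a g) (tfShift b g)) p (symplJ D)‖ₑ) :=
          lintegral_const_mul' _ _ ENNReal.coe_ne_top
      _ ≤ c * _ := mul_le_mul_right (lintegral_weight_funSTFT_wigner_le hg N a b D) _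
      _ = _ := by ring
  · simp [ENNReal.mul_eq_top, ENNReal.pow_eq_top_iff]

variable {Λ : Submodule ℤ (Phase d)} [DiscreteTopology Λ] [IsZLattice ℝ Λ]

/-- At a fixed point (z, D) the weights in the lattice points move onto F and the mixing Gaussian.
The sums over the two indices then factor and are bounded by K each, uniformly in v. -/
theorem tsum_weight_funSTFT_wigner_lt_top (hg : MemLp g 2) {N : ℕ} {K : ℝ≥0}
    (hK : ∀ x : Phase d, ∑' m : Λ, polyMul N (fun s => ‖stft gaussConf g s‖ₑ) (x - m) ≤ K)
    (u z D : Phase d) :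
    ∑' q : Λ × Λ, (1 + ‖(q.1 : Phase d) + u‖ₑ) ^ N * (1 + ‖(q.2 : Phase d)‖ₑ) ^ N *
      ‖funSTFT (wigner (tfShift ((q.1 : Phase d) + u) g) (tfShift (q.2 : Phase d) g)) z
        (symplJ D)‖ₑ < ∞ := by
  have hF := measurable_enorm_stft_gauss hg
  set F : Phase d → ℝ≥0∞ := fun s => ‖stft gaussConf g s‖ₑ with hFd
  let Y : Phase d → Phase d := fun v => z + v + (1 / 2 : ℝ) • D
  let X : Phase d → Phase d := fun v => z + v - (1 / 2 : ℝ) • D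
  have hY : Measurable Y := by fun_prop
  have hX : Measurable X := by fun_prop
  have hw : ∀ v : Phase d, (1 + ‖v‖ₑ) ^ N ≠ ∞ := fun v => by simp [ENNReal.pow_eq_top_iff]
  set A : ℝ≥0∞ := (1 + ‖z + (1 / 2 : ℝ) • D‖ₑ) ^ N * (1 + ‖z - (1 / 2 : ℝ) • D‖ₑ) ^ N with hA
  have hAt : A ≠ ∞ := ENNReal.mul_ne_top (hw _) (hw _)
  have hterm : ∀ q : Λ × Λ, (1 + ‖(q.1 : Phase d) + u‖ₑ) ^ N * (1 + ‖(q.2 : Phase d)‖ₑ) ^ N *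
      ‖funSTFT (wigner (tfShift ((q.1 : Phase d) + u) g) (tfShift (q.2 : Phase d) g)) z
        (symplJ D)‖ₑ ≤ ENNReal.ofReal (wignerConst d) * ∫⁻ v, A * (polyMul (N + N) mixENN v *
          (polyMul N F (Y v - u - q.1) * polyMul N F (X v - q.2))) := by
    intro q
    refine (mul_le_mul_right (enorm_funSTFT_wigner_tfShift_le hg _ _ z D) _).trans ?_
    rw [mul_left_comm, ← lintegral_const_mul' _ _ (ENNReal.mul_ne_top (hw _) (hw _))]
    refine mul_le_mul_right (lintegral_mono fun v => ?_) _
    calc _ ≤ (((1 + ‖Y v - (q.1 + u)‖ₑ) ^ N *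
            ((1 + ‖z + (1 / 2 : ℝ) • D‖ₑ) ^ N * (1 + ‖v‖ₑ) ^ N)) *
          ((1 + ‖X v - q.2‖ₑ) ^ N *
            ((1 + ‖z - (1 / 2 : ℝ) • D‖ₑ) ^ N * (1 + ‖v‖ₑ) ^ N))) *
          (mixENN v * (F (Y v - (q.1 + u)) * F (X v - q.2))) := by
          refine mul_le_mul_left (mul_le_mul' ?_ ?_) _
          · refine (one_add_enorm_pow_le_sub' N (Y v) _).trans ?_
            gcongr
            rw [← mul_pow]
            gcongr
            convert one_add_enorm_add_le (z + (1 / 2 : ℝ) • D) v using 3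
            simp only [Y]; abel
          · refine (one_add_enorm_pow_le_sub' N (X v) _).trans ?_
            gcongr
            rw [← mul_pow]
            gcongr
            convert one_add_enorm_add_le (z - (1 / 2 : ℝ) • D) v using 3
            simp only [X]; abel
      _ = _ := by
          have : Y v - u - q.1 = Y v - (q.1 + u) := by abel
          rw [this]
          simp only [polyMul, hA, pow_add]; ring
  refine (ENNReal.tsum_le_tsum hterm).trans_lt ?_
  have hPF := measurable_polyMul N hF
  rw [ENNReal.tsum_mul_left, ← lintegral_tsum fun q => by
    refine (measurable_const.mul ((measurable_polyMul _ measurable_mixENN).mul ?_)).aemeasurable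
    exact (hPF.comp ((hY.sub_const _).sub_const _)).mul (hPF.comp (hX.sub_const _))]
  refine ENNReal.mul_lt_top ENNReal.ofReal_lt_top ?_
  calc _ ≤ ∫⁻ v, A * (polyMul (N + N) mixENN v * (K * K)) := by
        refine lintegral_mono fun v => ?_
        simp only [ENNReal.tsum_mul_left]
        rw [ENNReal.tsum_prod (f := fun k m : Λ => polyMul N F (Y v - u - k) * polyMul N F (X v - m))]
        simp only [ENNReal.tsum_mul_left, ENNReal.tsum_mul_right]
        gcongr
        · exact hK _
        · exact hK _
    _ = A * ((∫⁻ v : Phase d, polyMul (N + N) mixENN v) * (K * K)) := by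
        rw [lintegral_const_mul' _ _ hAt, lintegral_mul_const' _ _ (by simp [ENNReal.mul_eq_top])]
    _ < ∞ := by
        refine (ENNReal.mul_ne_top hAt (ENNReal.mul_ne_top (lintegral_polyMul_mixENN_ne_top _) ?_)).lt_top
        simp [ENNReal.mul_eq_top]

theorem lintegral_lt_top_of_tsum_le {C : Set (Phase d)} (hC : IsAddFundamentalDomain Λ C volume)
    (hCb : Bornology.IsBounded C) {F : Phase d → ℝ≥0∞} {K : ℝ≥0}
    (hF : Measurable F) (hK : ∀ x : Phase d, ∑' m : Λ, F (x - m) ≤ K) : ∫⁻ s, F s < ∞ := by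
  rw [hC.lintegral_eq_tsum'', ← lintegral_tsum fun l => by
    exact (hF.comp (measurable_const_add (l : Phase d))).aemeasurable]
  calc _ ≤ ∫⁻ _ in C, (K : ℝ≥0∞) := by
        refine lintegral_mono fun x => ?_
        refine le_trans (le_of_eq ?_) (hK x)
        rw [← (Equiv.neg Λ).tsum_eq]
        refine tsum_congr fun l => ?_
        congr 1
        simp [Submodule.vadd_def, sub_eq_add_neg, add_comm]
    _ < ∞ := by
        rw [setLIntegral_const]
        exact ENNReal.mul_lt_top ENNReal.coe_lt_top hCb.measure_lt_top

end

end

noncomputable section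
open scoped NNReal Pointwise

variable {d : ℕ}

/-! ### Reconstruction of a symbol from its Gabor matrix -/

/-- The bracket of a distribution with a Wigner distribution, as an integral of transforms. -/
def wignerBracket (σ : 𝓢'(Phase d, ℂ)) (f h : Conf d → ℂ) : ℂ :=
  ∫ p : Phase d × Phase d, symbolSTFT σ p.1 p.2 * conj (funSTFT (wigner h f) p.1 p.2)

/-- Both ways of defining an entry yield the same number: the Schwartz case by the reproducing
formula, and because Wigner distributions ignore null sets. -/
theorem IsWeylEntry.eq_wignerBracket {σ : 𝓢'(Phase d, ℂ)} {f h : Conf d → ℂ} {c : ℂ}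
    (hc : IsWeylEntry σ f h c) : c = wignerBracket σ f h := by
  rcases hc with ⟨f₀, h₀, hf, hh, Φ, hΦ, rfl⟩ | ⟨-, -, -, rfl⟩
  · rw [(tempered_eq_integral_symbolSTFT σ Φ).2, wignerBracket, wigner_congr hf hh]
    have e : wigner h₀ f₀ = fun u => conj (Φ u) := funext fun u => by
      rw [hΦ, Complex.conj_conj]
    simp only [e, conj_funSTFT_conj]
  · rfl

variable {Λ : Submodule ℤ (Phase d)} [DiscreteTopology Λ] [IsZLattice ℝ Λ] {g : Conf d → ℂ}

theorem exists_tsum_one_add_norm_pow_inv_le :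
    ∃ (r : ℕ) (K : ℝ≥0), ∀ x : Phase d,
      ∑' m : Λ, ENNReal.ofReal (((1 + ‖x - m‖) ^ r)⁻¹) ≤ K := by
  classical
  obtain ⟨R₀, hR₀, hcov⟩ := exists_lattice_norm_sub_le Λ
  set r := Module.finrank ℤ Λ + 1
  have hs : Summable fun l : Λ => ((1 + ‖(l : Phase d)‖) ^ r)⁻¹ := by
    refine Summable.of_nonneg_of_le (fun _ => by positivity) (fun l => ?_)
      ((hasSum_ite_eq (0 : Λ) (1 : ℝ)).summable.add
        (ZLattice.summable_norm_sub_inv_pow Λ r (Nat.lt_succ_self _) 0))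
    by_cases hl : l = 0
    · subst hl
      simp [r]
    · have : 0 < ‖(l : Phase d)‖ := norm_pos_iff.mpr (by simpa using hl)
      simp only [hl, if_false, zero_add, sub_zero, inv_pow]
      gcongr
      linarith
  refine ⟨r, (∑' l : Λ, ENNReal.ofReal ((1 + R₀) ^ r * ((1 + ‖(l : Phase d)‖) ^ r)⁻¹)).toNNReal,
    fun x => ?_⟩
  rw [ENNReal.coe_toNNReal (hs.mul_left _).tsum_ofReal_ne_top]
  obtain ⟨α, hα⟩ := hcov x
  rw [← (Equiv.subLeft α).tsum_eq]
  refine ENNReal.tsum_le_tsum fun l => ENNReal.ofReal_le_ofReal ?_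
  rw [Equiv.subLeft_apply, ← div_eq_mul_inv, le_div_iff₀ (by positivity), mul_comm,
    ← div_eq_mul_inv, div_le_iff₀ (by positivity), ← mul_pow]
  gcongr
  have h₁ : ‖(l : Phase d)‖ ≤ ‖x - α‖ + ‖x - ((α - l : Λ) : Phase d)‖ := by
    calc ‖(l : Phase d)‖ = ‖(x - ((α - l : Λ) : Phase d)) - (x - α)‖ := by
          congr 1; push_cast; abel
      _ ≤ _ := (norm_sub_le _ _).trans_eq (add_comm _ _)
  nlinarith [norm_nonneg (x - ((α - l : Λ) : Phase d)), norm_nonneg (x - α)]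

/-- One defined entry with input g decides the regime. Either g agrees almost everywhere with a
Schwartz function, so F absorbs the polynomial growth of the tempered σ, or σ is in M^∞ and N = 0
suffices. -/
theorem exists_growth_of_entries {𝒜 : SolidConvAlgebra Λ}
    (hF : Dom 𝒜 (fun z => ‖stft gaussConf g z‖ₑ)) {σ : 𝓢'(Phase d, ℂ)} {h : Conf d → ℂ} {c : ℂ}
    (hc : IsWeylEntry σ g h c) :
    ∃ (N : ℕ) (c K : ℝ≥0), (∀ p D, ‖symbolSTFT σ p (symplJ D)‖ₑ ≤ c * (1 + ‖(p, D)‖ₑ) ^ N) ∧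
      ∀ x : Phase d, ∑' m : Λ, polyMul N (fun s => ‖stft gaussConf g s‖ₑ) (x - m) ≤ K := by
  rcases hc with ⟨f₀, -, hf, -, -⟩ | ⟨⟨M, hM⟩, -⟩
  · obtain ⟨c, N, hc0, hcN⟩ := exists_norm_symbolSTFT_le σ
    obtain ⟨r, K, hK⟩ := exists_tsum_one_add_norm_pow_inv_le (Λ := Λ)
    obtain ⟨B, hB0, hB⟩ := f₀.exists_stft_gauss_decay (N + r)
    rw [stft_congr hf (ae_eq_refl _)]
    refine ⟨N, c.toNNReal, B.toNNReal * K, fun p D => ?_, fun x => ?_⟩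
    · rw [one_add_enorm_pow, ← ENNReal.ofReal, ← ENNReal.ofReal_mul hc0, ← ofReal_norm]
      refine ENNReal.ofReal_le_ofReal ((hcN (p, symplJ D)).trans_eq ?_)
      have : ‖symplJ D‖ = ‖D‖ := by
        simp only [symplJ, Prod.norm_def, norm_neg, max_comm]
      have : ‖(p, symplJ D)‖ = ‖(p, D)‖ := congrArg (max ‖p‖) this
      rw [this]
    · push_cast
      refine le_trans ?_ (mul_le_mul_right (hK x) _)
      rw [← ENNReal.tsum_mul_left]
      refine ENNReal.tsum_le_tsum fun m => ?_
      rw [polyMul, one_add_enorm_pow, ← ofReal_norm, ← ENNReal.ofReal_mul (by positivity),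
        ← ENNReal.ofReal, ← ENNReal.ofReal_mul hB0]
      refine ENNReal.ofReal_le_ofReal ?_
      rw [← div_eq_mul_inv, le_div_iff₀ (by positivity)]
      refine le_trans (le_of_eq ?_) (hB (x - m))
      rw [pow_add]; ring
  · obtain ⟨K, hK⟩ := hF.tsum_le_const
    refine ⟨0, M.toNNReal, K, fun p D => ?_, fun x => ?_⟩
    · rw [pow_zero, mul_one, ← ofReal_norm]
      exact ENNReal.ofReal_le_ofReal (hM p (symplJ D))
    · simpa only [polyMul, pow_zero, one_mul] using hK x

/-- The conjugated Parseval identity expands the transform of the atom at (z, jD). Integration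
against 𝒱_Ψσ gives matrix entries term by term, and the reproducing formula identifies the total
with 𝒱_Ψσ(z, jD). -/
theorem hasSum_symbolSTFT {C : Set (Phase d)} (hC : IsAddFundamentalDomain Λ C volume)
    (hCb : Bornology.IsBounded C) (hg : MemLp g 2) (hframe : IsTightGaborFrame Λ g)
    {σ : 𝓢'(Phase d, ℂ)} {N : ℕ} {c K : ℝ≥0}
    (hσ : ∀ p D, ‖symbolSTFT σ p (symplJ D)‖ₑ ≤ c * (1 + ‖(p, D)‖ₑ) ^ N)
    (hK : ∀ x : Phase d, ∑' m : Λ, polyMul N (fun s => ‖stft gaussConf g s‖ₑ) (x - m) ≤ K)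
    (u z D : Phase d) :
    HasSum (fun q : Λ × Λ =>
      wignerBracket σ (tfShift (q.2 : Phase d) g) (tfShift ((q.1 : Phase d) + u) g) *
        funSTFT (wigner (tfShift ((q.1 : Phase d) + u) g) (tfShift (q.2 : Phase d) g)) z (symplJ D))
      (symbolSTFT σ z (symplJ D)) := by
  set W : Λ × Λ → Phase d → ℂ := fun q =>
    wigner (tfShift ((q.1 : Phase d) + u) g) (tfShift (q.2 : Phase d) g) with hWd
  have hW : ∀ q, StronglyMeasurable (W q) := fun q =>
    stronglyMeasurable_wigner (memLp_tfShift hg _) (memLp_tfShift hg _)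
  have hWm : ∀ q, StronglyMeasurable fun x : Phase d × Phase d => funSTFT (W q) x.1 x.2 :=
    fun q => measurable_funSTFT (hW q)
  set T : Λ × Λ → Phase d × Phase d → ℂ := fun q x =>
    (symbolSTFT σ x.1 x.2 * conj (funSTFT (W q) x.1 x.2)) * funSTFT (W q) z (symplJ D) with hTd
  have hT : ∀ q, StronglyMeasurable (T q) := fun q =>
    ((continuous_symbolSTFT σ).stronglyMeasurable.mul
      (Complex.continuous_conj.comp_stronglyMeasurable (hWm q))).mul_const _
  have hF := measurable_polyMul N (measurable_enorm_stft_gauss hg)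
  set I : ℝ≥0∞ := ∫⁻ s, polyMul N (fun s => ‖stft gaussConf g s‖ₑ) s with hI
  have hIt : I ≠ ∞ := (lintegral_lt_top_of_tsum_le hC hCb hF hK).ne
  set B : ℝ≥0∞ := c * ENNReal.ofReal (wignerConst d) *
    ((∫⁻ v : Phase d, polyMul N mixENN v) * (I * I)) with hB
  have hBt : B ≠ ∞ := ENNReal.mul_ne_top (ENNReal.mul_ne_top ENNReal.coe_ne_top ENNReal.ofReal_ne_top)
    (ENNReal.mul_ne_top (lintegral_polyMul_mixENN_ne_top N) (ENNReal.mul_ne_top hIt hIt))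
  have hlim : ∀ x : Phase d × Phase d, HasSum (fun q => T q x)
      (symbolSTFT σ x.1 x.2 * funSTFT (gaussAtomConj z (symplJ D)) x.1 (-x.2)) := by
    intro x
    obtain ⟨D', hD'⟩ : ∃ D', symplJ D' = x.2 := ⟨_, symplJ_surjective x.2⟩
    have h := (hframe.hasSum_funSTFT_wigner hg u x.1 D' z D).map
      (starRingEnd ℂ) Complex.continuous_conj
    rw [hD'] at h
    have e : conj (∫ w, conj (gaussAtomConj z (symplJ D) w) * gaussAtomConj x.1 x.2 w) =
        funSTFT (gaussAtomConj z (symplJ D)) x.1 (-x.2) := by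
      rw [funSTFT, ← integral_conj]
      congr 1; ext w
      rw [map_mul, Complex.conj_conj, conj_gaussAtomConj]
    rw [e] at h
    refine (h.mul_left (symbolSTFT σ x.1 x.2)).congr_fun fun q => ?_
    simp only [hTd, hWd, Function.comp_apply, map_mul, Complex.conj_conj]
    ring
  have hsum := hasSum_integral_of_tsum_enorm_le (fun q => (hT q).aestronglyMeasurable
    (μ := (volume : Measure (Phase d × Phase d)))) hlim (fun x => le_rfl) (by
    rw [lintegral_tsum fun q => (hT q).aestronglyMeasurable.enorm]
    -- The entry with index (k, m) grows at most like (1 + |k + u|)^N (1 + |m|)^N, which the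
    -- transforms at the fixed point (z, D) absorb.
    have hle : ∀ q : Λ × Λ, ∫⁻ x, ‖T q x‖ₑ ≤ B * ((1 + ‖(q.1 : Phase d) + u‖ₑ) ^ N *
        (1 + ‖(q.2 : Phase d)‖ₑ) ^ N * ‖funSTFT (W q) z (symplJ D)‖ₑ) := by
      intro q
      simp only [hTd, enorm_mul, enorm_conj]
      rw [lintegral_mul_const' _ _ enorm_ne_top]
      refine (mul_le_mul_left (lintegral_symbolSTFT_mul_funSTFT_wigner_le hg hσ _ _) _).trans_eq ?_
      rw [hB]; ring
    refine ne_top_of_le_ne_top ?_ (ENNReal.tsum_le_tsum hle)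
    rw [ENNReal.tsum_mul_left]
    exact ENNReal.mul_ne_top hBt (tsum_weight_funSTFT_wigner_lt_top hg hK u z D).ne)
  rw [← (tempered_eq_integral_symbolSTFT σ (gaussAtomConj z (symplJ D))).2] at hsum
  refine hsum.congr_fun fun q => ?_
  simp only [hTd]
  rw [integral_mul_const]
  rfl

/-- The reconstruction is estimated term by term. After the mixture formula the lattice sum has
arguments X and Y - u, whose difference is free of z and v, so a single sequence bounds the supremum
over z. -/
theorem dom_grandSymbol {C : Set (Phase d)} (hC : IsAddFundamentalDomain Λ C volume)
    (hCb : Bornology.IsBounded C) {𝒜 : SolidConvAlgebra Λ} (hg : MemLp g 2)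
    (hframe : IsTightGaborFrame Λ g) (hF : Dom 𝒜 (fun z => ‖stft gaussConf g z‖ₑ))
    {σ : 𝓢'(Phase d, ℂ)} {u : Phase d} {h : Λ → ℝ≥0} (hh : 𝒜.Has h)
    (hent : ∀ k m : Λ, ∃ c : ℂ,
      IsWeylEntry σ (tfShift (m : Phase d) g) (tfShift ((k : Phase d) + u) g) c ∧
        ‖c‖ₑ ≤ h (k - m)) :
    Dom 𝒜 fun D => grandSymbol σ (symplJ D) := by
  have hFm := measurable_enorm_stft_gauss hg
  have hbr : ∀ k m : Λ, ‖wignerBracket σ (tfShift (m : Phase d) g)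
      (tfShift ((k : Phase d) + u) g)‖ₑ ≤ h (k - m) := fun k m => by
    obtain ⟨c, hc, hcb⟩ := hent k m
    rwa [← hc.eq_wignerBracket]
  obtain ⟨N, c, K, hσ, hK⟩ : ∃ (N : ℕ) (c K : ℝ≥0),
      (∀ p D, ‖symbolSTFT σ p (symplJ D)‖ₑ ≤ c * (1 + ‖(p, D)‖ₑ) ^ N) ∧
      ∀ x : Phase d, ∑' m : Λ, polyMul N (fun s => ‖stft gaussConf g s‖ₑ) (x - m) ≤ K := by
    -- For m = 0 the input function is g itself.
    obtain ⟨c, hc, -⟩ := hent 0 0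
    rw [Submodule.coe_zero, tfShift_zero] at hc
    exact exists_growth_of_entries hF hc
  set F : Phase d → ℝ≥0∞ := fun s => ‖stft gaussConf g s‖ₑ with hFd
  -- Entries sit at k + u, so the natural variable is D + u; domination is invariant under
  -- translation.
  suffices hmain : Dom 𝒜 fun D => grandSymbol σ (symplJ (D + u)) by
    simpa only [neg_add_cancel_right] using hmain.comp_add (-u)
  intro R
  obtain ⟨b, hb, hbd⟩ := hF.tsum_tsum_le hF hh R
  refine ⟨fun l => (pairingMass d).toNNReal * b l, hb.const_mul _, fun l D hD => ?_⟩
  push_cast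
  rw [ENNReal.coe_toNNReal pairingMass_ne_top, grandSymbol_eq_iSup]
  refine iSup_le fun z => ?_
  let Y : Phase d → Phase d := fun v => z + v + (1 / 2 : ℝ) • (D + u)
  let X : Phase d → Phase d := fun v => z + v - (1 / 2 : ℝ) • (D + u)
  have hs := hasSum_symbolSTFT hC hCb hg hframe hσ hK u z (D + u)
  calc _ ≤ ∑' q : Λ × Λ, ENNReal.ofReal (wignerConst d) * ∫⁻ v, mixENN v *
        (F (X v - q.2) * F (Y v - u - q.1) * h (q.1 - q.2)) := by
        rw [← hs.tsum_eq]
        refine enorm_tsum_le_tsum_enorm.trans (ENNReal.tsum_le_tsum fun q => ?_)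
        rw [enorm_mul]
        refine (mul_le_mul' (hbr q.1 q.2)
          (enorm_funSTFT_wigner_tfShift_le hg _ _ z (D + u))).trans_eq ?_
        rw [mul_left_comm, ← lintegral_const_mul' _ _ ENNReal.coe_ne_top]
        congr 1
        refine lintegral_congr fun v => ?_
        have : Y v - u - q.1 = Y v - (q.1 + u) := by abel
        rw [this]
        simp only [hFd, X, Y]
        ring
    _ = ENNReal.ofReal (wignerConst d) * ∫⁻ v, mixENN v * ∑' m : Λ, ∑' k : Λ,
        F (X v - m) * F (Y v - u - k) * h (k - m) := by
        rw [ENNReal.tsum_mul_left, ← lintegral_tsum]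
        · congr 1
          refine lintegral_congr fun v => ?_
          rw [ENNReal.tsum_mul_left, ENNReal.tsum_comm,
            ENNReal.tsum_prod (f := fun k m : Λ => F (X v - m) * F (Y v - u - k) * h (k - m))]
        · intro q
          refine (measurable_mixENN.mul (((hFm.comp ?_).mul (hFm.comp ?_)).mul_const _)).aemeasurable
          · fun_prop
          · fun_prop
    _ ≤ ENNReal.ofReal (wignerConst d) * ∫⁻ v : Phase d, mixENN v * b l := by
        refine mul_le_mul_right (lintegral_mono fun v => mul_le_mul_right (hbd l _ _ ?_) _) _
        convert hD using 2
        simp only [X, Y]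
        module
    _ = _ := by
        rw [lintegral_mul_const _ measurable_mixENN, pairingMass, mul_assoc]
        rfl

/-- A generic point of a fundamental domain at which an almost everywhere bound on all the cells
holds simultaneously. -/
theorem AEDom.exists_generic {C : Set (Phase d)} {𝒜 : SolidConvAlgebra Λ}
    (hC : IsAddFundamentalDomain Λ C volume) {F : Phase d → ℝ≥0∞} (hF : AEDom 𝒜 C F) :
    ∃ (u : Phase d) (a : Λ → ℝ≥0), 𝒜.Has a ∧ ∀ l : Λ, F (l + u) ≤ a l := by
  obtain ⟨a, ha, haF⟩ := hF
  have h₁ : ∀ l : Λ, ∀ᵐ y : Phase d, y ∈ (fun u => (l : Phase d) + u) '' C → F y ≤ a l := by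
    intro l
    have hnull : NullMeasurableSet ((fun u => (l : Phase d) + u) '' C) volume := by
      rw [Set.image_add_left]
      exact hC.nullMeasurableSet.preimage (measurePreserving_add_left _ _).quasiMeasurePreserving
    exact (ae_restrict_iff'₀ hnull).mp (haF l)
  -- All cells and all translations into C are treated at once: the m that brings y into C depends
  -- on y, and countability keeps the exceptional set null.
  have h₂ : ∀ᵐ y : Phase d, ∀ l m : Λ, (m : Phase d) + y ∈ C → F (l + (m + y)) ≤ a l := by
    rw [ae_all_iff]; intro l
    rw [ae_all_iff]; intro m
    have := (measurePreserving_add_left (volume : Measure (Phase d))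
      ((l : Phase d) + m)).quasiMeasurePreserving.ae (h₁ l)
    filter_upwards [this] with y hy hm
    rw [← add_assoc]
    exact hy ⟨_, hm, by simp only [add_assoc]⟩
  obtain ⟨y, hy, m, hm⟩ := (h₂.and hC.ae_covers).exists
  exact ⟨(m : Phase d) + y, a, ha, fun l => hy l m hm⟩

end

/-! ### The equivalence -/

theorem mainTheorem2 (d : ℕ)
    (Λ : Submodule ℤ (Phase d)) [DiscreteTopology Λ] [IsZLattice ℝ Λ]
    (C : Set (Phase d)) (hC : IsAddFundamentalDomain Λ C volume)
    (hCb : Bornology.IsBounded C) (hC0 : (0 : Phase d) ∈ C)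
    (𝒜 : SolidConvAlgebra Λ)
    (g : Conf d → ℂ) (hg : MemLp g 2)
    (hgA : MemAmalgam 𝒜 C (fun z => ‖stft g g z‖ₑ))
    (hframe : IsTightGaborFrame Λ g)
    (σ : 𝓢'(Phase d, ℂ)) :
    List.TFAE [
      MemSjostrand 𝒜 C σ,
      ∃ H : Phase d → ℝ, MemAmalgam 𝒜 C (fun z => ‖H z‖ₑ) ∧
        ∀ z w : Phase d, ∃ c : ℂ,
          IsWeylEntry σ (tfShift z g) (tfShift w g) c ∧ ‖c‖ ≤ H (w - z),
      ∃ h : Λ → ℝ, (fun l => (h l : ℂ)) ∈ 𝒜.carrier ∧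
        ∀ l m : Λ, ∃ c : ℂ,
          IsWeylEntry σ (tfShift (m : Phase d) g) (tfShift (l : Phase d) g) c ∧
            ‖c‖ ≤ h (l - m)] := by
  have hF := dom_stft_gauss hC hCb hg hgA.aeDom hframe
  -- The common core of both converses: entries with outputs on the shifted lattice Λ + u and inputs
  -- on Λ determine membership.
  have of_entries : ∀ {u : Phase d} {h : Λ → NNReal}, 𝒜.Has h → (∀ k m : Λ, ∃ c : ℂ,
      IsWeylEntry σ (tfShift (m : Phase d) g) (tfShift ((k : Phase d) + u) g) c ∧
        ‖c‖ₑ ≤ h (k - m)) → MemSjostrand 𝒜 C σ := fun hh hent =>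
    ((dom_grandSymbol hC hCb hg hframe hF hh hent).aeDom hC hCb).memAmalgam
      (measurable_grandSymbol_symplJ σ).aemeasurable
  tfae_have 1 → 2 := by
    intro hσ
    obtain ⟨B, hBm, hB, hent⟩ := hσ.aeDom.exists_entry_bound hC hCb hg hF
    have e : ∀ y, ‖(B y : ℝ)‖ₑ = B y := fun y => by
      rw [← ofReal_norm, Real.norm_of_nonneg (NNReal.coe_nonneg _), ENNReal.ofReal_coe_nnreal]
    refine ⟨fun y => B y, ?_, fun z w => ?_⟩
    · simp only [e]
      exact (hB.aeDom hC hCb).memAmalgam hBm.coe_nnreal_ennreal.aemeasurable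
    · obtain ⟨c, hc, hcB⟩ := hent z w
      exact ⟨c, hc, by exact_mod_cast hcB⟩
  tfae_have 1 → 3 := by
    intro hσ
    obtain ⟨B, -, hB, hent⟩ := hσ.aeDom.exists_entry_bound hC hCb hg hF
    -- Radius 0: the bound is sampled at the lattice points themselves, where domination holds
    -- pointwise.
    obtain ⟨b, hb, hBb⟩ := hB 0
    refine ⟨fun l => b l, hb, fun l m => ?_⟩
    obtain ⟨c, hc, hcB⟩ := hent m l
    refine ⟨c, hc, ?_⟩
    have := hcB.trans (hBb (l - m) ((l : Phase d) - m) (by simp))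
    exact_mod_cast this
  tfae_have 2 → 1 := by
    rintro ⟨H, hH, hent⟩
    -- The amalgam norm does not see the values of H on the null set Λ, so H is sampled on Λ + u for
    -- a generic u.
    obtain ⟨u, a, ha, hau⟩ := hH.aeDom.exists_generic hC
    refine of_entries (u := u) ha fun k m => ?_
    obtain ⟨c, hc, hcH⟩ := hent m (k + u)
    refine ⟨c, hc, le_trans ?_ (hau (k - m))⟩
    have e : (k : Phase d) + u - m = ((k - m : Λ) : Phase d) + u := by push_cast; abel
    rw [e] at hcH
    rw [enorm_le_iff_norm_le]
    exact hcH.trans (le_abs_self _)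
  tfae_have 3 → 1 := by
    rintro ⟨h, hh, hent⟩
    refine of_entries (u := 0) (SolidConvAlgebra.has_of_mem hh) fun k m => ?_
    obtain ⟨c, hc, hch⟩ := hent k m
    rw [add_zero]
    refine ⟨c, hc, ?_⟩
    rw [← enorm_eq_nnnorm, enorm_le_iff_norm_le, Complex.norm_real]
    exact hch.trans (le_abs_self _)
  tfae_finish
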